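/- Let $n\in\mathbb N$, let $\mathbb D^n\subset\mathbb C^n$ be the open unit polydisc, and let $0<\alpha<1$. Let $C^\alpha(\mathbb D^n)$ be the space of Hölder-$\alpha$ functions $f:\mathbb D^n\to\mathbb C$ with norm $\|f\|_{C^\alpha}=\sup_{z}|f(z)|+\sup_{z\ne w}|f(z)-f(w)|/|z-w|^\alpha$, and let $Z^\alpha_{(0,1)}(\mathbb D^n)$ be the space of $(0,1)$-forms $g=\sum_{j=1}^n g_j\,d\bar z_j$ with $g_j\in C^\alpha(\mathbb D^n)$ that are $\bar\partial$-closed in the sense of distributions, with norm $\|g\|_{C^\alpha}=\sum_j\|g_j\|_{C^\alpha}$. For a proper subset $J\subsetneq\{1,\dots,n\}$ with complement $K$, and $z\in\mathbb D^n$, let $$\gamma_J(z)=\{\zeta\in\mathbb D^n:\ \zeta_j=z_j\ (j\in J),\ |\zeta_k|=r\ (k\in K)\ \text{for some } r \text{ with } r\le|z_j|\text{ for all }j\in J\},$$ parametrized by $\zeta_k=re^{i\theta_k}$ $(k\in K)$ with parameters $(r,(\theta_k)_{k\in K})$, where $0<\theta_k<2\pi$ and $0<r<1$, $r\le |z_j|$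 for all $j\in J$. Writing $K=\{k_1<\dots<k_m\}$, orient $\gamma_J(z)$ by $dr\wedge d\theta_{k_1}\wedge\dots\wedge d\theta_{k_m}$. Henkin's (unweighted) operator is $$H[g](z)=-\sum_{J\subsetneq\{1,\dots,n\}}\int_{\gamma_J(z)}g(\zeta)\wedge\bigwedge_{s=1}^{m}\frac{1}{2\pi i}\frac{d\zeta_{k_s}}{\zeta_{k_s}-z_{k_s}}.$$ Then for every $g\in Z^\alpha_{(0,1)}(\mathbb D^n)$ and every $z\in\mathbb D^n$ all these integrals converge absolutely; $H[g]\in C^\alpha(\mathbb D^n)$ and $\bar\partial H[g]=g$ on $\mathbb D^n$ in the sense of distributions; and $H:Z^\alpha_{(0,1)}(\mathbb D^n)\to C^\alpha(\mathbb D^n)$ is a bounded linear operator, i.e. it is linear and there is a constant $C$ depending only on $n$ and $\alpha$ with $\|H[g]\|_{C^\alpha}\le C\|g\|_{C^\alpha}$ for all $g\in Z^\alpha_{(0,1)}(\mathbb D^n)$. -/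

import Mathlib

open MeasureTheory Set
open scoped NNReal Distributions

noncomputable section

/-- The open unit polydisc `𝔻ⁿ` in `ℂⁿ`. -/
def polydisc (n : ℕ) : TopologicalSpace.Opens (Fin n → ℂ) where
  carrier := {z | ∀ i, ‖z i‖ < 1}
  is_open' := by
    have h : {z : Fin n → ℂ | ∀ i, ‖z i‖ < 1} = ⋂ i, {z | ‖z i‖ < 1} := by ext; simp
    rw [h]
    exact isOpen_iInter_of_finite fun i => isOpen_lt (by fun_prop) continuous_const

/-- Extension by zero to `ℂⁿ` of a function on the polydisc. All integrals
below run over points of the polydisc, so the values outside play no role. -/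
def zeroExt {n : ℕ} (f : polydisc n → ℂ) (z : Fin n → ℂ) : ℂ :=
  open Classical in if h : z ∈ polydisc n then f ⟨z, h⟩ else 0

/-- The Hölder space `C^α(𝔻ⁿ)`. Distances are measured in the maximum norm of `ℂⁿ`, which is
equivalent to the Euclidean one. Membership implies boundedness since `𝔻ⁿ` is bounded. -/
def holderSpace (n : ℕ) (α : ℝ≥0) : Submodule ℂ (polydisc n → ℂ) where
  carrier := {f | MemHolder α f}
  add_mem' hf hg := hf.add hg
  zero_mem' := memHolder_zero
  smul_mem' _ _ hf := hf.smul

/-- The norm of `C^α(𝔻ⁿ)`: supremum norm plus the best Hölder constant. -/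
def holderNorm {n : ℕ} (α : ℝ≥0) (f : polydisc n → ℂ) : ℝ :=
  (⨆ z, ‖f z‖) + nnHolderNorm α f

/-- The `C^α` norm of the `(0,1)`-form `∑ j, g j dz̄_j`. -/
def formHolderNorm {n : ℕ} (α : ℝ≥0) (g : Fin n → polydisc n → ℂ) : ℝ :=
  ∑ j, holderNorm α (g j)

/-- The Wirtinger derivative `∂φ/∂z̄_j = (∂φ/∂x_j + i ∂φ/∂y_j) / 2`. -/
def wirtingerBar {n : ℕ} (j : Fin n) (φ : (Fin n → ℂ) → ℂ) (z : Fin n → ℂ) : ℂ :=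
  (fderiv ℝ φ z (Pi.single j 1) + Complex.I * fderiv ℝ φ z (Pi.single j Complex.I)) / 2

/-- `∂̄ u = g` on `𝔻ⁿ` in the sense of distributions, i.e. `∂u/∂z̄_j = g j` for all `j`. -/
def IsDbarSolution {n : ℕ} (u : polydisc n → ℂ) (g : Fin n → polydisc n → ℂ) : Prop :=
  ∀ (j : Fin n) (φ : 𝓓(polydisc n, ℂ)),
    ∫ z in (polydisc n : Set (Fin n → ℂ)), zeroExt u z * wirtingerBar j φ z =
      -∫ z in (polydisc n : Set (Fin n → ℂ)), zeroExt (g j) z * φ z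

/-- The `(0,1)`-form `∑ j, g j dz̄_j` is `∂̄`-closed in the sense of distributions, i.e.
`∂(g k)/∂z̄_j = ∂(g j)/∂z̄_k` for all `j`, `k`. -/
def IsDbarClosed {n : ℕ} (g : Fin n → polydisc n → ℂ) : Prop :=
  ∀ (j k : Fin n) (φ : 𝓓(polydisc n, ℂ)),
    ∫ z in (polydisc n : Set (Fin n → ℂ)), zeroExt (g k) z * wirtingerBar j φ z =
      ∫ z in (polydisc n : Set (Fin n → ℂ)), zeroExt (g j) z * wirtingerBar k φ z

theorem zeroExt_add {n : ℕ} (f g : polydisc n → ℂ) (z : Fin n → ℂ) :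
    zeroExt (f + g) z = zeroExt f z + zeroExt g z := by
  unfold zeroExt; split_ifs <;> simp

theorem zeroExt_smul {n : ℕ} (c : ℂ) (f : polydisc n → ℂ) (z : Fin n → ℂ) :
    zeroExt (c • f) z = c * zeroExt f z := by
  unfold zeroExt; split_ifs <;> simp

theorem integrable_zeroExt_mul_wirtingerBar {n : ℕ} {f : polydisc n → ℂ} (hf : Continuous f)
    (j : Fin n) (φ : 𝓓(polydisc n, ℂ)) :
    IntegrableOn (fun z => zeroExt f z * wirtingerBar j φ z) (polydisc n : Set (Fin n → ℂ)) := by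
  have hfd : Continuous (fderiv ℝ φ) := φ.contDiff.continuous_fderiv (by simp)
  have hc : ContinuousOn (zeroExt f) (polydisc n : Set (Fin n → ℂ)) := by
    rw [continuousOn_iff_continuous_domRestrict]
    refine hf.congr fun z => ?_
    have hz : (z : Fin n → ℂ) ∈ polydisc n := z.2
    simp [zeroExt, hz]
  have hK : IntegrableOn (fun z => zeroExt f z * wirtingerBar j φ z) (tsupport φ) := by
    apply ContinuousOn.integrableOn_compact φ.hasCompactSupport
    apply (hc.mono φ.tsupport_subset).mul
    unfold wirtingerBar
    fun_prop
  refine ((integrableOn_iff_integrable_of_support_subset ?_).1 hK).integrableOn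
  intro z hz
  by_contra hn
  have h0 : fderiv ℝ φ z = 0 := by
    by_contra h
    exact hn (support_fderiv_subset ℝ h)
  exact hz (by simp [wirtingerBar, h0])

/-- `Z^α_{(0,1)}(𝔻ⁿ)`: the space of `∂̄`-closed `(0,1)`-forms on `𝔻ⁿ` with coefficients in
`C^α(𝔻ⁿ)`. A form `∑ j, g j dz̄_j` is given by its coefficients. -/
def closedForms (n : ℕ) (α : ℝ≥0) (hα : 0 < α) : Submodule ℂ (Fin n → polydisc n → ℂ) where
  carrier := {g | (∀ j, g j ∈ holderSpace n α) ∧ IsDbarClosed g}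
  add_mem' := by
    rintro g h ⟨hg, hg'⟩ ⟨hh, hh'⟩
    refine ⟨fun j => (holderSpace n α).add_mem (hg j) (hh j), fun j k φ => ?_⟩
    have cont : ∀ {f : polydisc n → ℂ}, f ∈ holderSpace n α → Continuous f :=
      fun hf => hf.holderWith.continuous hα
    simp only [Pi.add_apply, zeroExt_add, add_mul]
    rw [integral_add (integrable_zeroExt_mul_wirtingerBar (cont (hg k)) j φ)
        (integrable_zeroExt_mul_wirtingerBar (cont (hh k)) j φ),
      integral_add (integrable_zeroExt_mul_wirtingerBar (cont (hg j)) k φ)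
        (integrable_zeroExt_mul_wirtingerBar (cont (hh j)) k φ), hg' j k φ, hh' j k φ]
  zero_mem' := ⟨fun _ => (holderSpace n α).zero_mem, fun j k φ => by
    simp [zeroExt]⟩
  smul_mem' := by
    rintro c g ⟨hg, hg'⟩
    refine ⟨fun j => (holderSpace n α).smul_mem c (hg j), fun j k φ => ?_⟩
    simp only [Pi.smul_apply, zeroExt_smul, mul_assoc, integral_const_mul]
    rw [hg' j k φ]

/-! ### Henkin's operator

For a proper subset `J` of the index set, with complement `K`, the chain `γ_J(z)` consists of the
`ζ ∈ 𝔻ⁿ` with `ζ_j = z_j` for `j ∈ J` and `|ζ_k| = r` for all `k ∈ K`, where `r ≤ |z_j|` for all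
`j ∈ J`. It is parametrized by `(r, (θ_k)_{k ∈ K})` through `ζ_k = r exp(i θ_k)` and is oriented
by `(∂_r, (∂_{θ_k})_{k ∈ K})`. The integrand is the form `g ∧ ⋀_{k ∈ K} dζ_k / (2πi (ζ_k - z_k))`,
whose value on the frame is the determinant of the matrix of values of its one-form factors on the
frame vectors; as rows and columns are both indexed by `K` and one extra index, no ordering of
`K` has to be chosen. -/

/-- The parameter domain of `γ_J(z)`. -/
def henkinRegion {n : ℕ} (J : Finset (Fin n)) (z : Fin n → ℂ) :
    Set (ℝ × ({k // k ∉ J} → ℝ)) :=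
  {p | (0 < p.1 ∧ p.1 < 1 ∧ ∀ j ∈ J, p.1 ≤ ‖z j‖) ∧ ∀ k, 0 < p.2 k ∧ p.2 k < 2 * Real.pi}

/-- The point `ζ` of `γ_J(z)` with parameters `p = (r, θ)`. -/
def henkinPoint {n : ℕ} (J : Finset (Fin n)) (z : Fin n → ℂ)
    (p : ℝ × ({k // k ∉ J} → ℝ)) : Fin n → ℂ :=
  fun i => if h : i ∉ J then p.1 * Complex.exp (p.2 ⟨i, h⟩ * Complex.I) else z i

/-- The frame of coordinate vectors of the parametrization at `p = (r, θ)`: `none` stands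
for `∂ζ/∂r` and `some k` for `∂ζ/∂θ_k`. -/
def henkinFrame {n : ℕ} (J : Finset (Fin n)) (p : ℝ × ({k // k ∉ J} → ℝ)) :
    Option {k // k ∉ J} → Fin n → ℂ
  | none => fun i => if h : i ∉ J then Complex.exp (p.2 ⟨i, h⟩ * Complex.I) else 0
  | some k => Pi.single k.1 (p.1 * Complex.I * Complex.exp (p.2 k * Complex.I))

/-- The one-form factors of `g ∧ ⋀_{k ∈ K} dζ_k / (2πi (ζ_k - z_k))` at the point `ζ`, applied to
a tangent vector `v`: `none` stands for `g = ∑ j, g j dζ̄_j` and `some k` for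
`dζ_k / (2πi (ζ_k - z_k))`. -/
def henkinFactor {n : ℕ} (g : Fin n → polydisc n → ℂ) (J : Finset (Fin n)) (z ζ v : Fin n → ℂ) :
    Option {k // k ∉ J} → ℂ
  | none => ∑ j, zeroExt (g j) ζ * (starRingEnd ℂ) (v j)
  | some k => v k.1 / (2 * Real.pi * Complex.I * (ζ k.1 - z k.1))

/-- The pullback of `g ∧ ⋀_{k ∈ K} dζ_k / (2πi (ζ_k - z_k))` to the parameter domain of `γ_J(z)`,
as a density with respect to `dr ∏ dθ_k`. -/
def henkinIntegrand {n : ℕ} (g : Fin n → polydisc n → ℂ) (J : Finset (Fin n)) (z : Fin n → ℂ)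
    (p : ℝ × ({k // k ∉ J} → ℝ)) : ℂ :=
  (Matrix.of fun a b : Option {k // k ∉ J} =>
    henkinFactor g J z (henkinPoint J z p) (henkinFrame J p b) a).det

/-- Henkin's (unweighted) integral operator. At points `z` whose coordinates have
pairwise distinct moduli, exactly one ordering `(j_1, …, j_r)` of each subset `J` satisfies
`|z_{j_1}| ≥ … ≥ |z_{j_r}|`, so that the sum over subsets is the sum over ordered tuples. -/
def henkin {n : ℕ} (g : Fin n → polydisc n → ℂ) (z : polydisc n) : ℂ :=
  -∑ J : Finset (Fin n) with J ≠ Finset.univ,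
    ∫ p in henkinRegion J (z : Fin n → ℂ), henkinIntegrand g J z p

end

open scoped Real

/-!
The chains `γ_J(z)` of all subsets `J` are parametrized at once by a radius `r` and one angle per
coordinate, where each angle carries the measure `δ₀ + dθ` and the atom stands for a coordinate
frozen at `z_j`. Expanding the determinant of the wedge product turns Henkin's operator into a
single integral over these parameters, with a density that is the product over the coordinates of
one-variable Cauchy factors times `∑_k 2 conj(∂ζ_k/∂r) g_k(ζ)`.

The angular integral of a Cauchy factor is `O(|r - |z_j||^(-ε))` for every `ε > 0`, so the density
is integrable, even after multiplication by a power `|r - ρ|^(-α)` with `α < 1`. When a single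
coordinate of `z` moves from `a` to `b`, its Cauchy factor changes by at most `|a - b|^α` times
such powers times the factors at `a` and `b`; this is Hölder continuity in each variable.

For the equation `∂H[g]/∂z̄_l = g_l`, one tests against a function `ψ` of `z_l` alone, the other
coordinates being fixed. If `g` is a superposition of translates of products of functions of one
variable, the angular integrals factor into chain means, and Green's formula and the
Cauchy–Pompeiu formula in one variable yield `∫ ψ g_l` and area terms, which cancel because
`∂g_k/∂z̄_l = ∂g_l/∂z̄_k`. Mollification by product kernels reduces the general case to this one.
-/

noncomputable section

namespace Henkin

/-! ### Henkin's operator as a single integral -/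

/-- The measure `δ₀ + dθ` on the angles `(0, 2π]`. The atom at `0` encodes that a coordinate of
`ζ` is frozen at the corresponding coordinate of `z`, so that a product of copies of this measure
parametrizes the chains of all subsets `J` at once. -/
def angleMeasure : Measure ℝ := Measure.dirac 0 + volume.restrict (Ioc 0 (2 * π))

instance : IsFiniteMeasure angleMeasure := by unfold angleMeasure; infer_instance

theorem integrable_angleMeasure_iff {E : Type*} [NormedAddCommGroup E] {f : ℝ → E} :
    Integrable f angleMeasure ↔ IntervalIntegrable f volume 0 (2 * π) := by
  rw [angleMeasure, integrable_add_measure, intervalIntegrable_iff_integrableOn_Ioc_of_le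
    Real.two_pi_pos.le, IntegrableOn, and_iff_right (integrable_dirac (by simp))]

theorem integral_angleMeasure {E : Type*} [NormedAddCommGroup E] [NormedSpace ℝ E]
    [CompleteSpace E] {f : ℝ → E} (hf : IntervalIntegrable f volume 0 (2 * π)) :
    ∫ θ, f θ ∂angleMeasure = f 0 + ∫ θ in (0 : ℝ)..2 * π, f θ := by
  rw [angleMeasure, integral_add_measure (integrable_dirac (by simp))
    ((intervalIntegrable_iff_integrableOn_Ioc_of_le Real.two_pi_pos.le).1 hf), integral_dirac,
    intervalIntegral.integral_of_le Real.two_pi_pos.le]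

/-- A coordinate of the point of the chain with radius `r` and angle `θ`; the angle `0` stands for
a frozen coordinate. -/
def chainCoord (r : ℝ) (z : ℂ) (θ : ℝ) : ℂ :=
  if θ = 0 then z else circleMap 0 r θ

/-- The factor of Henkin's kernel in one coordinate: the density of `dζ / (2πi (ζ - z))` with
respect to `dθ` for a moving coordinate, and the condition `r ≤ |z|` of the chain for a frozen
one. -/
def cauchyWeight (r : ℝ) (z : ℂ) (θ : ℝ) : ℂ :=
  if θ = 0 then (if r ≤ ‖z‖ then 1 else 0)
  else circleMap 0 r θ / (2 * π * (circleMap 0 r θ - z))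

/-- The coefficient of `g_j` in Henkin's density. It is twice the conjugate of `∂ζ_j/∂r`: the
component of the form along `dζ̄_j` meets the frame in `∂/∂r` and in `∂/∂θ_j`, with equal
contributions. -/
def radialFactor (θ : ℝ) : ℂ :=
  if θ = 0 then 0 else 2 * (starRingEnd ℂ) (circleMap 0 1 θ)

section Coordinates

theorem measurable_chainCoord {X : Type*} [MeasurableSpace X] {r : X → ℝ} {z : X → ℂ} {θ : X → ℝ}
    (hr : Measurable r) (hz : Measurable z) (hθ : Measurable θ) :
    Measurable fun x => chainCoord (r x) (z x) (θ x) :=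
  Measurable.ite (hθ (measurableSet_singleton 0)) hz (by fun_prop)

theorem measurable_cauchyWeight {X : Type*} [MeasurableSpace X] {r : X → ℝ} {z : X → ℂ}
    {θ : X → ℝ} (hr : Measurable r) (hz : Measurable z) (hθ : Measurable θ) :
    Measurable fun x => cauchyWeight (r x) (z x) (θ x) :=
  Measurable.ite (hθ (measurableSet_singleton 0))
    (Measurable.ite (measurableSet_le hr hz.norm) measurable_const measurable_const)
    (by fun_prop)

theorem measurable_radialFactor : Measurable radialFactor :=
  Measurable.ite (measurableSet_singleton 0) measurable_const
    (Complex.continuous_conj.measurable.comp (continuous_circleMap 0 1).measurable |>.const_mul 2)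

theorem norm_radialFactor_le (θ : ℝ) : ‖radialFactor θ‖ ≤ 2 := by
  unfold radialFactor
  split_ifs <;> simp

variable {r : ℝ}

theorem norm_chainCoord_le (hr : 0 ≤ r) (z : ℂ) (θ : ℝ) : ‖chainCoord r z θ‖ ≤ max r ‖z‖ := by
  unfold chainCoord
  split_ifs
  · exact le_max_right _ _
  · rw [norm_circleMap_zero, abs_of_nonneg hr]
    exact le_max_left _ _

theorem abs_sub_norm_le_norm_circleMap_sub (hr : 0 ≤ r) (z : ℂ) (θ : ℝ) :
    |r - ‖z‖| ≤ ‖circleMap 0 r θ - z‖ := by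
  simpa [abs_of_nonneg hr] using abs_norm_sub_norm_le (circleMap 0 r θ) z

theorem circleMap_ne_of_ne_norm (hr : 0 ≤ r) {z : ℂ} (hz : r ≠ ‖z‖) (θ : ℝ) :
    circleMap 0 r θ ≠ z :=
  sub_ne_zero.1 <| norm_pos_iff.1 <|
    (abs_pos.2 (sub_ne_zero.2 hz)).trans_le (abs_sub_norm_le_norm_circleMap_sub hr z θ)

theorem norm_cauchyWeight_zero_le_one (r : ℝ) (z : ℂ) : ‖cauchyWeight r z 0‖ ≤ 1 := by
  rw [cauchyWeight, if_pos rfl]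
  split_ifs <;> simp

theorem norm_cauchyWeight_of_ne_zero (hr : 0 ≤ r) (z : ℂ) {θ : ℝ} (hθ : θ ≠ 0) :
    ‖cauchyWeight r z θ‖ = r / (2 * π * ‖circleMap 0 r θ - z‖) := by
  rw [cauchyWeight, if_neg hθ, norm_div, norm_circleMap_zero, abs_of_nonneg hr]
  simp [abs_of_pos Real.pi_pos]

theorem norm_cauchyWeight_le (hr : 0 ≤ r) {z : ℂ} (hz : r ≠ ‖z‖) (θ : ℝ) :
    ‖cauchyWeight r z θ‖ ≤ 1 + r / |r - ‖z‖| := by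
  have hgap : 0 < |r - ‖z‖| := abs_pos.2 (sub_ne_zero.2 hz)
  rcases eq_or_ne θ 0 with rfl | hθ
  · exact (norm_cauchyWeight_zero_le_one r z).trans (le_add_of_nonneg_right (by positivity))
  · rw [norm_cauchyWeight_of_ne_zero hr z hθ]
    have hle : r / (2 * π * ‖circleMap 0 r θ - z‖) ≤ r / |r - ‖z‖| := by
      gcongr
      nlinarith [Real.pi_gt_three, abs_sub_norm_le_norm_circleMap_sub hr z θ]
    exact hle.trans (le_add_of_nonneg_left zero_le_one)

theorem integrable_cauchyWeight (hr : 0 ≤ r) {z : ℂ} (hz : r ≠ ‖z‖) :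
    Integrable (cauchyWeight r z) angleMeasure :=
  Integrable.of_bound
    (measurable_cauchyWeight measurable_const measurable_const measurable_id).aestronglyMeasurable
    _ (ae_of_all _ (norm_cauchyWeight_le hr hz))

end Coordinates

section Powers

theorem intervalIntegrable_abs_rpow {s : ℝ} (hs : -1 < s) (a b : ℝ) :
    IntervalIntegrable (fun x : ℝ => |x| ^ s) volume a b := by
  have hpos : ∀ c : ℝ, 0 ≤ c → IntervalIntegrable (fun x : ℝ => |x| ^ s) volume 0 c :=
    fun c hc => (intervalIntegral.intervalIntegrable_rpow' hs).congr fun x hx => by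
      rw [uIoc_of_le hc] at hx
      simp only [abs_of_pos hx.1]
  have hzero : ∀ c : ℝ, IntervalIntegrable (fun x : ℝ => |x| ^ s) volume 0 c := fun c => by
    rcases le_total 0 c with hc | hc
    · exact hpos c hc
    · simpa using (IntervalIntegrable.iff_comp_neg (by simp)).1 (hpos (-c) (by linarith))
  exact (hzero a).symm.trans (hzero b)

theorem intervalIntegrable_abs_sub_rpow {s : ℝ} (hs : -1 < s) (c a b : ℝ) :
    IntervalIntegrable (fun x : ℝ => |x - c| ^ s) volume a b := by
  simpa using (intervalIntegrable_abs_rpow hs (a - c) (b - c)).comp_sub_right c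

theorem integral_abs_sub_rpow_le {s : ℝ} (hs : -1 < s) {a b c K : ℝ} (hab : a ≤ b)
    (ha : -K ≤ a - c) (hb : b - c ≤ K) :
    ∫ x in a..b, |x - c| ^ s ≤ ∫ x in -K..K, |x| ^ s := by
  rw [intervalIntegral.integral_comp_sub_right (fun x => |x| ^ s)]
  exact intervalIntegral.integral_mono_interval ha (by linarith) hb
    (ae_of_all _ fun x => by positivity) (intervalIntegrable_abs_rpow hs _ _)

theorem one_le_abs_rpow_neg {a ε : ℝ} (ha : a ≠ 0) (ha' : |a| ≤ 1) (hε : 0 ≤ ε) :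
    1 ≤ |a| ^ (-ε) :=
  Real.one_le_rpow_of_pos_of_le_one_of_nonpos (abs_pos.2 ha) ha' (neg_nonpos.2 hε)

theorem inv_le_rpow_neg_mul_rpow {a b d ε : ℝ} (ha : 0 < a) (hb : 0 < b) (had : a ≤ d)
    (hbd : b ≤ d) (hε0 : 0 ≤ ε) (hε1 : ε ≤ 1) : d⁻¹ ≤ a ^ (-ε) * b ^ (ε - 1) := by
  have hd : 0 < d := ha.trans_le had
  calc d⁻¹ = d ^ (-ε) * d ^ (ε - 1) := by
        rw [← Real.rpow_add hd, neg_add_eq_sub, sub_sub_cancel_left, Real.rpow_neg_one]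
    _ ≤ a ^ (-ε) * b ^ (ε - 1) := mul_le_mul
        (Real.rpow_le_rpow_of_nonpos ha had (neg_nonpos.2 hε0))
        (Real.rpow_le_rpow_of_nonpos hb hbd (sub_nonpos.2 hε1)) (by positivity) (by positivity)

end Powers

section AngularIntegral

variable {r ε : ℝ}

theorem norm_circleMap_add_arg_sub (r : ℝ) (z : ℂ) (t : ℝ) :
    ‖circleMap 0 r (t + z.arg) - z‖ = ‖circleMap 0 r t - ‖z‖‖ := by
  have hrot : circleMap 0 r (t + z.arg) - z =
      (circleMap 0 r t - ‖z‖) * Complex.exp (z.arg * Complex.I) := by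
    conv_lhs => enter [2]; rw [← Complex.norm_mul_exp_arg_mul_I z]
    rw [circleMap_zero, circleMap_zero, sub_mul, mul_assoc, ← Complex.exp_add]
    push_cast
    ring_nf
  rw [hrot, norm_mul, Complex.norm_exp_ofReal_mul_I, mul_one]

theorem mul_abs_div_pi_le_norm_circleMap_sub (hr : 0 ≤ r) {ρ : ℝ} (hρ : 0 ≤ ρ) {t : ℝ}
    (ht : |t| ≤ π) : r * (|t| / π) ≤ ‖circleMap 0 r t - ρ‖ := by
  have hradial : |r - ρ| ≤ ‖circleMap 0 r t - ρ‖ := by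
    simpa [abs_of_nonneg hρ] using abs_sub_norm_le_norm_circleMap_sub hr (ρ : ℂ) t
  have hchord : ‖circleMap 0 r t - r‖ ≤ 2 * ‖circleMap 0 r t - ρ‖ := by
    have htri := norm_sub_le (circleMap 0 r t - ρ) ((r - ρ : ℝ) : ℂ)
    rw [Complex.norm_real, Real.norm_eq_abs, Complex.ofReal_sub, sub_sub_sub_cancel_right] at htri
    linarith
  have hsin : ‖circleMap 0 r t - r‖ = r * (2 * |Real.sin (t / 2)|) := by
    rw [circleMap_zero, ← mul_sub_one, norm_mul, mul_comm (t : ℂ),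
      Complex.norm_exp_I_mul_ofReal_sub_one]
    simp [abs_of_nonneg hr]
  have hjordan : |t| / π ≤ |Real.sin (t / 2)| := by
    have habs : |t / 2| = |t| / 2 := by rw [abs_div, abs_two]
    have := Real.mul_abs_le_abs_sin (x := t / 2) (by rw [habs]; linarith)
    rwa [habs, show 2 / π * (|t| / 2) = |t| / π by ring] at this
  linarith [mul_le_mul_of_nonneg_left hjordan hr]

theorem div_norm_circleMap_sub_le (hε0 : 0 < ε) (hε1 : ε ≤ 1) (hr : r ∈ Ioo 0 1) {ρ : ℝ}
    (hρ : 0 ≤ ρ) (hrρ : r ≠ ρ) {t : ℝ} (ht0 : t ≠ 0) (ht : |t| ≤ π) :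
    r / (2 * π * ‖circleMap 0 r t - ρ‖) ≤ |r - ρ| ^ (-ε) * (|t| / π) ^ (ε - 1) := by
  have hgap : 0 < |r - ρ| := abs_pos.2 (sub_ne_zero.2 hrρ)
  have hx : 0 < |t| / π := by positivity
  have hd : |r - ρ| ≤ ‖circleMap 0 r t - ρ‖ := by
    simpa [abs_of_nonneg hρ] using abs_sub_norm_le_norm_circleMap_sub hr.1.le (ρ : ℂ) t
  have hpow : r * r ^ (ε - 1) ≤ 1 := by
    rw [← Real.rpow_one_add' hr.1.le (by linarith), add_sub_cancel]
    exact Real.rpow_le_one hr.1.le hr.2.le hε0.le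
  calc r / (2 * π * ‖circleMap 0 r t - ρ‖) ≤ r / ‖circleMap 0 r t - ρ‖ := by
        have := hgap.trans_le hd
        gcongr
        · exact hr.1.le
        · nlinarith [Real.pi_gt_three]
    _ ≤ r * (|r - ρ| ^ (-ε) * (r * (|t| / π)) ^ (ε - 1)) := by
        rw [div_eq_mul_inv]
        exact mul_le_mul_of_nonneg_left (inv_le_rpow_neg_mul_rpow hgap (mul_pos hr.1 hx) hd
          (mul_abs_div_pi_le_norm_circleMap_sub hr.1.le hρ ht) hε0.le hε1) hr.1.le
    _ = r * r ^ (ε - 1) * (|r - ρ| ^ (-ε) * (|t| / π) ^ (ε - 1)) := by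
        rw [Real.mul_rpow hr.1.le hx.le]
        ring
    _ ≤ |r - ρ| ^ (-ε) * (|t| / π) ^ (ε - 1) := mul_le_of_le_one_left (by positivity) hpow

theorem integral_norm_cauchyWeight_eq (hr : 0 ≤ r) (z : ℂ) :
    ∫ θ in (0 : ℝ)..2 * π, ‖cauchyWeight r z θ‖ =
      ∫ t in -π..π, r / (2 * π * ‖circleMap 0 r t - ‖z‖‖) := by
  set F : ℝ → ℝ := fun θ => r / (2 * π * ‖circleMap 0 r θ - z‖) with hF
  have hper : Function.Periodic F (2 * π) := fun θ => by
    simp only [hF, periodic_circleMap 0 r θ]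
  calc ∫ θ in (0 : ℝ)..2 * π, ‖cauchyWeight r z θ‖ = ∫ θ in (0 : ℝ)..0 + 2 * π, F θ := by
        rw [zero_add]
        refine intervalIntegral.integral_congr_ae ?_
        filter_upwards [Measure.ae_ne volume 0] with θ hθ _
        exact norm_cauchyWeight_of_ne_zero hr z hθ
    _ = ∫ θ in (-π + z.arg)..(-π + z.arg) + 2 * π, F θ :=
        hper.intervalIntegral_add_eq _ _
    _ = ∫ t in -π..π, F (t + z.arg) := by
        rw [intervalIntegral.integral_comp_add_right]
        ring_nf
    _ = ∫ t in -π..π, r / (2 * π * ‖circleMap 0 r t - ‖z‖‖) := by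
        simp only [hF, norm_circleMap_add_arg_sub]

theorem exists_integral_norm_cauchyWeight_le (hε0 : 0 < ε) (hε1 : ε ≤ 1) :
    ∃ C : ℝ, 0 ≤ C ∧ ∀ (r : ℝ) (z : ℂ), r ∈ Ioo (0 : ℝ) 1 → ‖z‖ ≤ 1 → r ≠ ‖z‖ →
      ∫ θ, ‖cauchyWeight r z θ‖ ∂angleMeasure ≤ C * |r - ‖z‖| ^ (-ε) := by
  have hpow : IntervalIntegrable (fun t : ℝ => (|t| / π) ^ (ε - 1)) volume (-π) π := by
    simp only [Real.div_rpow (abs_nonneg _) Real.pi_pos.le]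
    exact (intervalIntegrable_abs_rpow (by linarith) _ _).div_const _
  have hpi : -π ≤ π := by linarith [Real.pi_pos]
  refine ⟨1 + ∫ t in -π..π, (|t| / π) ^ (ε - 1), add_nonneg zero_le_one
    (intervalIntegral.integral_nonneg hpi fun t _ => by positivity), fun r z hr hz hrz => ?_⟩
  have hatom : ‖cauchyWeight r z 0‖ ≤ |r - ‖z‖| ^ (-ε) :=
    (norm_cauchyWeight_zero_le_one r z).trans <| one_le_abs_rpow_neg (sub_ne_zero.2 hrz)
      (abs_le.2 ⟨by linarith [hr.1], by linarith [hr.2, norm_nonneg z]⟩) hε0.le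
  have hcircle : ∫ θ in (0 : ℝ)..2 * π, ‖cauchyWeight r z θ‖ ≤
      |r - ‖z‖| ^ (-ε) * ∫ t in -π..π, (|t| / π) ^ (ε - 1) := by
    have hcont : Continuous fun t : ℝ => r / (2 * π * ‖circleMap 0 r t - ‖z‖‖) := by
      have hne : ∀ t, circleMap 0 r t - (‖z‖ : ℂ) ≠ 0 := fun t =>
        sub_ne_zero.2 (circleMap_ne_of_ne_norm hr.1.le (by simpa using hrz) t)
      exact continuous_const.div (by fun_prop) fun t => by simp [Real.pi_ne_zero, hne t]
    rw [integral_norm_cauchyWeight_eq hr.1.le, ← intervalIntegral.integral_const_mul]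
    refine intervalIntegral.integral_mono_ae_restrict hpi (hcont.intervalIntegrable _ _)
      (hpow.const_mul _) ?_
    filter_upwards [ae_restrict_mem measurableSet_Icc,
      ae_restrict_of_ae (Measure.ae_ne volume 0)] with t ht ht0
    exact div_norm_circleMap_sub_le hε0 hε1 hr (norm_nonneg z) hrz ht0 (abs_le.2 ht)
  rw [integral_angleMeasure
    (integrable_angleMeasure_iff.1 (integrable_cauchyWeight hr.1.le hrz).norm)]
  linarith

end AngularIntegral

section Kernel

/-- The common parameter space `(r, θ)` of the chains of all subsets `J`. -/
def chainMeasure (ι : Type*) [Fintype ι] : Measure (ℝ × (ι → ℝ)) :=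
  (volume.restrict (Ioo (0 : ℝ) 1)).prod (Measure.pi fun _ => angleMeasure)

instance (ι : Type*) [Fintype ι] : IsFiniteMeasure (chainMeasure ι) := by
  unfold chainMeasure; infer_instance

/-- The point of the chain with parameters `p = (r, θ)`. -/
def chainPoint {ι : Type*} (z : ι → ℂ) (p : ℝ × (ι → ℝ)) : ι → ℂ :=
  fun j => chainCoord p.1 (z j) (p.2 j)

/-- Henkin's kernel without the contribution of the form `g`: the product of the weights of all
coordinates. -/
def cauchyKernel {ι : Type*} [Fintype ι] (z : ι → ℂ) (p : ℝ × (ι → ℝ)) : ℂ :=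
  ∏ j, cauchyWeight p.1 (z j) (p.2 j)

variable {ι : Type*}

theorem measurable_chainPoint {X : Type*} [MeasurableSpace X] {z : X → ι → ℂ}
    {p : X → ℝ × (ι → ℝ)} (hz : Measurable z) (hp : Measurable p) :
    Measurable fun x => chainPoint (z x) (p x) :=
  measurable_pi_lambda _ fun j => measurable_chainCoord hp.fst
    ((measurable_pi_apply j).comp hz) ((measurable_pi_apply j).comp hp.snd)

theorem ae_ne_norm [Countable ι] (z : ι → ℂ) :
    ∀ᵐ r ∂(volume.restrict (Ioo (0 : ℝ) 1)), ∀ j, r ≠ ‖z j‖ :=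
  ae_all_iff.2 fun _ => ae_restrict_of_ae (Measure.ae_ne volume _)

variable [Fintype ι]

theorem measurable_cauchyKernel {X : Type*} [MeasurableSpace X] {z : X → ι → ℂ}
    {p : X → ℝ × (ι → ℝ)} (hz : Measurable z) (hp : Measurable p) :
    Measurable fun x => cauchyKernel (z x) (p x) :=
  Finset.measurable_fun_prod _ fun j _ => measurable_cauchyWeight hp.fst
    ((measurable_pi_apply j).comp hz) ((measurable_pi_apply j).comp hp.snd)

theorem integrable_cauchyKernel_slice {z : ι → ℂ} {r : ℝ} (hr : 0 ≤ r) (hz : ∀ j, r ≠ ‖z j‖) :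
    Integrable (fun θ => cauchyKernel z (r, θ)) (Measure.pi fun _ : ι => angleMeasure) :=
  Integrable.fintype_prod fun j => integrable_cauchyWeight hr (hz j)

theorem integral_norm_cauchyKernel_slice (z : ι → ℂ) (r : ℝ) :
    ∫ θ, ‖cauchyKernel z (r, θ)‖ ∂(Measure.pi fun _ : ι => angleMeasure) =
      ∏ j, ∫ θ, ‖cauchyWeight r (z j) θ‖ ∂angleMeasure := by
  simp only [cauchyKernel, norm_prod]
  exact integral_fintype_prod_eq_prod fun j θ => ‖cauchyWeight r (z j) θ‖

end Kernel

section KernelBound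

/-- A sum of powers of the distances of `r` to `ρ` and to the `‖z j‖`, which majorizes the
angular integral of the kernel. -/
def radialMajorant {ι : Type*} [Fintype ι] (σ ρ : ℝ) (z : ι → ℂ) (r : ℝ) : ℝ :=
  |r - ρ| ^ (-σ) + ∑ j, |r - ‖z j‖| ^ (-σ)

theorem prod_rpow_neg_le_sum {κ : Type*} {s : Finset κ} (hs : s.Nonempty) {b e : κ → ℝ}
    (hb : ∀ i ∈ s, 0 < b i) (he : ∀ i ∈ s, 0 ≤ e i) :
    ∏ i ∈ s, b i ^ (-e i) ≤ ∑ i ∈ s, b i ^ (-∑ i ∈ s, e i) := by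
  obtain ⟨m, hm, hmin⟩ := s.exists_min_image b hs
  calc ∏ i ∈ s, b i ^ (-e i) ≤ ∏ i ∈ s, b m ^ (-e i) :=
        Finset.prod_le_prod (fun i hi => (Real.rpow_pos_of_pos (hb i hi) _).le) fun i hi =>
          Real.rpow_le_rpow_of_nonpos (hb m hm) (hmin i hi) (neg_nonpos.2 (he i hi))
    _ = b m ^ (-∑ i ∈ s, e i) := by
        rw [← Finset.sum_neg_distrib, Real.rpow_sum_of_pos (hb m hm)]
    _ ≤ ∑ i ∈ s, b i ^ (-∑ i ∈ s, e i) :=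
        Finset.single_le_sum (fun i hi => (Real.rpow_pos_of_pos (hb i hi) _).le) hm

variable {ι : Type*} [Fintype ι]

theorem rpow_neg_mul_prod_le_radialMajorant {α ε : ℝ} (hα : 0 ≤ α) (hε : 0 ≤ ε) {ρ r : ℝ}
    {z : ι → ℂ} (hρ : r ≠ ρ) (hz : ∀ j, r ≠ ‖z j‖) :
    |r - ρ| ^ (-α) * ∏ j, |r - ‖z j‖| ^ (-ε) ≤
      radialMajorant (α + Fintype.card ι * ε) ρ z r := by
  have h := prod_rpow_neg_le_sum (s := Finset.univ) Finset.univ_nonempty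
    (b := fun i : Option ι => i.elim |r - ρ| fun j => |r - ‖z j‖|)
    (e := fun i => i.elim α fun _ => ε)
    (by rintro (_ | j) - <;> simp [sub_ne_zero, hρ, hz])
    (by rintro (_ | j) - <;> assumption)
  simpa [Fintype.prod_option, Fintype.sum_option, radialMajorant] using h

theorem exists_integral_norm_cauchyKernel_slice_le (ι : Type*) [Fintype ι] {α : ℝ} (hα0 : 0 ≤ α)
    (hα1 : α < 1) :
    ∃ σ < 1, ∃ C : ℝ, 0 ≤ C ∧ ∀ (z : ι → ℂ) (ρ r : ℝ), (∀ j, ‖z j‖ ≤ 1) → r ∈ Ioo (0 : ℝ) 1 →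
      r ≠ ρ → (∀ j, r ≠ ‖z j‖) →
      ∫ θ, |r - ρ| ^ (-α) * ‖cauchyKernel z (r, θ)‖ ∂(Measure.pi fun _ : ι => angleMeasure) ≤
        C * radialMajorant σ ρ z r := by
  set N := Fintype.card ι
  obtain ⟨ε, hε0, hε⟩ : ∃ ε : ℝ, 0 < ε ∧ (N + 1) * ε = (1 - α) / 2 :=
    ⟨(1 - α) / 2 / (N + 1), div_pos (by linarith) (by positivity), by field_simp⟩
  have hNε : 0 ≤ N * ε := by positivity
  obtain ⟨C, hC0, hC⟩ := exists_integral_norm_cauchyWeight_le hε0 (by linarith)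
  refine ⟨α + N * ε, by linarith, C ^ N, by positivity, fun z ρ r hz hr hρ hrz => ?_⟩
  rw [integral_const_mul, integral_norm_cauchyKernel_slice]
  calc |r - ρ| ^ (-α) * ∏ j, ∫ θ, ‖cauchyWeight r (z j) θ‖ ∂angleMeasure
      ≤ |r - ρ| ^ (-α) * ∏ j, (C * |r - ‖z j‖| ^ (-ε)) := by
        gcongr with j
        exact hC r (z j) hr (hz j) (hrz j)
    _ = C ^ N * (|r - ρ| ^ (-α) * ∏ j, |r - ‖z j‖| ^ (-ε)) := by
        rw [Finset.prod_mul_distrib, Finset.prod_const, Finset.card_univ]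
        ring
    _ ≤ C ^ N * radialMajorant (α + N * ε) ρ z r := by
        gcongr
        exact rpow_neg_mul_prod_le_radialMajorant hα0 hε0.le hρ hrz

theorem integrableOn_abs_sub_rpow {s : ℝ} (hs : -1 < s) (c : ℝ) :
    IntegrableOn (fun r : ℝ => |r - c| ^ s) (Ioo 0 1) :=
  (intervalIntegrable_iff_integrableOn_Ioo_of_le zero_le_one).1
    (intervalIntegrable_abs_sub_rpow hs c 0 1)

theorem setIntegral_abs_sub_rpow_le {s : ℝ} (hs : -1 < s) {c : ℝ} (hc : c ∈ Icc (0 : ℝ) 1) :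
    ∫ r in Ioo (0 : ℝ) 1, |r - c| ^ s ≤ ∫ x in (-1 : ℝ)..1, |x| ^ s := by
  rw [← integral_Ioc_eq_integral_Ioo, ← intervalIntegral.integral_of_le zero_le_one]
  exact integral_abs_sub_rpow_le hs zero_le_one (by linarith [hc.2]) (by linarith [hc.1])

theorem integrableOn_radialMajorant {σ : ℝ} (hσ : σ < 1) (ρ : ℝ) (z : ι → ℂ) :
    IntegrableOn (radialMajorant σ ρ z) (Ioo 0 1) :=
  (integrableOn_abs_sub_rpow (by linarith) ρ).add
    (integrable_finsetSum _ fun j _ => integrableOn_abs_sub_rpow (by linarith) ‖z j‖)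

theorem integral_radialMajorant_le {σ : ℝ} (hσ : σ < 1) {ρ : ℝ} (hρ : ρ ∈ Icc (0 : ℝ) 1)
    {z : ι → ℂ} (hz : ∀ j, ‖z j‖ ≤ 1) :
    ∫ r in Ioo (0 : ℝ) 1, radialMajorant σ ρ z r ≤
      (1 + Fintype.card ι) * ∫ x in (-1 : ℝ)..1, |x| ^ (-σ) := by
  have hs : -1 < -σ := by linarith
  simp only [radialMajorant]
  rw [integral_add (integrableOn_abs_sub_rpow hs ρ)
      (integrable_finsetSum _ fun j _ => integrableOn_abs_sub_rpow hs ‖z j‖),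
    integral_finsetSum _ fun j _ => integrableOn_abs_sub_rpow hs ‖z j‖, add_mul, one_mul,
    ← nsmul_eq_mul, ← Finset.card_univ]
  exact add_le_add (setIntegral_abs_sub_rpow_le hs hρ) (Finset.sum_le_card_nsmul _ _ _
    fun j _ => setIntegral_abs_sub_rpow_le hs ⟨norm_nonneg _, hz j⟩)

theorem integrable_rpow_mul_norm_cauchyKernel {α : ℝ} (hα0 : 0 ≤ α) (hα1 : α < 1) {z : ι → ℂ}
    (hz : ∀ j, ‖z j‖ ≤ 1) (ρ : ℝ) :
    Integrable (fun p => |p.1 - ρ| ^ (-α) * ‖cauchyKernel z p‖) (chainMeasure ι) := by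
  obtain ⟨σ, hσ, C, -, hC⟩ := exists_integral_norm_cauchyKernel_slice_le ι hα0 hα1
  have hmeas : AEStronglyMeasurable (fun p => |p.1 - ρ| ^ (-α) * ‖cauchyKernel z p‖)
      (chainMeasure ι) := by
    have : Measurable fun p : ℝ × (ι → ℝ) => cauchyKernel z p :=
      measurable_cauchyKernel measurable_const measurable_id
    exact Measurable.aestronglyMeasurable (by fun_prop)
  have hnorm : ∀ (r : ℝ) (θ : ι → ℝ), ‖|r - ρ| ^ (-α) * ‖cauchyKernel z (r, θ)‖‖ =
      |r - ρ| ^ (-α) * ‖cauchyKernel z (r, θ)‖ := fun r θ => Real.norm_of_nonneg (by positivity)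
  refine (integrable_prod_iff hmeas).2 ⟨?_, ?_⟩
  · filter_upwards [ae_ne_norm z, ae_restrict_mem measurableSet_Ioo] with r hrz hr
    exact (integrable_cauchyKernel_slice hr.1.le hrz).norm.const_mul _
  · refine Integrable.mono' ((integrableOn_radialMajorant hσ ρ z).const_mul C)
      hmeas.norm.integral_prod_right' ?_
    filter_upwards [ae_ne_norm z, ae_restrict_mem measurableSet_Ioo,
      ae_restrict_of_ae (Measure.ae_ne volume ρ)] with r hrz hr hrρ
    rw [Real.norm_of_nonneg (integral_nonneg fun θ => norm_nonneg _)]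
    simpa only [hnorm] using hC z ρ r hz hr hrρ hrz

theorem exists_integral_rpow_mul_norm_cauchyKernel_le (ι : Type*) [Fintype ι] {α : ℝ}
    (hα0 : 0 ≤ α) (hα1 : α < 1) :
    ∃ C : ℝ, 0 ≤ C ∧ ∀ (z : ι → ℂ) (ρ : ℝ), (∀ j, ‖z j‖ ≤ 1) → ρ ∈ Icc (0 : ℝ) 1 →
      ∫ p, |p.1 - ρ| ^ (-α) * ‖cauchyKernel z p‖ ∂(chainMeasure ι) ≤ C := by
  obtain ⟨σ, hσ, C, hC0, hC⟩ := exists_integral_norm_cauchyKernel_slice_le ι hα0 hα1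
  refine ⟨C * ((1 + Fintype.card ι) * ∫ x in (-1 : ℝ)..1, |x| ^ (-σ)), mul_nonneg hC0
    (mul_nonneg (by positivity) (intervalIntegral.integral_nonneg (by norm_num)
      fun x _ => by positivity)), fun z ρ hz hρ => ?_⟩
  have hint := integrable_rpow_mul_norm_cauchyKernel hα0 hα1 hz ρ
  unfold chainMeasure at hint ⊢
  rw [integral_prod _ hint]
  calc ∫ r in Ioo (0 : ℝ) 1, ∫ θ, |r - ρ| ^ (-α) * ‖cauchyKernel z (r, θ)‖
        ∂(Measure.pi fun _ : ι => angleMeasure)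
      ≤ ∫ r in Ioo (0 : ℝ) 1, C * radialMajorant σ ρ z r := by
        refine integral_mono_ae hint.integral_prod_left
          ((integrableOn_radialMajorant hσ ρ z).const_mul C) ?_
        filter_upwards [ae_ne_norm z, ae_restrict_mem measurableSet_Ioo,
          ae_restrict_of_ae (Measure.ae_ne volume ρ)] with r hrz hr hrρ
        exact hC z ρ r hz hr hrρ hrz
    _ ≤ C * ((1 + Fintype.card ι) * ∫ x in (-1 : ℝ)..1, |x| ^ (-σ)) := by
        rw [integral_const_mul]
        exact mul_le_mul_of_nonneg_left (integral_radialMajorant_le hσ hρ hz) hC0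

theorem integrable_cauchyKernel {z : ι → ℂ} (hz : ∀ j, ‖z j‖ ≤ 1) :
    Integrable (cauchyKernel z) (chainMeasure ι) := by
  have h := integrable_rpow_mul_norm_cauchyKernel le_rfl zero_lt_one hz 0
  simp only [neg_zero, Real.rpow_zero, one_mul] at h
  exact (integrable_norm_iff
    (measurable_cauchyKernel measurable_const measurable_id).aestronglyMeasurable).1 h

end KernelBound

section ChainDecomposition

variable {ι : Type*} [DecidableEq ι]

/-- The extension by zero of a family of angles indexed by the complement of `J`. -/
def extendAngle (J : Finset ι) (θ : {k // k ∉ J} → ℝ) (i : ι) : ℝ :=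
  if h : i ∉ J then θ ⟨i, h⟩ else 0

/-- The parameter box of `γ_J(z)`, without the condition `r ≤ |z_j|`. -/
def chainBox (J : Finset ι) : Set (ℝ × ({k // k ∉ J} → ℝ)) :=
  Ioo (0 : ℝ) 1 ×ˢ univ.pi fun _ => Ioo 0 (2 * π)

theorem extendAngle_of_mem {J : Finset ι} {i : ι} (hi : i ∈ J) (θ : {k // k ∉ J} → ℝ) :
    extendAngle J θ i = 0 := by simp [extendAngle, hi]

theorem extendAngle_coe {J : Finset ι} (k : {k // k ∉ J}) (θ : {k // k ∉ J} → ℝ) :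
    extendAngle J θ k = θ k := by simp [extendAngle, k.2]

theorem measurable_extendAngle (J : Finset ι) : Measurable (extendAngle J) := by
  refine measurable_pi_lambda _ fun i => ?_
  by_cases hi : i ∈ J
  · simp only [extendAngle_of_mem hi, measurable_const]
  · simpa only [extendAngle, hi, not_false_eq_true, dite_true] using measurable_pi_apply _

theorem measurable_prodMap_extendAngle (J : Finset ι) :
    Measurable (Prod.map id (extendAngle J) : ℝ × ({k // k ∉ J} → ℝ) → ℝ × (ι → ℝ)) :=
  measurable_id.prodMap (measurable_extendAngle J)

theorem extendAngle_mem_pi_iff {J : Finset ι} {s : ι → Set ℝ} {θ : {k // k ∉ J} → ℝ} :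
    extendAngle J θ ∈ univ.pi s ↔ (∀ i ∈ J, (0 : ℝ) ∈ s i) ∧ ∀ k : {k // k ∉ J}, θ k ∈ s k := by
  refine ⟨fun h => ⟨fun i hi => ?_, fun k => ?_⟩, fun h i _ => ?_⟩
  · simpa [extendAngle_of_mem hi] using h i (mem_univ i)
  · simpa [extendAngle_coe] using h k (mem_univ _)
  · by_cases hi : i ∈ J
    · simpa [extendAngle_of_mem hi] using h.1 i hi
    · simpa [extendAngle, hi] using h.2 ⟨i, hi⟩

variable [Fintype ι]

theorem map_extendAngle_pi (J : Finset ι) (μ : Measure ℝ) [SigmaFinite μ] {s : ι → Set ℝ}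
    (hs : ∀ i, MeasurableSet (s i)) :
    ((Measure.pi fun _ : {k // k ∉ J} => μ).map (extendAngle J)) (univ.pi s) =
      (∏ i ∈ J, Measure.dirac (0 : ℝ) (s i)) * ∏ i ∈ Finset.univ \ J, μ (s i) := by
  rw [Measure.map_apply (measurable_extendAngle J) (MeasurableSet.univ_pi hs)]
  by_cases h : ∀ i ∈ J, (0 : ℝ) ∈ s i
  · have hpre : extendAngle J ⁻¹' univ.pi s = univ.pi fun k : {k // k ∉ J} => s k := by
      ext θ
      rw [mem_preimage, extendAngle_mem_pi_iff, mem_univ_pi, and_iff_right h]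
    have hdirac : ∏ i ∈ J, Measure.dirac (0 : ℝ) (s i) = 1 :=
      Finset.prod_eq_one fun i hi => by simp [Measure.dirac_apply', hs, h i hi]
    rw [hpre, hdirac, Measure.pi_pi, one_mul,
      ← Finset.prod_subtype (Finset.univ \ J) (by simp) fun i => μ (s i)]
  · have hpre : extendAngle J ⁻¹' univ.pi s = ∅ := by
      ext θ
      simp only [mem_preimage, extendAngle_mem_pi_iff, h, false_and, mem_empty_iff_false]
    obtain ⟨i, hi, h0⟩ : ∃ i ∈ J, (0 : ℝ) ∉ s i := by push Not at h; exact h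
    rw [hpre, measure_empty, Finset.prod_eq_zero hi (by simp [Measure.dirac_apply', hs, h0]),
      zero_mul]

theorem pi_angleMeasure_eq_sum : Measure.pi (fun _ : ι => angleMeasure) = ∑ J : Finset ι,
    (Measure.pi fun _ : {k // k ∉ J} => volume.restrict (Ioc 0 (2 * π))).map (extendAngle J) := by
  refine Measure.pi_eq fun s hs => ?_
  simp only [Measure.finsetSum_apply, map_extendAngle_pi _ _ hs, angleMeasure, Measure.add_apply]
  rw [Finset.prod_add, Finset.powerset_univ]

theorem chainMeasure_eq_sum : chainMeasure ι = ∑ J : Finset ι,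
    (volume.restrict (chainBox J)).map (Prod.map id (extendAngle J)) := by
  unfold chainMeasure
  rw [pi_angleMeasure_eq_sum, ← Measure.sum_fintype, Measure.prod_sum_right, Measure.sum_fintype]
  refine Finset.sum_congr rfl fun J _ => ?_
  rw [← restrict_Ioo_eq_restrict_Ioc, chainBox, Measure.volume_eq_prod, ← Measure.prod_restrict,
    volume_pi, Measure.restrict_pi_pi,
    ← Measure.map_prod_map _ _ measurable_id (measurable_extendAngle J), Measure.map_id]

end ChainDecomposition

section Density

/-- The density of Henkin's operator with respect to `chainMeasure`. -/
def henkinDensity {ι : Type*} [Fintype ι] (g : ι → (ι → ℂ) → ℂ) (z : ι → ℂ) (p : ℝ × (ι → ℝ)) :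
    ℂ :=
  cauchyKernel z p * ∑ k, radialFactor (p.2 k) * g k (chainPoint z p)

/-- Subtracting `c⁻¹` times the sum of the other columns from the column `none` makes the matrix
triangular. -/
theorem det_of_arrow {K R : Type*} [Fintype K] [DecidableEq K] [Field R] {a c : R} (hc : c ≠ 0)
    {b d : K → R} {M : Matrix (Option K) (Option K) R} (hcorner : M none none = a)
    (hrow : ∀ k, M none (some k) = b k) (hcol : ∀ k, M (some k) none = d k)
    (hdiag : ∀ j k, M (some j) (some k) = if j = k then c * d k else 0) :
    M.det = (∏ k, (c * d k)) * (a - ∑ k, b k / c) := by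
  set T : Matrix (Unit ⊕ K) (Unit ⊕ K) R :=
    Matrix.fromBlocks (Matrix.of fun _ _ => a - ∑ k, b k / c) (Matrix.of fun _ k => b k) 0
      (Matrix.diagonal fun k => c * d k) with hT
  set U : Matrix (Unit ⊕ K) (Unit ⊕ K) R :=
    Matrix.fromBlocks 1 0 (Matrix.of fun _ _ => c⁻¹) 1 with hU
  have hfactor : M.det = (T * U).det := by
    rw [← Matrix.det_submatrix_equiv_self ((Equiv.optionEquivSumPUnit K).trans
      (Equiv.sumComm _ _)).symm M]
    congr 1
    rw [hT, hU, Matrix.fromBlocks_multiply]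
    ext (i | i) (j | j)
    · simp [hcorner, Matrix.mul_apply, div_eq_mul_inv]
    · simp [hrow]
    · simp [hcol, Matrix.mul_apply, Matrix.diagonal_apply, ← div_eq_mul_inv, ite_div, hc]
    · by_cases h : i = j <;> simp [hdiag, h]
  rw [hfactor, Matrix.det_mul, hT, hU, Matrix.det_fromBlocks_zero₂₁, Matrix.det_fromBlocks_zero₁₂]
  simp [mul_comm]

variable {n : ℕ}

theorem henkinIntegrand_eq (g : Fin n → polydisc n → ℂ) (J : Finset (Fin n)) (z : Fin n → ℂ)
    {p : ℝ × ({k // k ∉ J} → ℝ)} (hr : p.1 ≠ 0) (hθ : ∀ k, p.2 k ≠ 0) :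
    henkinIntegrand g J z p = (∏ k : {k // k ∉ J}, cauchyWeight p.1 (z k) (p.2 k)) *
      ∑ k : {k // k ∉ J}, radialFactor (p.2 k) * zeroExt (g k) (henkinPoint J z p) := by
  have hI : (p.1 : ℂ) * Complex.I ≠ 0 := by simp [hr]
  have hpoint : ∀ k : {k // k ∉ J}, henkinPoint J z p k = circleMap 0 p.1 (p.2 k) :=
    fun k => by simp [henkinPoint, k.2, circleMap_zero]
  unfold henkinIntegrand
  rw [det_of_arrow hI (M := Matrix.of _)
    (a := ∑ k : {k // k ∉ J}, zeroExt (g k) (henkinPoint J z p) *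
      (starRingEnd ℂ) (circleMap 0 1 (p.2 k)))
    (b := fun k : {k // k ∉ J} => -(p.1 * Complex.I * (zeroExt (g k) (henkinPoint J z p) *
      (starRingEnd ℂ) (circleMap 0 1 (p.2 k)))))
    (d := fun k : {k // k ∉ J} => circleMap 0 1 (p.2 k) /
      (2 * π * Complex.I * (circleMap 0 p.1 (p.2 k) - z k)))]
  · congr 1
    · refine Finset.prod_congr rfl fun k _ => ?_
      rw [cauchyWeight, if_neg (hθ k), circleMap_zero, circleMap_zero, Complex.ofReal_one, one_mul,
        mul_div_assoc', mul_right_comm, mul_right_comm (2 * (π : ℂ)),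
        mul_div_mul_right _ _ Complex.I_ne_zero]
    · rw [← Finset.sum_sub_distrib]
      refine Finset.sum_congr rfl fun k _ => ?_
      rw [radialFactor, if_neg (hθ k), neg_div, mul_div_cancel_left₀ _ hI]
      ring
  · simp only [Matrix.of_apply, henkinFactor, henkinFrame]
    rw [← Fintype.sum_subtype_add_sum_subtype (fun i => i ∉ J), add_eq_left.2]
    · exact Finset.sum_congr rfl fun k _ => by simp [k.2, circleMap_zero]
    · exact Finset.sum_eq_zero fun k _ => by simp [not_not.1 k.2]
  · intro k
    simp only [Matrix.of_apply, henkinFactor, henkinFrame]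
    rw [Finset.sum_eq_single_of_mem k.1 (Finset.mem_univ _) fun j _ hj => by simp [hj]]
    simp only [Pi.single_eq_same, map_mul, Complex.conj_ofReal, Complex.conj_I, circleMap_zero,
      Complex.ofReal_one, one_mul]
    ring
  · intro k
    simp [henkinFactor, henkinFrame, hpoint, k.2, circleMap_zero]
  · intro j k
    simp only [Matrix.of_apply, henkinFactor, henkinFrame, hpoint]
    rcases eq_or_ne j k with rfl | h
    · simp [circleMap_zero, mul_div_assoc]
    · simp [h, Subtype.coe_injective.ne h]

theorem chainPoint_extendAngle (J : Finset (Fin n)) (z : Fin n → ℂ)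
    {p : ℝ × ({k // k ∉ J} → ℝ)} (hθ : ∀ k, p.2 k ≠ 0) :
    chainPoint z (Prod.map id (extendAngle J) p) = henkinPoint J z p := by
  funext i
  by_cases hi : i ∈ J
  · simp [chainPoint, henkinPoint, chainCoord, extendAngle, hi]
  · simp [chainPoint, henkinPoint, chainCoord, extendAngle, hi, hθ, circleMap_zero]

theorem cauchyKernel_extendAngle {ι : Type*} [Fintype ι] [DecidableEq ι] (J : Finset ι)
    (z : ι → ℂ) (p : ℝ × ({k // k ∉ J} → ℝ)) :
    cauchyKernel z (Prod.map id (extendAngle J) p) =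
      if ∀ j ∈ J, p.1 ≤ ‖z j‖ then ∏ k : {k // k ∉ J}, cauchyWeight p.1 (z k) (p.2 k) else 0 := by
  simp only [cauchyKernel, Prod.map_fst, Prod.map_snd, id]
  split_ifs with h
  · have hfrozen : ∏ k : {k // ¬k ∉ J}, cauchyWeight p.1 (z k) (extendAngle J p.2 k) = 1 :=
      Finset.prod_eq_one fun k _ => by
        have hk := not_not.1 k.2
        rw [extendAngle_of_mem hk, cauchyWeight, if_pos rfl, if_pos (h _ hk)]
    rw [← Fintype.prod_subtype_mul_prod_subtype (fun i => i ∉ J), hfrozen, mul_one]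
    exact Finset.prod_congr rfl fun k _ => by rw [extendAngle_coe]
  · push Not at h
    obtain ⟨j, hj, hlt⟩ := h
    refine Finset.prod_eq_zero (Finset.mem_univ j) ?_
    rw [extendAngle_of_mem hj, cauchyWeight, if_pos rfl, if_neg hlt.not_ge]

theorem sum_radialFactor_extendAngle {ι : Type*} [Fintype ι] [DecidableEq ι] (J : Finset ι)
    (θ : {k // k ∉ J} → ℝ) (u : ι → ℂ) :
    ∑ k, radialFactor (extendAngle J θ k) * u k =
      ∑ k : {k // k ∉ J}, radialFactor (θ k) * u k := by
  rw [← Fintype.sum_subtype_add_sum_subtype (fun i => i ∉ J), add_eq_left.2]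
  · exact Finset.sum_congr rfl fun k _ => by rw [extendAngle_coe]
  · exact Finset.sum_eq_zero fun k _ => by
      rw [extendAngle_of_mem (not_not.1 k.2), radialFactor, if_pos rfl, zero_mul]

theorem henkinDensity_extendAngle (g : Fin n → polydisc n → ℂ) (J : Finset (Fin n))
    (z : Fin n → ℂ) {p : ℝ × ({k // k ∉ J} → ℝ)} (hr : p.1 ≠ 0) (hθ : ∀ k, p.2 k ≠ 0) :
    henkinDensity (fun k => zeroExt (g k)) z (Prod.map id (extendAngle J) p) =
      {p | ∀ j ∈ J, p.1 ≤ ‖z j‖}.indicator (henkinIntegrand g J z) p := by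
  rw [henkinDensity, cauchyKernel_extendAngle, chainPoint_extendAngle J z hθ]
  simp only [indicator_apply, mem_ofPred_eq]
  split_ifs
  · rw [henkinIntegrand_eq g J z hr hθ, Prod.map_snd,
      sum_radialFactor_extendAngle J p.2 fun k => zeroExt (g k) (henkinPoint J z p)]
  · rw [zero_mul]

theorem henkinRegion_eq_inter (J : Finset (Fin n)) (z : Fin n → ℂ) :
    henkinRegion J z = {p | ∀ j ∈ J, p.1 ≤ ‖z j‖} ∩ chainBox J := by
  ext p
  simp only [henkinRegion, chainBox, mem_ofPred_eq, mem_inter_iff, mem_prod, mem_Ioo, mem_univ_pi]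
  tauto

theorem measurableSet_forall_le_norm (J : Finset (Fin n)) (z : Fin n → ℂ) :
    MeasurableSet {p : ℝ × ({k // k ∉ J} → ℝ) | ∀ j ∈ J, p.1 ≤ ‖z j‖} := by
  simp only [ofPred_forall]
  exact Finset.measurableSet_biInter J fun j _ => measurableSet_le measurable_fst measurable_const

theorem henkinDensity_extendAngle_ae_eq (g : Fin n → polydisc n → ℂ) (J : Finset (Fin n))
    (z : Fin n → ℂ) :
    henkinDensity (fun k => zeroExt (g k)) z ∘ Prod.map id (extendAngle J)
      =ᵐ[volume.restrict (chainBox J)]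
      {p | ∀ j ∈ J, p.1 ≤ ‖z j‖}.indicator (henkinIntegrand g J z) := by
  have hbox : MeasurableSet (chainBox J) :=
    measurableSet_Ioo.prod (MeasurableSet.univ_pi fun _ => measurableSet_Ioo)
  filter_upwards [ae_restrict_mem hbox] with p hp
  exact henkinDensity_extendAngle g J z hp.1.1.ne' fun k => (hp.2 k (mem_univ k)).1.ne'

theorem integrableOn_henkinIntegrand {g : Fin n → polydisc n → ℂ} {z : Fin n → ℂ}
    (h : Integrable (henkinDensity (fun k => zeroExt (g k)) z) (chainMeasure (Fin n)))
    (J : Finset (Fin n)) : IntegrableOn (henkinIntegrand g J z) (henkinRegion J z) := by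
  rw [chainMeasure_eq_sum, integrable_finsetSum_measure] at h
  have hJ := ((h J (Finset.mem_univ J)).comp_measurable (measurable_prodMap_extendAngle J)).congr
    (henkinDensity_extendAngle_ae_eq g J z)
  rwa [integrable_indicator_iff (measurableSet_forall_le_norm J z), IntegrableOn,
    Measure.restrict_restrict (measurableSet_forall_le_norm J z), ← henkinRegion_eq_inter] at hJ

theorem henkin_eq_neg_integral {g : Fin n → polydisc n → ℂ} {z : polydisc n}
    (h : Integrable (henkinDensity (fun k => zeroExt (g k)) z) (chainMeasure (Fin n))) :
    henkin g z = -∫ p, henkinDensity (fun k => zeroExt (g k)) z p ∂(chainMeasure (Fin n)) := by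
  rw [chainMeasure_eq_sum, integrable_finsetSum_measure] at h
  rw [chainMeasure_eq_sum, integral_finsetSum_measure h, henkin, Finset.sum_filter]
  congr 1
  refine Finset.sum_congr rfl fun J hJ => ?_
  have hface : ∫ p, henkinDensity (fun k => zeroExt (g k)) z p
        ∂((volume.restrict (chainBox J)).map (Prod.map id (extendAngle J))) =
      ∫ p in henkinRegion J (z : Fin n → ℂ), henkinIntegrand g J z p := by
    rw [integral_map (measurable_prodMap_extendAngle J).aemeasurable (h J hJ).1]
    refine (integral_congr_ae (henkinDensity_extendAngle_ae_eq g J z)).trans ?_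
    rw [integral_indicator (measurableSet_forall_le_norm J z),
      Measure.restrict_restrict (measurableSet_forall_le_norm J z), henkinRegion_eq_inter]
  rw [hface]
  split_ifs with hproper
  · rfl
  · obtain rfl : J = Finset.univ := not_not.1 hproper
    refine (setIntegral_eq_zero_of_forall_eq_zero fun p hp => ?_).symm
    rw [henkinIntegrand_eq g _ _ hp.1.1.ne' fun k => (hp.2 k).1.ne', Finset.sum_eq_zero, mul_zero]
    exact fun k _ => absurd (Finset.mem_univ _) k.2

end Density

/-! ### Hölder estimates -/

section Polydisc

variable {n : ℕ}

theorem zeroExt_of_mem (f : polydisc n → ℂ) {z : Fin n → ℂ} (hz : z ∈ polydisc n) :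
    zeroExt f z = f ⟨z, hz⟩ :=
  dif_pos hz

theorem continuousOn_zeroExt {f : polydisc n → ℂ} (hf : Continuous f) :
    ContinuousOn (zeroExt f) (polydisc n : Set (Fin n → ℂ)) := by
  rw [continuousOn_iff_continuous_domRestrict]
  exact hf.congr fun z => (zeroExt_of_mem f z.2).symm

theorem measurable_zeroExt {f : polydisc n → ℂ} (hf : Continuous f) : Measurable (zeroExt f) := by
  classical
  exact Measurable.dite hf.measurable measurable_const (polydisc n).isOpen.measurableSet

theorem zero_mem_polydisc (n : ℕ) : (0 : Fin n → ℂ) ∈ polydisc n := fun i => by simp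

instance (n : ℕ) : Nonempty (polydisc n) := ⟨⟨0, zero_mem_polydisc n⟩⟩

theorem dist_polydisc_le (z w : polydisc n) : dist z w ≤ 2 := by
  rw [Subtype.dist_eq, dist_pi_le_iff zero_le_two]
  intro i
  have hz : ‖(z : Fin n → ℂ) i‖ < 1 := z.2 i
  have hw : ‖(w : Fin n → ℂ) i‖ < 1 := w.2 i
  linarith [dist_le_norm_add_norm ((z : Fin n → ℂ) i) ((w : Fin n → ℂ) i)]

theorem update_mem_polydisc {z : Fin n → ℂ} (hz : z ∈ polydisc n) (i : Fin n) {a : ℂ}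
    (ha : ‖a‖ < 1) : Function.update z i a ∈ polydisc n := by
  intro j
  rcases eq_or_ne j i with rfl | h
  · simpa using ha
  · simpa [h] using hz j

theorem norm_le_one_of_mem_polydisc {z : Fin n → ℂ} (hz : z ∈ polydisc n) (j : Fin n) :
    ‖z j‖ ≤ 1 :=
  (hz j).le

theorem chainPoint_mem_polydisc {z : Fin n → ℂ} (hz : z ∈ polydisc n) {p : ℝ × (Fin n → ℝ)}
    (hp : p.1 ∈ Ioo (0 : ℝ) 1) : chainPoint z p ∈ polydisc n := fun j =>
  (norm_chainCoord_le hp.1.le (z j) (p.2 j)).trans_lt (max_lt hp.2 (hz j))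

variable {α : ℝ≥0} {f : polydisc n → ℂ}

theorem bddAbove_norm_of_memHolder (hf : MemHolder α f) : BddAbove (range fun z => ‖f z‖) := by
  obtain ⟨C, hC⟩ := hf
  set o : polydisc n := ⟨0, zero_mem_polydisc n⟩
  refine ⟨‖f o‖ + C * 2 ^ (α : ℝ), forall_mem_range.2 fun z => ?_⟩
  have hdist : ‖f z - f o‖ ≤ C * 2 ^ (α : ℝ) := by
    simpa [dist_eq_norm] using hC.dist_le_of_le (dist_polydisc_le z o)
  exact (norm_le_norm_add_norm_sub' (f z) (f o)).trans (by gcongr)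

theorem norm_zeroExt_le (hf : MemHolder α f) (z : Fin n → ℂ) : ‖zeroExt f z‖ ≤ ⨆ z, ‖f z‖ := by
  unfold zeroExt
  split_ifs with h
  · exact le_ciSup (bddAbove_norm_of_memHolder hf) (⟨z, h⟩ : polydisc n)
  · rw [norm_zero]
    exact Real.iSup_nonneg fun _ => norm_nonneg _

theorem norm_zeroExt_sub_le (hf : MemHolder α f) {z w : Fin n → ℂ} (hz : z ∈ polydisc n)
    (hw : w ∈ polydisc n) {d : ℝ} (h : dist z w ≤ d) :
    ‖zeroExt f z - zeroExt f w‖ ≤ nnHolderNorm α f * d ^ (α : ℝ) := by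
  rw [zeroExt_of_mem f hz, zeroExt_of_mem f hw, ← dist_eq_norm]
  exact hf.holderWith.dist_le_of_le h

theorem sum_iSup_norm_le_formHolderNorm (α : ℝ≥0) (g : Fin n → polydisc n → ℂ) :
    ∑ k, (⨆ z, ‖g k z‖) ≤ formHolderNorm α g :=
  Finset.sum_le_sum fun _ _ => le_add_of_nonneg_right NNReal.zero_le_coe

theorem sum_nnHolderNorm_le_formHolderNorm (α : ℝ≥0) (g : Fin n → polydisc n → ℂ) :
    ∑ k, (nnHolderNorm α (g k) : ℝ) ≤ formHolderNorm α g :=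
  Finset.sum_le_sum fun _ _ => le_add_of_nonneg_left (Real.iSup_nonneg fun _ => norm_nonneg _)

theorem formHolderNorm_nonneg (α : ℝ≥0) (g : Fin n → polydisc n → ℂ) : 0 ≤ formHolderNorm α g :=
  (Finset.sum_nonneg fun _ _ => NNReal.zero_le_coe).trans (sum_nnHolderNorm_le_formHolderNorm α g)

end Polydisc

section DensityBound

variable {ι : Type*} [Fintype ι]

theorem ae_fst_mem_Ioo : ∀ᵐ p ∂(chainMeasure ι), p.1 ∈ Ioo (0 : ℝ) 1 :=
  Measure.quasiMeasurePreserving_fst.ae (ae_restrict_mem measurableSet_Ioo)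

theorem ae_fst_ne (ρ : ℝ) : ∀ᵐ p ∂(chainMeasure ι), p.1 ≠ ρ :=
  Measure.quasiMeasurePreserving_fst.ae (ae_restrict_of_ae (Measure.ae_ne volume ρ))

theorem measurable_henkinDensity {X : Type*} [MeasurableSpace X] {g : ι → (ι → ℂ) → ℂ}
    (hg : ∀ k, Measurable (g k)) {z : X → ι → ℂ} {p : X → ℝ × (ι → ℝ)} (hz : Measurable z)
    (hp : Measurable p) : Measurable fun x => henkinDensity g (z x) (p x) :=
  (measurable_cauchyKernel hz hp).mul <| Finset.measurable_fun_sum _ fun k _ =>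
    (measurable_radialFactor.comp ((measurable_pi_apply k).comp hp.snd)).mul
      ((hg k).comp (measurable_chainPoint hz hp))

theorem norm_sum_radialFactor_mul_le {u : ι → ℂ} {M : ι → ℝ} (hM : ∀ k, ‖u k‖ ≤ M k)
    (θ : ι → ℝ) : ‖∑ k, radialFactor (θ k) * u k‖ ≤ 2 * ∑ k, M k := by
  rw [Finset.mul_sum]
  refine norm_sum_le_of_le _ fun k _ => ?_
  rw [norm_mul]
  exact mul_le_mul (norm_radialFactor_le _) (hM k) (norm_nonneg _) zero_le_two

theorem norm_henkinDensity_le {g : ι → (ι → ℂ) → ℂ} {M : ι → ℝ} (hM : ∀ k z, ‖g k z‖ ≤ M k)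
    (z : ι → ℂ) (p : ℝ × (ι → ℝ)) :
    ‖henkinDensity g z p‖ ≤ ‖cauchyKernel z p‖ * (2 * ∑ k, M k) := by
  rw [henkinDensity, norm_mul]
  gcongr
  exact norm_sum_radialFactor_mul_le (fun k => hM k _) _

theorem integrable_henkinDensity {g : ι → (ι → ℂ) → ℂ} {M : ι → ℝ} (hg : ∀ k, Measurable (g k))
    (hM : ∀ k z, ‖g k z‖ ≤ M k) {z : ι → ℂ} (hz : ∀ j, ‖z j‖ ≤ 1) :
    Integrable (henkinDensity g z) (chainMeasure ι) :=
  ((integrable_cauchyKernel hz).norm.mul_const (2 * ∑ k, M k)).mono'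
    (measurable_henkinDensity hg measurable_const measurable_id).aestronglyMeasurable
    (ae_of_all _ (norm_henkinDensity_le hM z))

end DensityBound

section HolderEstimate

variable {α : ℝ}

theorem le_rpow_mul_add_of_le_add (hα0 : 0 ≤ α) (hα1 : α ≤ 1) {δ a b : ℝ} (hδ : 0 ≤ δ)
    (ha : 0 ≤ a) (hb : 0 ≤ b) (h : δ ≤ a + b) :
    δ ≤ δ ^ α * (a ^ (1 - α) + b ^ (1 - α)) := by
  have hsub : 0 ≤ 1 - α := sub_nonneg.2 hα1
  calc δ = δ ^ α * δ ^ (1 - α) := by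
        rw [← Real.rpow_add_of_nonneg hδ hα0 hsub, add_sub_cancel, Real.rpow_one]
    _ ≤ δ ^ α * (a + b) ^ (1 - α) := by gcongr
    _ ≤ δ ^ α * (a ^ (1 - α) + b ^ (1 - α)) := by
        gcongr
        exact Real.rpow_add_le_add_rpow ha hb hsub (sub_le_self 1 hα0)

theorem div_mul_le_rpow_mul (hα0 : 0 ≤ α) (hα1 : α ≤ 1) {δ a b : ℝ} (hδ : 0 ≤ δ)
    (ha : 0 < a) (hb : 0 < b) (h : δ ≤ a + b) :
    δ / (a * b) ≤ δ ^ α * (a ^ (-α) / b + b ^ (-α) / a) := by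
  calc δ / (a * b) ≤ δ ^ α * (a ^ (1 - α) + b ^ (1 - α)) / (a * b) := by
        gcongr
        exact le_rpow_mul_add_of_le_add hα0 hα1 hδ ha.le hb.le h
    _ = δ ^ α * (a ^ (-α) / b + b ^ (-α) / a) := by
        rw [sub_eq_add_neg, Real.rpow_add ha, Real.rpow_add hb, Real.rpow_one, Real.rpow_one]
        field_simp

variable {r : ℝ} {z w : ℂ}

theorem norm_cauchyWeight_zero_sub_le (hα0 : 0 ≤ α) (hz : r ≠ ‖z‖) (hw : r ≠ ‖w‖) :
    ‖cauchyWeight r z 0 - cauchyWeight r w 0‖ ≤ ‖z - w‖ ^ α *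
      (|r - ‖z‖| ^ (-α) * ‖cauchyWeight r w 0‖ + |r - ‖w‖| ^ (-α) * ‖cauchyWeight r z 0‖) := by
  have hnorm : |‖z‖ - ‖w‖| ≤ ‖z - w‖ := abs_norm_sub_norm_le z w
  have one_le : ∀ x : ℝ, 0 < x → x ≤ ‖z - w‖ → 1 ≤ ‖z - w‖ ^ α * x ^ (-α) := by
    intro x hx hxz
    rw [Real.rpow_neg hx.le, ← div_eq_mul_inv, one_le_div (by positivity)]
    exact Real.rpow_le_rpow hx.le hxz hα0
  have hz0 : 0 < |r - ‖z‖| := abs_pos.2 (sub_ne_zero.2 hz)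
  have hw0 : 0 < |r - ‖w‖| := abs_pos.2 (sub_ne_zero.2 hw)
  simp only [cauchyWeight, if_true]
  rcases lt_or_ge ‖z‖ r with hzr | hzr <;> rcases lt_or_ge ‖w‖ r with hwr | hwr
  · simp [hzr.not_ge, hwr.not_ge]
  · simp only [hzr.not_ge, hwr, if_true, if_false, zero_sub, norm_neg, norm_one, mul_one,
      norm_zero, mul_zero, add_zero]
    exact one_le _ hz0 (by rw [abs_of_pos (by linarith)]; linarith [neg_abs_le (‖z‖ - ‖w‖)])
  · simp only [hwr.not_ge, hzr, if_true, if_false, sub_zero, norm_one, mul_one, norm_zero,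
      mul_zero, zero_add]
    exact one_le _ hw0 (by rw [abs_of_pos (by linarith)]; linarith [le_abs_self (‖z‖ - ‖w‖)])
  · simp only [hzr, hwr, if_true, sub_self, norm_zero]
    positivity

theorem norm_cauchyWeight_sub_of_ne_zero (hr : 0 ≤ r) (hz : r ≠ ‖z‖) (hw : r ≠ ‖w‖) {θ : ℝ}
    (hθ : θ ≠ 0) : ‖cauchyWeight r z θ - cauchyWeight r w θ‖ =
      r / (2 * π) * (‖z - w‖ / (‖circleMap 0 r θ - z‖ * ‖circleMap 0 r θ - w‖)) := by
  have hcz : circleMap 0 r θ - z ≠ 0 := sub_ne_zero.2 (circleMap_ne_of_ne_norm hr hz θ)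
  have hcw : circleMap 0 r θ - w ≠ 0 := sub_ne_zero.2 (circleMap_ne_of_ne_norm hr hw θ)
  have hdiff : cauchyWeight r z θ - cauchyWeight r w θ =
      circleMap 0 r θ / (2 * π) *
        ((z - w) / ((circleMap 0 r θ - z) * (circleMap 0 r θ - w))) := by
    rw [cauchyWeight, cauchyWeight, if_neg hθ, if_neg hθ]
    field_simp
    ring
  rw [hdiff, norm_mul, norm_div, norm_div, norm_mul (_ - z), norm_circleMap_zero,
    abs_of_nonneg hr]
  simp [abs_of_pos Real.pi_pos]

theorem norm_cauchyWeight_sub_le (hα0 : 0 ≤ α) (hα1 : α ≤ 1) (hr : 0 ≤ r) (hz : r ≠ ‖z‖)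
    (hw : r ≠ ‖w‖) (θ : ℝ) :
    ‖cauchyWeight r z θ - cauchyWeight r w θ‖ ≤ ‖z - w‖ ^ α *
      (|r - ‖z‖| ^ (-α) * ‖cauchyWeight r w θ‖ + |r - ‖w‖| ^ (-α) * ‖cauchyWeight r z θ‖) := by
  rcases eq_or_ne θ 0 with rfl | hθ
  · exact norm_cauchyWeight_zero_sub_le hα0 hz hw
  have hz0 : 0 < |r - ‖z‖| := abs_pos.2 (sub_ne_zero.2 hz)
  have hw0 : 0 < |r - ‖w‖| := abs_pos.2 (sub_ne_zero.2 hw)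
  have ha := abs_sub_norm_le_norm_circleMap_sub hr z θ
  have hb := abs_sub_norm_le_norm_circleMap_sub hr w θ
  have hab : ‖z - w‖ ≤ ‖circleMap 0 r θ - z‖ + ‖circleMap 0 r θ - w‖ := by
    rw [norm_sub_rev _ z]
    exact norm_sub_le_norm_sub_add_norm_sub z _ w
  rw [norm_cauchyWeight_sub_of_ne_zero hr hz hw hθ, norm_cauchyWeight_of_ne_zero hr z hθ,
    norm_cauchyWeight_of_ne_zero hr w hθ]
  set a := ‖circleMap 0 r θ - z‖
  set b := ‖circleMap 0 r θ - w‖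
  have ha0 : 0 < a := hz0.trans_le ha
  have hb0 : 0 < b := hw0.trans_le hb
  calc r / (2 * π) * (‖z - w‖ / (a * b))
      ≤ r / (2 * π) * (‖z - w‖ ^ α * (a ^ (-α) / b + b ^ (-α) / a)) := by
        gcongr
        exact div_mul_le_rpow_mul hα0 hα1 (norm_nonneg _) ha0 hb0 hab
    _ = ‖z - w‖ ^ α * (a ^ (-α) * (r / (2 * π * b)) + b ^ (-α) * (r / (2 * π * a))) := by
        field_simp
    _ ≤ _ := by
        gcongr ?_ * (?_ * _ + ?_ * _)
        · exact Real.rpow_le_rpow_of_nonpos hz0 ha (neg_nonpos.2 hα0)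
        · exact Real.rpow_le_rpow_of_nonpos hw0 hb (neg_nonpos.2 hα0)

section Update

variable {ι : Type*} [DecidableEq ι] [Fintype ι]

theorem cauchyKernel_update (z : ι → ℂ) (i : ι) (a : ℂ) (p : ℝ × (ι → ℝ)) :
    cauchyKernel (Function.update z i a) p = cauchyWeight p.1 a (p.2 i) *
      ∏ j ∈ Finset.univ.erase i, cauchyWeight p.1 (z j) (p.2 j) := by
  rw [cauchyKernel, ← Finset.mul_prod_erase _ _ (Finset.mem_univ i), Function.update_self]
  congr 1
  refine Finset.prod_congr rfl fun j hj => ?_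
  rw [Function.update_of_ne (Finset.ne_of_mem_erase hj)]

theorem norm_cauchyKernel_sub_update_le (hα0 : 0 ≤ α) (hα1 : α ≤ 1) (z : ι → ℂ) (i : ι) (a : ℂ)
    {p : ℝ × (ι → ℝ)} (hr : 0 ≤ p.1) (hz : p.1 ≠ ‖z i‖) (ha : p.1 ≠ ‖a‖) :
    ‖cauchyKernel z p - cauchyKernel (Function.update z i a) p‖ ≤ ‖z i - a‖ ^ α *
      (|p.1 - ‖z i‖| ^ (-α) * ‖cauchyKernel (Function.update z i a) p‖ +
        |p.1 - ‖a‖| ^ (-α) * ‖cauchyKernel z p‖) := by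
  have hself := cauchyKernel_update z i (z i) p
  rw [Function.update_eq_self] at hself
  rw [cauchyKernel_update, hself, ← sub_mul, norm_mul, norm_mul, norm_mul]
  refine (mul_le_mul_of_nonneg_right (norm_cauchyWeight_sub_le hα0 hα1 hr hz ha _)
    (norm_nonneg _)).trans_eq ?_
  ring

theorem dist_chainPoint_update_le (z : ι → ℂ) (i : ι) (a : ℂ) (p : ℝ × (ι → ℝ)) :
    dist (chainPoint z p) (chainPoint (Function.update z i a) p) ≤ ‖z i - a‖ := by
  rw [dist_pi_le_iff (norm_nonneg _)]
  intro j
  unfold chainPoint chainCoord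
  rcases eq_or_ne j i with rfl | h
  · split_ifs <;> simp [dist_eq_norm]
  · simp [h]

end Update

end HolderEstimate

section HolderBound

variable {n : ℕ} {α : ℝ≥0} {g : Fin n → polydisc n → ℂ}

theorem norm_sum_radialFactor_zeroExt_le (hg : ∀ k, MemHolder α (g k)) (θ : Fin n → ℝ)
    (ζ : Fin n → ℂ) : ‖∑ k, radialFactor (θ k) * zeroExt (g k) ζ‖ ≤ 2 * formHolderNorm α g :=
  (norm_sum_radialFactor_mul_le (fun k => norm_zeroExt_le (hg k) ζ) θ).trans
    (by gcongr; exact sum_iSup_norm_le_formHolderNorm α g)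

theorem norm_sum_radialFactor_zeroExt_sub_le (hg : ∀ k, MemHolder α (g k)) (θ : Fin n → ℝ)
    {ζ η : Fin n → ℂ} (hζ : ζ ∈ polydisc n) (hη : η ∈ polydisc n) {d : ℝ} (h : dist ζ η ≤ d) :
    ‖∑ k, radialFactor (θ k) * zeroExt (g k) ζ - ∑ k, radialFactor (θ k) * zeroExt (g k) η‖ ≤
      2 * formHolderNorm α g * d ^ (α : ℝ) := by
  have hd : 0 ≤ d := dist_nonneg.trans h
  simp only [← Finset.sum_sub_distrib, ← mul_sub]
  refine (norm_sum_radialFactor_mul_le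
    (fun k => norm_zeroExt_sub_le (hg k) hζ hη h) θ).trans ?_
  rw [← Finset.sum_mul, ← mul_assoc]
  gcongr
  exact sum_nnHolderNorm_le_formHolderNorm α g

theorem norm_henkinDensity_sub_update_le (hα1 : α ≤ 1) (hg : ∀ k, MemHolder α (g k))
    {z : Fin n → ℂ} (hz : z ∈ polydisc n) (i : Fin n) {a : ℂ} (ha : ‖a‖ < 1)
    {p : ℝ × (Fin n → ℝ)} (hp : p.1 ∈ Ioo (0 : ℝ) 1) (hpz : p.1 ≠ ‖z i‖) (hpa : p.1 ≠ ‖a‖) :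
    ‖henkinDensity (fun k => zeroExt (g k)) z p -
        henkinDensity (fun k => zeroExt (g k)) (Function.update z i a) p‖ ≤
      2 * formHolderNorm α g * ‖z i - a‖ ^ (α : ℝ) *
        (|p.1 - ‖z i‖| ^ (-(α : ℝ)) * ‖cauchyKernel (Function.update z i a) p‖ +
          |p.1 - ‖a‖| ^ (-(α : ℝ)) * ‖cauchyKernel z p‖ +
          ‖cauchyKernel (Function.update z i a) p‖) := by
  have hkernel := norm_cauchyKernel_sub_update_le α.coe_nonneg (by exact_mod_cast hα1) z i a
    hp.1.le hpz hpa
  have hform := norm_sum_radialFactor_zeroExt_le hg p.2 (chainPoint z p)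
  have hdiff := norm_sum_radialFactor_zeroExt_sub_le hg p.2 (chainPoint_mem_polydisc hz hp)
    (chainPoint_mem_polydisc (update_mem_polydisc hz i ha) hp) (dist_chainPoint_update_le z i a p)
  unfold henkinDensity
  set K := cauchyKernel z p
  set K' := cauchyKernel (Function.update z i a) p
  set X := ∑ k, radialFactor (p.2 k) * zeroExt (g k) (chainPoint z p)
  set X' := ∑ k, radialFactor (p.2 k) * zeroExt (g k) (chainPoint (Function.update z i a) p)
  calc ‖K * X - K' * X'‖ = ‖(K - K') * X + K' * (X - X')‖ := by congr 1; ring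
    _ ≤ ‖K - K'‖ * ‖X‖ + ‖K'‖ * ‖X - X'‖ := by
        rw [← norm_mul, ← norm_mul]
        exact norm_add_le _ _
    _ ≤ _ := add_le_add (mul_le_mul hkernel hform (norm_nonneg _) (by positivity))
          (mul_le_mul_of_nonneg_left hdiff (norm_nonneg _))
    _ = _ := by ring

theorem norm_sub_le_of_coordinatewise {f : (Fin n → ℂ) → ℂ} {K α : ℝ} (hK : 0 ≤ K)
    (hα : 0 ≤ α)
    (h : ∀ z ∈ polydisc n, ∀ i, ∀ a : ℂ, ‖a‖ < 1 →
      ‖f z - f (Function.update z i a)‖ ≤ K * ‖z i - a‖ ^ α)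
    {z w : Fin n → ℂ} (hz : z ∈ polydisc n) (hw : w ∈ polydisc n) :
    ‖f z - f w‖ ≤ n * K * dist z w ^ α := by
  classical
  have hpartial : ∀ s : Finset (Fin n), s.piecewise w z ∈ polydisc n ∧
      ‖f z - f (s.piecewise w z)‖ ≤ s.card * K * dist z w ^ α := by
    intro s
    induction s using Finset.induction_on with
    | empty => simpa using hz
    | insert i s hi ih =>
      rw [Finset.piecewise_insert]
      refine ⟨update_mem_polydisc ih.1 i (hw i), ?_⟩
      have hstep := h _ ih.1 i (w i) (hw i)
      rw [Finset.piecewise_eq_of_notMem _ _ _ hi] at hstep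
      have hdist : ‖z i - w i‖ ≤ dist z w := by
        rw [← dist_eq_norm]
        exact dist_le_pi_dist z w i
      rw [Finset.card_insert_of_notMem hi, Nat.cast_add_one]
      calc _ ≤ ‖f z - f (s.piecewise w z)‖ + ‖f (s.piecewise w z) -
            f (Function.update (s.piecewise w z) i (w i))‖ := norm_sub_le_norm_sub_add_norm_sub ..
        _ ≤ s.card * K * dist z w ^ α + K * dist z w ^ α :=
            add_le_add ih.2 (hstep.trans (by gcongr))
        _ = _ := by ring
  have huniv := (hpartial Finset.univ).2
  rwa [Finset.card_univ, Fintype.card_fin, Finset.piecewise_univ] at huniv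

theorem integrable_henkinDensity_zeroExt (hα0 : 0 < α) (hg : ∀ k, MemHolder α (g k))
    {z : Fin n → ℂ} (hz : z ∈ polydisc n) :
    Integrable (henkinDensity (fun k => zeroExt (g k)) z) (chainMeasure (Fin n)) :=
  integrable_henkinDensity
    (fun k => measurable_zeroExt ((hg k).holderWith.continuous hα0))
    (fun k => norm_zeroExt_le (hg k)) (norm_le_one_of_mem_polydisc hz)

theorem exists_norm_henkin_le (n : ℕ) : ∃ C : ℝ, ∀ {α : ℝ≥0}, 0 < α →
    ∀ g : Fin n → polydisc n → ℂ, (∀ k, MemHolder α (g k)) → ∀ z : polydisc n,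
      ‖henkin g z‖ ≤ C * formHolderNorm α g := by
  obtain ⟨B, -, hB⟩ := exists_integral_rpow_mul_norm_cauchyKernel_le (Fin n) le_rfl one_pos
  simp only [neg_zero, Real.rpow_zero, one_mul] at hB
  refine ⟨2 * B, fun {α} hα0 g hg z => ?_⟩
  have hz := norm_le_one_of_mem_polydisc z.2
  rw [henkin_eq_neg_integral (integrable_henkinDensity_zeroExt hα0 hg z.2), norm_neg]
  calc ‖∫ p, henkinDensity (fun k => zeroExt (g k)) z p ∂(chainMeasure (Fin n))‖
      ≤ ∫ p, ‖cauchyKernel (z : Fin n → ℂ) p‖ * (2 * formHolderNorm α g)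
          ∂(chainMeasure (Fin n)) := by
        refine norm_integral_le_of_norm_le ((integrable_cauchyKernel hz).norm.mul_const _)
          (ae_of_all _ fun p => ?_)
        rw [henkinDensity, norm_mul]
        exact mul_le_mul_of_nonneg_left (norm_sum_radialFactor_zeroExt_le hg _ _) (norm_nonneg _)
    _ = (∫ p, ‖cauchyKernel (z : Fin n → ℂ) p‖ ∂(chainMeasure (Fin n))) *
          (2 * formHolderNorm α g) := integral_mul_const _ _
    _ ≤ B * (2 * formHolderNorm α g) := by
        have := formHolderNorm_nonneg α g
        gcongr
        exact hB z 0 hz (by simp)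
    _ = 2 * B * formHolderNorm α g := by ring

theorem exists_norm_integral_henkinDensity_sub_update_le (n : ℕ) {α : ℝ≥0} (hα1 : α < 1) :
    ∃ C : ℝ, 0 ≤ C ∧ ∀ g : Fin n → polydisc n → ℂ, 0 < α → (∀ k, MemHolder α (g k)) →
      ∀ z ∈ polydisc n, ∀ i, ∀ a : ℂ, ‖a‖ < 1 →
        ‖(∫ p, henkinDensity (fun k => zeroExt (g k)) z p ∂(chainMeasure (Fin n))) -
          ∫ p, henkinDensity (fun k => zeroExt (g k)) (Function.update z i a) p
            ∂(chainMeasure (Fin n))‖ ≤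
        C * formHolderNorm α g * ‖z i - a‖ ^ (α : ℝ) := by
  have hα1' : (α : ℝ) < 1 := by exact_mod_cast hα1
  obtain ⟨A, hA0, hA⟩ :=
    exists_integral_rpow_mul_norm_cauchyKernel_le (Fin n) α.coe_nonneg hα1'
  obtain ⟨B, hB0, hB⟩ := exists_integral_rpow_mul_norm_cauchyKernel_le (Fin n) le_rfl one_pos
  simp only [neg_zero, Real.rpow_zero, one_mul] at hB
  refine ⟨2 * (A + A + B), by positivity, fun g hα0 hg z hz i a ha => ?_⟩
  have hz' := update_mem_polydisc hz i ha
  have hz1 := norm_le_one_of_mem_polydisc hz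
  have hz1' := norm_le_one_of_mem_polydisc hz'
  have hN := formHolderNorm_nonneg α g
  set z' := Function.update z i a
  have hint₁ := integrable_rpow_mul_norm_cauchyKernel α.coe_nonneg hα1' hz1' ‖z i‖
  have hint₂ := integrable_rpow_mul_norm_cauchyKernel α.coe_nonneg hα1' hz1 ‖a‖
  have hint₃ := (integrable_cauchyKernel hz1').norm
  rw [← integral_sub (integrable_henkinDensity_zeroExt hα0 hg hz)
    (integrable_henkinDensity_zeroExt hα0 hg hz')]
  calc _ ≤ ∫ p, 2 * formHolderNorm α g * ‖z i - a‖ ^ (α : ℝ) *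
          (|p.1 - ‖z i‖| ^ (-(α : ℝ)) * ‖cauchyKernel z' p‖ +
            |p.1 - ‖a‖| ^ (-(α : ℝ)) * ‖cauchyKernel z p‖ + ‖cauchyKernel z' p‖)
          ∂(chainMeasure (Fin n)) := by
        refine norm_integral_le_of_norm_le (((hint₁.add hint₂).add hint₃).const_mul _) ?_
        filter_upwards [ae_fst_mem_Ioo, ae_fst_ne ‖z i‖, ae_fst_ne ‖a‖] with p hp hpz hpa
        exact norm_henkinDensity_sub_update_le hα1.le hg hz i ha hp hpz hpa
    _ = 2 * formHolderNorm α g * ‖z i - a‖ ^ (α : ℝ) *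
          ((∫ p, |p.1 - ‖z i‖| ^ (-(α : ℝ)) * ‖cauchyKernel z' p‖ ∂(chainMeasure (Fin n))) +
            (∫ p, |p.1 - ‖a‖| ^ (-(α : ℝ)) * ‖cauchyKernel z p‖ ∂(chainMeasure (Fin n))) +
            ∫ p, ‖cauchyKernel z' p‖ ∂(chainMeasure (Fin n))) := by
        rw [integral_const_mul, integral_add (hint₁.fun_add hint₂) hint₃, integral_add hint₁ hint₂]
    _ ≤ 2 * formHolderNorm α g * ‖z i - a‖ ^ (α : ℝ) * (A + A + B) := by
        gcongr
        · exact hA z' _ hz1' ⟨norm_nonneg _, hz1 i⟩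
        · exact hA z _ hz1 ⟨norm_nonneg _, ha.le⟩
        · exact hB z' 0 hz1' (by simp)
    _ = _ := by ring

theorem exists_norm_henkin_sub_le (n : ℕ) {α : ℝ≥0} (hα1 : α < 1) :
    ∃ C : ℝ, ∀ g : Fin n → polydisc n → ℂ, 0 < α → (∀ k, MemHolder α (g k)) →
      ∀ z w : polydisc n, ‖henkin g z - henkin g w‖ ≤
        C * formHolderNorm α g * dist z w ^ (α : ℝ) := by
  obtain ⟨C, hC0, hC⟩ := exists_norm_integral_henkinDensity_sub_update_le n hα1
  refine ⟨n * C, fun g hα0 hg z w => ?_⟩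
  have hN := formHolderNorm_nonneg α g
  rw [henkin_eq_neg_integral (integrable_henkinDensity_zeroExt hα0 hg z.2),
    henkin_eq_neg_integral (integrable_henkinDensity_zeroExt hα0 hg w.2), neg_sub_neg,
    norm_sub_rev, Subtype.dist_eq, mul_assoc (n : ℝ)]
  exact norm_sub_le_of_coordinatewise (by positivity) α.coe_nonneg (hC g hα0 hg) z.2 w.2

end HolderBound

/-! ### Integration by parts in one variable -/

section WirtingerDerivative

/-- The Wirtinger derivative `∂f/∂z̄` of a function of one complex variable. -/
def dbar (f : ℂ → ℂ) (z : ℂ) : ℂ := (fderiv ℝ f z 1 + Complex.I * fderiv ℝ f z Complex.I) / 2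

variable {f : ℂ → ℂ} {z : ℂ}

theorem dbar_mul {g : ℂ → ℂ} (hf : DifferentiableAt ℝ f z) (hg : DifferentiableAt ℝ g z) :
    dbar (fun w => f w * g w) z = dbar f z * g z + f z * dbar g z := by
  simp only [dbar, fderiv_fun_mul hf hg, add_apply, smul_apply, smul_eq_mul]
  ring

theorem dbar_eq_zero_of_differentiableAt (hf : DifferentiableAt ℂ f z) : dbar f z = 0 := by
  have hI : fderiv ℂ f z Complex.I = Complex.I * fderiv ℂ f z 1 := by
    rw [← smul_eq_mul, ← map_smul, smul_eq_mul, mul_one]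
  rw [dbar, hf.fderiv_restrictScalars ℝ, ContinuousLinearMap.coe_restrictScalars', hI,
    ← mul_assoc, Complex.I_mul_I, neg_one_mul, add_neg_cancel, zero_div]

theorem dbar_mul_of_differentiableAt {g : ℂ → ℂ} (hf : DifferentiableAt ℂ f z)
    (hg : DifferentiableAt ℝ g z) : dbar (fun w => f w * g w) z = f z * dbar g z := by
  rw [dbar_mul (hf.restrictScalars ℝ) hg, dbar_eq_zero_of_differentiableAt hf, zero_mul, zero_add]

theorem dbar_comp_add (f : ℂ → ℂ) (a z : ℂ) : dbar (fun w => f (w + a)) z = dbar f (z + a) := by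
  rw [dbar, dbar, fderiv_comp_add_right]

theorem continuous_dbar (hf : ContDiff ℝ 1 f) : Continuous (dbar f) := by
  have := hf.continuous_fderiv (by simp)
  unfold dbar
  fun_prop

theorem support_dbar_subset (f : ℂ → ℂ) : Function.support (dbar f) ⊆ tsupport f := by
  refine fun z hz => support_fderiv_subset ℝ fun h => hz ?_
  simp [dbar, h]

theorem hasCompactSupport_dbar (hf : HasCompactSupport f) : HasCompactSupport (dbar f) :=
  hf.mono' (support_dbar_subset f)

theorem integrable_dbar (hf : ContDiff ℝ 1 f) (hc : HasCompactSupport f) : Integrable (dbar f) :=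
  (continuous_dbar hf).integrable_of_hasCompactSupport (hasCompactSupport_dbar hc)

theorem dbar_eq_zero_of_notMem_tsupport (h : z ∉ tsupport f) : dbar f z = 0 :=
  Function.notMem_support.1 fun h' => h (support_dbar_subset f h')

theorem two_mul_conj_circleMap_mul_dbar (f : ℂ → ℂ) (z : ℂ) (θ : ℝ) :
    2 * (starRingEnd ℂ) (circleMap 0 1 θ) * dbar f z =
      fderiv ℝ f z (circleMap 0 1 θ) +
        Complex.I * fderiv ℝ f z (circleMap 0 1 θ * Complex.I) := by
  have decomp : ∀ v : ℂ, fderiv ℝ f z v = v.re * fderiv ℝ f z 1 + v.im * fderiv ℝ f z Complex.I :=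
    fun v => by
      conv_lhs => rw [← Complex.re_add_im v, ← mul_one (v.re : ℂ)]
      simp only [← Complex.real_smul, map_add, map_smul]
  generalize circleMap 0 1 θ = u
  rw [decomp u, decomp (u * Complex.I), dbar, Complex.mul_I_re, Complex.mul_I_im,
    show (starRingEnd ℂ) u = u.re - u.im * Complex.I from Complex.ext (by simp) (by simp)]
  push_cast
  linear_combination (-(u.im : ℂ) * fderiv ℝ f z Complex.I) * Complex.I_sq

end WirtingerDerivative

section Green

variable {f : ℂ → ℂ} {a b : ℝ}

theorem circleMap_zero_eq_mul (s θ : ℝ) : circleMap 0 s θ = s * circleMap 0 1 θ := by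
  simp [circleMap]

theorem continuousOn_fderiv_circleMap {S : Set ℝ}
    (hf : ∀ s ∈ S, ∀ θ, ContDiffAt ℝ 1 f (circleMap 0 s θ)) :
    ContinuousOn (fun p : ℝ × ℝ => fderiv ℝ f (circleMap 0 p.1 p.2)) (S ×ˢ univ) := fun p hp =>
  (((hf p.1 hp.1 p.2).fderiv_right (m := 0) (by simp)).continuousAt.comp
    (f := fun p : ℝ × ℝ => circleMap 0 p.1 p.2) (by fun_prop)).continuousWithinAt

theorem intervalIntegrable_fderiv_circleMap {s : ℝ}
    (hf : ∀ θ, ContDiffAt ℝ 1 f (circleMap 0 s θ)) {v : ℝ → ℂ} (hv : Continuous v) :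
    IntervalIntegrable (fun θ => fderiv ℝ f (circleMap 0 s θ) (v θ)) volume a b := by
  have hfd : Continuous fun θ => fderiv ℝ f (circleMap 0 s θ) := by
    rw [← continuousOn_univ]
    exact (continuousOn_fderiv_circleMap (S := {s}) fun _ hs => hs ▸ hf).comp
      (f := fun θ : ℝ => (s, θ)) (by fun_prop) fun θ _ => ⟨rfl, trivial⟩
  exact (hfd.clm_apply hv).intervalIntegrable a b

theorem integral_fderiv_circleMap_angular {s : ℝ} (hs : s ≠ 0)
    (hf : ∀ θ, ContDiffAt ℝ 1 f (circleMap 0 s θ)) :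
    ∫ θ in (0 : ℝ)..2 * π, fderiv ℝ f (circleMap 0 s θ) (circleMap 0 1 θ * Complex.I) = 0 := by
  have hderiv : ∀ θ : ℝ, HasDerivAt (fun θ => f (circleMap 0 s θ))
      (s * fderiv ℝ f (circleMap 0 s θ) (circleMap 0 1 θ * Complex.I)) θ := fun θ => by
    rw [← Complex.real_smul, ← map_smul, Complex.real_smul, ← mul_assoc, ← circleMap_zero_eq_mul]
    exact ((hf θ).differentiableAt (by simp)).hasFDerivAt.comp_hasDerivAt θ
      (hasDerivAt_circleMap 0 s θ)
  have hftc := intervalIntegral.integral_eq_sub_of_hasDerivAt (a := 0) (b := 2 * π)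
    (fun θ _ => hderiv θ) ((intervalIntegrable_fderiv_circleMap hf (by fun_prop)).const_mul _)
  rw [intervalIntegral.integral_const_mul, (periodic_circleMap 0 s).eq, sub_self] at hftc
  exact (mul_eq_zero.1 hftc).resolve_left (mod_cast hs)

theorem integral_fderiv_circleMap_radial
    (hf : ∀ s ∈ uIcc a b, ∀ θ, ContDiffAt ℝ 1 f (circleMap 0 s θ)) (θ : ℝ) :
    ∫ s in a..b, fderiv ℝ f (circleMap 0 s θ) (circleMap 0 1 θ) =
      f (circleMap 0 b θ) - f (circleMap 0 a θ) := by
  refine intervalIntegral.integral_eq_sub_of_hasDerivAt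
    (f := fun s => f (circleMap 0 s θ)) (fun s hs => ?_) ?_
  · have hcircle : HasDerivAt (fun s => circleMap 0 s θ) (circleMap 0 1 θ) s := by
      simpa only [circleMap_zero, Complex.ofRealCLM_apply, Complex.ofReal_one] using
        (Complex.ofRealCLM.hasDerivAt (x := s)).mul_const (Complex.exp (θ * Complex.I))
    exact ((hf s hs θ).differentiableAt (by simp)).hasFDerivAt.comp_hasDerivAt s hcircle
  · exact (((continuousOn_fderiv_circleMap hf).comp (f := fun s : ℝ => (s, θ)) (by fun_prop)
      fun s hs => ⟨hs, trivial⟩).clm_apply continuousOn_const).intervalIntegrable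

theorem circleAverage_two_mul_div_mul_dbar {s : ℝ} (hs : s ≠ 0)
    (hf : ∀ θ, ContDiffAt ℝ 1 f (circleMap 0 s θ)) :
    Real.circleAverage (fun ζ => 2 * s / ζ * dbar f ζ) 0 s =
      (2 * π)⁻¹ • ∫ θ in (0 : ℝ)..2 * π, fderiv ℝ f (circleMap 0 s θ) (circleMap 0 1 θ) := by
  have hpolar : ∀ θ : ℝ, 2 * s / circleMap 0 s θ * dbar f (circleMap 0 s θ) =
      fderiv ℝ f (circleMap 0 s θ) (circleMap 0 1 θ) +
        Complex.I * fderiv ℝ f (circleMap 0 s θ) (circleMap 0 1 θ * Complex.I) := fun θ => by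
    have hconj : (starRingEnd ℂ) (circleMap 0 1 θ) = (circleMap 0 1 θ)⁻¹ := by
      rw [Complex.inv_def, Complex.normSq_eq_norm_sq]
      simp
    rw [← two_mul_conj_circleMap_mul_dbar, hconj, circleMap_zero_eq_mul s]
    have : (s : ℂ) ≠ 0 := mod_cast hs
    field_simp
  simp only [Real.circleAverage_def, hpolar]
  rw [intervalIntegral.integral_add (intervalIntegrable_fderiv_circleMap hf (by fun_prop))
    ((intervalIntegrable_fderiv_circleMap hf (by fun_prop)).const_mul _),
    intervalIntegral.integral_const_mul, integral_fderiv_circleMap_angular hs hf, mul_zero,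
    add_zero]

theorem circleAverage_sub_circleAverage
    (hf : ∀ s ∈ uIcc a b, ∀ θ, ContDiffAt ℝ 1 f (circleMap 0 s θ)) :
    Real.circleAverage f 0 b - Real.circleAverage f 0 a =
      ∫ s in a..b, Real.circleAverage (fun ζ => 2 * s / ζ * dbar f ζ) 0 s := by
  have hcircle : ∀ s ∈ uIcc a b,
      IntervalIntegrable (fun θ => f (circleMap 0 s θ)) volume 0 (2 * π) := fun s hs =>
    (continuous_iff_continuousAt.2 fun θ => (hf s hs θ).continuousAt.comp
      (continuous_circleMap 0 s).continuousAt).intervalIntegrable _ _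
  have hradial : IntegrableOn
      (Function.uncurry fun s θ : ℝ => fderiv ℝ f (circleMap 0 s θ) (circleMap 0 1 θ))
      (uIoc a b ×ˢ uIoc 0 (2 * π)) := by
    refine IntegrableOn.mono_set ?_ (prod_mono uIoc_subset_uIcc uIoc_subset_uIcc)
    exact (((continuousOn_fderiv_circleMap hf).mono (prod_mono_right (subset_univ _))).clm_apply
      (by fun_prop)).integrableOn_compact (isCompact_uIcc.prod isCompact_uIcc)
  calc Real.circleAverage f 0 b - Real.circleAverage f 0 a
      = (2 * π)⁻¹ • ∫ θ in (0 : ℝ)..2 * π, ∫ s in a..b,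
          fderiv ℝ f (circleMap 0 s θ) (circleMap 0 1 θ) := by
        simp only [integral_fderiv_circleMap_radial hf, Real.circleAverage_def]
        rw [← smul_sub, intervalIntegral.integral_sub (hcircle b right_mem_uIcc)
          (hcircle a left_mem_uIcc)]
    _ = ∫ s in a..b, (2 * π)⁻¹ • ∫ θ in (0 : ℝ)..2 * π,
          fderiv ℝ f (circleMap 0 s θ) (circleMap 0 1 θ) := by
        rw [← intervalIntegral_intervalIntegral_swap hradial, intervalIntegral.integral_smul]
    _ = ∫ s in a..b, Real.circleAverage (fun ζ => 2 * s / ζ * dbar f ζ) 0 s := by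
        refine intervalIntegral.integral_congr_ae ?_
        filter_upwards [Measure.ae_ne volume 0] with s hs hsab
        exact (circleAverage_two_mul_div_mul_dbar hs (hf s (uIoc_subset_uIcc hsab))).symm

theorem exists_forall_lt_norm_notMem_tsupport (hc : HasCompactSupport f) :
    ∃ R, 0 ≤ R ∧ ∀ ζ, R < ‖ζ‖ → ζ ∉ tsupport f := by
  obtain ⟨R, hR0, hR⟩ := hc.isBounded.subset_closedBall_lt 0 0
  exact ⟨R, hR0.le, fun ζ hζ h => hζ.not_ge (mem_closedBall_zero_iff.1 (hR h))⟩

theorem integral_Ioi_circleAverage_dbar (ha : 0 ≤ a)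
    (hf : ∀ s, a ≤ s → ∀ θ, ContDiffAt ℝ 1 f (circleMap 0 s θ)) (hc : HasCompactSupport f) :
    ∫ s in Ioi a, Real.circleAverage (fun ζ => 2 * s / ζ * dbar f ζ) 0 s =
      -Real.circleAverage f 0 a := by
  obtain ⟨R, -, hR⟩ := exists_forall_lt_norm_notMem_tsupport hc
  set b := max a R + 1
  have hab : a ≤ b := by linarith [le_max_left a R]
  have houtside : ∀ s, b ≤ s → ∀ θ, circleMap 0 s θ ∉ tsupport f := fun s hs θ => by
    refine hR _ ?_
    rw [norm_circleMap_zero, abs_of_nonneg (by linarith)]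
    linarith [le_max_right a R]
  have hb : Real.circleAverage f 0 b = 0 := by
    simp [Real.circleAverage_def, image_eq_zero_of_notMem_tsupport (houtside b le_rfl _)]
  have hvanish : ∀ s ∈ Ioi a \ Ioc a b,
      Real.circleAverage (fun ζ => 2 * s / ζ * dbar f ζ) 0 s = 0 := fun s hs => by
    have hbs : b ≤ s := (not_le.1 fun h => hs.2 ⟨hs.1, h⟩).le
    simp [Real.circleAverage_def, dbar_eq_zero_of_notMem_tsupport (houtside s hbs _)]
  have hgreen := circleAverage_sub_circleAverage (f := f) (a := a) (b := b) fun s hs =>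
    hf s (uIcc_of_le hab ▸ hs).1
  rw [hb, zero_sub, intervalIntegral.integral_of_le hab] at hgreen
  rw [hgreen]
  exact setIntegral_eq_of_subset_of_forall_sdiff_eq_zero measurableSet_Ioi Ioc_subset_Ioi_self
    hvanish

end Green

section PolarCoordinates

variable {E : Type*} [NormedAddCommGroup E] [NormedSpace ℝ E] {F : ℂ → E}

theorem polarCoord_symm_eq_circleMap (p : ℝ × ℝ) :
    Complex.polarCoord.symm p = circleMap 0 p.1 p.2 := by
  rw [Complex.polarCoord_symm_apply, circleMap_zero, Complex.exp_mul_I, Complex.ofReal_cos,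
    Complex.ofReal_sin]

theorem circleAverage_eq_integral_Ioo (F : ℂ → E) (s : ℝ) :
    Real.circleAverage F 0 s = (2 * π)⁻¹ • ∫ θ in Ioo (-π) π, F (circleMap 0 s θ) := by
  rw [Real.circleAverage_eq_integral_add (-π), intervalIntegral.integral_comp_add_right
    (fun θ => F (circleMap 0 s θ)), ← integral_Ioc_eq_integral_Ioo,
    ← intervalIntegral.integral_of_le (by linarith [Real.pi_pos])]
  congr 3 <;> ring

theorem integrable_smul_comp_circleMap (hF : Integrable F) :
    Integrable (fun p : ℝ × ℝ => p.1 • F (circleMap 0 p.1 p.2))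
      ((volume.restrict (Ioi 0)).prod (volume.restrict (Ioo (-π) π))) := by
  have hreal : IntegrableOn (F ∘ Complex.measurableEquivRealProd.symm) polarCoord.source :=
    (Complex.volume_preserving_equiv_real_prod.symm.integrable_comp_emb
      Complex.measurableEquivRealProd.symm.measurableEmbedding).2 hF |>.integrableOn
  rw [← polarCoord.symm_image_target_eq_source,
    integrableOn_image_iff_integrableOn_abs_det_fderiv_smul volume
      polarCoord.open_target.measurableSet
      (fun p _ => (hasFDerivAt_polarCoord_symm p).hasFDerivWithinAt) polarCoord.symm.injOn] at hreal
  rw [Measure.prod_restrict, ← Measure.volume_eq_prod]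
  refine hreal.congr_fun (fun p hp => ?_) polarCoord.open_target.measurableSet
  simp only [Function.comp_apply]
  rw [det_fderivPolarCoordSymm, abs_of_pos hp.1,
    Complex.measurableEquivRealProd_symm_polarCoord_symm_apply, polarCoord_symm_eq_circleMap]

theorem integrableOn_smul_circleAverage (hF : Integrable F) :
    IntegrableOn (fun s => s • Real.circleAverage F 0 s) (Ioi 0) := by
  refine ((integrable_smul_comp_circleMap hF).integral_prod_left.smul (2 * π)⁻¹).congr
    (ae_of_all _ fun s => ?_)
  simp only [Pi.smul_apply]
  rw [circleAverage_eq_integral_Ioo, integral_smul, smul_comm]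

theorem integral_eq_integral_circleAverage (hF : Integrable F) :
    ∫ z, F z = (2 * π) • ∫ s in Ioi 0, s • Real.circleAverage F 0 s := by
  rw [← Complex.integral_comp_polarCoord_symm, polarCoord_target, Measure.volume_eq_prod,
    ← Measure.prod_restrict]
  simp only [polarCoord_symm_eq_circleMap]
  rw [integral_prod _ (integrable_smul_comp_circleMap hF), ← integral_smul]
  refine integral_congr_ae (ae_of_all _ fun s => ?_)
  simp only [circleAverage_eq_integral_Ioo, integral_smul]
  rw [smul_comm s, smul_inv_smul₀ Real.two_pi_pos.ne']

theorem measurableSet_le_norm (r : ℝ) : MeasurableSet {z : ℂ | r ≤ ‖z‖} :=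
  measurableSet_le measurable_const measurable_norm

theorem setIntegral_le_norm_eq (hF : Integrable F) {r : ℝ} (hr : 0 ≤ r) :
    ∫ z in {z : ℂ | r ≤ ‖z‖}, F z = (2 * π) • ∫ s in Ioi r, s • Real.circleAverage F 0 s := by
  have havg : ∀ s ∈ Ioi (0 : ℝ), s • Real.circleAverage ({z : ℂ | r ≤ ‖z‖}.indicator F) 0 s =
      (Ici r).indicator (fun s => s • Real.circleAverage F 0 s) s := fun s hs => by
    have hnorm : ∀ θ, ‖circleMap 0 s θ‖ = s := fun θ => by
      rw [norm_circleMap_zero, abs_of_pos hs]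
    by_cases hrs : r ≤ s
    · simp [Real.circleAverage_def, indicator, hrs, hnorm]
    · simp [Real.circleAverage_def, indicator, hrs, hnorm]
  rw [← integral_indicator (measurableSet_le_norm r), integral_eq_integral_circleAverage
    (hF.indicator (measurableSet_le_norm r)), setIntegral_congr_fun measurableSet_Ioi havg,
    setIntegral_congr_set Ioi_ae_eq_Ici, setIntegral_indicator measurableSet_Ici,
    inter_eq_right.2 (Ici_subset_Ici.2 hr), integral_Ici_eq_integral_Ioi]

end PolarCoordinates

section CauchyPompeiu

variable {h ψ : ℂ → ℂ}

theorem locallyIntegrable_inv : LocallyIntegrable fun z : ℂ => z⁻¹ :=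
  locallyIntegrable_of_norm_le_rpow (C := 1) (α := 1) (by simp) (by simp)
    (ae_of_all _ fun z => by simp [Real.rpow_neg_one]) measurable_inv.aestronglyMeasurable

theorem integrable_div_sub (hh : Continuous h) (hc : HasCompactSupport h) (w : ℂ) :
    Integrable fun z => h z / (w - z) :=
  hc.convolutionExists_left (ContinuousLinearMap.mul ℝ ℂ) hh locallyIntegrable_inv w

theorem continuous_integral_norm_div_sub (hh : Continuous h) (hc : HasCompactSupport h) :
    Continuous fun w => ∫ z, ‖h z / (w - z)‖ := by
  have := hc.norm.continuous_convolution_left (ContinuousLinearMap.mul ℝ ℝ) hh.norm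
    (locallyIntegrableOn_univ.1 (locallyIntegrable_inv.locallyIntegrableOn univ).norm)
  simp only [div_eq_mul_inv, norm_mul]
  exact this

theorem cauchy_pompeiu_zero (hψ : ContDiff ℝ 1 ψ) (hc : HasCompactSupport ψ) :
    ∫ w, dbar ψ w / (0 - w) = π * ψ 0 := by
  have hgreen := integral_Ioi_circleAverage_dbar (f := ψ) le_rfl (fun _ _ _ => hψ.contDiffAt) hc
  have havg : ∀ s ∈ Ioi (0 : ℝ), s • Real.circleAverage (fun w => dbar ψ w / (0 - w)) 0 s =
      (-(1 / 2) : ℝ) • Real.circleAverage (fun ζ => 2 * s / ζ * dbar ψ ζ) 0 s := fun s _ => by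
    rw [← Real.circleAverage_fun_smul, ← Real.circleAverage_fun_smul]
    congr 1 with w
    simp only [Complex.real_smul, zero_sub, div_neg]
    push_cast
    ring
  rw [integral_eq_integral_circleAverage (integrable_div_sub (continuous_dbar hψ)
    (hasCompactSupport_dbar hc) 0), setIntegral_congr_fun measurableSet_Ioi havg, integral_smul,
    hgreen, Real.circleAverage_zero]
  simp only [Complex.real_smul]
  push_cast
  ring

theorem cauchy_pompeiu (hψ : ContDiff ℝ 1 ψ) (hc : HasCompactSupport ψ) (z : ℂ) :
    ∫ w, dbar ψ w / (z - w) = π * ψ z := by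
  have htranslate := cauchy_pompeiu_zero (hψ.comp (contDiff_id.add (contDiff_const (c := z))))
    (hc.comp_homeomorph (Homeomorph.addRight z))
  simp only [Function.comp_def, id, dbar_comp_add, zero_add] at htranslate
  rw [← htranslate, ← integral_add_right_eq_self _ z]
  simp only [sub_add_cancel_right, zero_sub]

theorem setIntegral_le_norm_dbar (hψ : ContDiff ℝ 1 ψ) (hc : HasCompactSupport ψ) {r : ℝ}
    (hr : 0 ≤ r) : ∫ z in {z : ℂ | r ≤ ‖z‖}, dbar ψ z =
      -π * Real.circleAverage (fun ζ => ζ * ψ ζ) 0 r := by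
  have hgreen := integral_Ioi_circleAverage_dbar (f := fun w => id w * ψ w) hr
    (fun _ _ _ => (contDiff_id.mul hψ).contDiffAt) (hc.mul_left (f := id))
  have havg : ∀ s ∈ Ioi r, s • Real.circleAverage (dbar ψ) 0 s = (1 / 2 : ℝ) •
      Real.circleAverage (fun ζ => 2 * s / ζ * dbar (fun w => id w * ψ w) ζ) 0 s := fun s hs => by
    rw [← Real.circleAverage_fun_smul, ← Real.circleAverage_fun_smul]
    refine Real.circleAverage_congr_sphere fun w hw => ?_
    have hw0 : w ≠ 0 := Metric.ne_of_mem_sphere hw (abs_pos.2 (hr.trans_lt hs).ne').ne'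
    rw [dbar_mul_of_differentiableAt differentiableAt_id (hψ.differentiable (by simp) w)]
    simp only [Complex.real_smul, id]
    push_cast
    field_simp
  rw [setIntegral_le_norm_eq (integrable_dbar hψ hc) hr,
    setIntegral_congr_fun measurableSet_Ioi havg, integral_smul, hgreen]
  simp only [Complex.real_smul, id]
  push_cast
  ring

theorem integrable_circle_mul_dbar_div (hh : Continuous h) (r : ℝ) (hψ : ContDiff ℝ 1 ψ)
    (hc : HasCompactSupport ψ) :
    Integrable (fun p : ℂ × ℝ => h (circleMap 0 r p.2) * (dbar ψ p.1 / (circleMap 0 r p.2 - p.1)))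
      (volume.prod (volume.restrict (uIoc 0 (2 * π)))) := by
  have hdbar := continuous_dbar hψ
  have hcirc := continuous_circleMap 0 r
  have hmeas : Measurable fun p : ℂ × ℝ =>
      h (circleMap 0 r p.2) * (dbar ψ p.1 / (circleMap 0 r p.2 - p.1)) := by
    have := hh.measurable
    have := hdbar.measurable
    have := hcirc.measurable
    fun_prop
  refine (integrable_prod_iff' hmeas.aestronglyMeasurable).2 ⟨ae_of_all _ fun θ =>
    (integrable_div_sub hdbar (hasCompactSupport_dbar hc) (circleMap 0 r θ)).const_mul
      (h (circleMap 0 r θ)), ?_⟩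
  simp only [norm_mul, integral_const_mul]
  exact ((hh.comp hcirc).norm.mul ((continuous_integral_norm_div_sub hdbar
    (hasCompactSupport_dbar hc)).comp hcirc)).integrableOn_uIoc

theorem circleAverage_div_sub_mul (h : ℂ → ℂ) (r : ℝ) (z c : ℂ) :
    Real.circleAverage (fun ζ => h ζ / (ζ - z)) 0 r * c = (2 * π)⁻¹ •
      ∫ θ in uIoc 0 (2 * π), h (circleMap 0 r θ) * (c / (circleMap 0 r θ - z)) := by
  rw [Real.circleAverage_def, smul_mul_assoc, ← intervalIntegral.integral_mul_const,
    intervalIntegral.integral_of_le Real.two_pi_pos.le, uIoc_of_le Real.two_pi_pos.le]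
  simp only [div_mul_eq_mul_div, mul_div_assoc]

theorem integrable_circleAverage_div_sub_mul_dbar (hh : Continuous h) (r : ℝ)
    (hψ : ContDiff ℝ 1 ψ) (hc : HasCompactSupport ψ) :
    Integrable fun z => Real.circleAverage (fun ζ => h ζ / (ζ - z)) 0 r * dbar ψ z := by
  simp only [circleAverage_div_sub_mul]
  exact (integrable_circle_mul_dbar_div hh r hψ hc).integral_prod_left.smul (2 * π)⁻¹

theorem integral_circleAverage_div_sub_mul_dbar (hh : Continuous h) (r : ℝ)
    (hψ : ContDiff ℝ 1 ψ) (hc : HasCompactSupport ψ) :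
    ∫ z, Real.circleAverage (fun ζ => h ζ / (ζ - z)) 0 r * dbar ψ z =
      π * Real.circleAverage (fun ζ => h ζ * ψ ζ) 0 r := by
  simp only [circleAverage_div_sub_mul]
  rw [integral_smul, integral_integral_swap (integrable_circle_mul_dbar_div hh r hψ hc)]
  simp only [integral_const_mul, cauchy_pompeiu hψ hc]
  rw [Real.circleAverage_def, intervalIntegral.integral_of_le Real.two_pi_pos.le,
    uIoc_of_le Real.two_pi_pos.le, mul_smul_comm, ← integral_const_mul]
  simp only [mul_left_comm]

end CauchyPompeiu

/-- The integral of `e` against the one-coordinate kernel over all angles: the frozen value `e z`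
outside the circle of radius `r`, plus the Cauchy integral of `e` over this circle. -/
def chainMean (e : ℂ → ℂ) (z : ℂ) (r : ℝ) : ℂ :=
  ∫ θ, cauchyWeight r z θ * e (chainCoord r z θ) ∂angleMeasure

/-- The contribution of the radius `r` to the Cauchy transform of `-e` in polar coordinates. -/
def radialChainMean (e : ℂ → ℂ) (z : ℂ) (r : ℝ) : ℂ :=
  ∫ θ, cauchyWeight r z θ * (radialFactor θ * e (chainCoord r z θ)) ∂angleMeasure

section ChainMean

variable {e ψ : ℂ → ℂ} {z ζ : ℂ} {r : ℝ}

theorem integral_cauchyWeight_mul {k : ℂ → ℂ} {G : ℝ → ℂ} (hk : Continuous k)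
    (hG : ∀ θ ≠ 0, circleMap 0 r θ * G θ = k (circleMap 0 r θ)) (hr : 0 ≤ r) (hz : r ≠ ‖z‖) :
    ∫ θ, cauchyWeight r z θ * G θ ∂angleMeasure = (if r ≤ ‖z‖ then G 0 else 0) +
      Real.circleAverage (fun ζ => k ζ / (ζ - z)) 0 r := by
  have hcont : Continuous fun θ => k (circleMap 0 r θ) / (circleMap 0 r θ - z) :=
    (hk.comp (continuous_circleMap 0 r)).div (by fun_prop) fun θ =>
      sub_ne_zero.2 (circleMap_ne_of_ne_norm hr hz θ)
  have heq : EqOn (fun θ => ((2 * π)⁻¹ : ℝ) • (k (circleMap 0 r θ) / (circleMap 0 r θ - z)))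
      (fun θ => cauchyWeight r z θ * G θ) (uIoc 0 (2 * π)) := fun θ hθ => by
    have hθ0 : θ ≠ 0 := ((uIoc_of_le Real.two_pi_pos.le ▸ hθ : θ ∈ Ioc 0 (2 * π)).1).ne'
    simp only [cauchyWeight, if_neg hθ0, ← hG θ hθ0, Complex.real_smul]
    push_cast
    field_simp
  rw [integral_angleMeasure (((hcont.fun_const_smul _).intervalIntegrable _ _).congr heq),
    ← intervalIntegral.integral_congr_ae (ae_of_all _ heq), intervalIntegral.integral_smul,
    Real.circleAverage_def]
  simp [cauchyWeight]

theorem chainMean_eq_add_circleAverage (he : Continuous e) (hr : 0 ≤ r) (hz : r ≠ ‖z‖) :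
    chainMean e z r =
      (if r ≤ ‖z‖ then e z else 0) + Real.circleAverage (fun ζ => ζ * e ζ / (ζ - z)) 0 r := by
  rw [chainMean, integral_cauchyWeight_mul (k := fun ζ => ζ * e ζ) (by fun_prop)
    (fun θ hθ => by simp only [chainCoord, if_neg hθ]) hr hz]
  simp only [chainCoord, if_pos]

theorem radialChainMean_eq_circleAverage (he : Continuous e) (hr : 0 ≤ r) (hz : r ≠ ‖z‖) :
    radialChainMean e z r = Real.circleAverage (fun ζ => 2 * r * e ζ / (ζ - z)) 0 r := by
  have hconj : ∀ θ, circleMap 0 r θ * (2 * (starRingEnd ℂ) (circleMap 0 1 θ)) = 2 * r := fun θ => by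
    have hunit := Complex.mul_conj (circleMap 0 1 θ)
    rw [Complex.normSq_eq_norm_sq, norm_circleMap_zero] at hunit
    rw [circleMap_zero_eq_mul, mul_left_comm, mul_assoc, hunit]
    simp
  rw [radialChainMean, integral_cauchyWeight_mul (k := fun ζ => 2 * r * e ζ) (by fun_prop)
    (fun θ hθ => by simp only [chainCoord, radialFactor, if_neg hθ, ← mul_assoc _ _ (e _), hconj])
    hr hz]
  simp [radialFactor]

theorem ae_ne_norm_complex (r : ℝ) : ∀ᵐ z : ℂ, r ≠ ‖z‖ := by
  filter_upwards [measure_eq_zero_iff_ae_notMem.1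
    (Measure.addHaar_sphere volume (0 : ℂ) r)] with z hz hrz
  exact hz (by simp [hrz])

theorem integral_radialChainMean_mul_dbar (he : Continuous e) (hr : 0 ≤ r) (hψ : ContDiff ℝ 1 ψ)
    (hc : HasCompactSupport ψ) : ∫ z, radialChainMean e z r * dbar ψ z =
      2 * π * r * Real.circleAverage (fun ζ => e ζ * ψ ζ) 0 r := by
  have hcongr : ∀ᵐ z : ℂ, radialChainMean e z r * dbar ψ z =
      Real.circleAverage (fun ζ => 2 * r * e ζ / (ζ - z)) 0 r * dbar ψ z := by
    filter_upwards [ae_ne_norm_complex r] with z hz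
    rw [radialChainMean_eq_circleAverage he hr hz]
  rw [integral_congr_ae hcongr, integral_circleAverage_div_sub_mul_dbar (by fun_prop) r hψ hc]
  have hsmul := Real.circleAverage_fun_smul (a := 2 * (r : ℂ)) (f := fun ζ => e ζ * ψ ζ) (c := 0)
    (R := r)
  simp only [smul_eq_mul, ← mul_assoc] at hsmul
  rw [hsmul]
  ring

theorem integral_chainMean_mul_dbar (he : ContDiff ℝ 1 e) (hr : 0 ≤ r) (hψ : ContDiff ℝ 1 ψ)
    (hc : HasCompactSupport ψ) :
    ∫ z, chainMean e z r * dbar ψ z = -∫ z in {z : ℂ | r ≤ ‖z‖}, dbar e z * ψ z := by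
  have hset := measurableSet_le_norm r
  have hint₁ : Integrable (fun z => e z * dbar ψ z) :=
    (he.continuous.mul (continuous_dbar hψ)).integrable_of_hasCompactSupport
      (hasCompactSupport_dbar hc).mul_left
  have hint₂ : Integrable (fun z => dbar e z * ψ z) :=
    ((continuous_dbar he).mul hψ.continuous).integrable_of_hasCompactSupport hc.mul_left
  have hgreen := setIntegral_le_norm_dbar (he.mul hψ) hc.mul_left hr
  simp only [dbar_mul (he.differentiable (by simp) _) (hψ.differentiable (by simp) _)] at hgreen
  rw [integral_add hint₂.integrableOn hint₁.integrableOn] at hgreen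
  have hcont : Continuous fun ζ => ζ * e ζ := continuous_id.mul he.continuous
  have hcongr : ∀ᵐ z : ℂ, chainMean e z r * dbar ψ z =
      {z : ℂ | r ≤ ‖z‖}.indicator (fun z => e z * dbar ψ z) z +
        Real.circleAverage (fun ζ => ζ * e ζ / (ζ - z)) 0 r * dbar ψ z := by
    filter_upwards [ae_ne_norm_complex r] with z hz
    rw [chainMean_eq_add_circleAverage he.continuous hr hz, add_mul, ite_mul, zero_mul]
    rfl
  rw [integral_congr_ae hcongr, integral_add (hint₁.indicator hset)
    (integrable_circleAverage_div_sub_mul_dbar hcont r hψ hc), integral_indicator hset,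
    integral_circleAverage_div_sub_mul_dbar hcont r hψ hc]
  simp only [mul_assoc]
  linear_combination hgreen

theorem radialChainMean_eq_smul_circleAverage (he : Continuous e) (hr : 0 ≤ r) (hz : r ≠ ‖z‖) :
    radialChainMean e z r = (-2 : ℝ) • r • Real.circleAverage (fun ζ => e ζ / (z - ζ)) 0 r := by
  rw [radialChainMean_eq_circleAverage he hr hz, ← Real.circleAverage_fun_smul,
    ← Real.circleAverage_fun_smul]
  congr 1 with ζ
  rw [← neg_sub ζ z, div_neg]
  simp only [Complex.real_smul]
  push_cast
  ring

theorem ae_radialChainMean_eq (he : Continuous e) (z : ℂ) :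
    ∀ᵐ s ∂volume.restrict (Ioi 0), (-2 : ℝ) • s •
      Real.circleAverage (fun ζ => e ζ / (z - ζ)) 0 s = radialChainMean e z s := by
  filter_upwards [ae_restrict_mem measurableSet_Ioi,
    ae_restrict_of_ae (Measure.ae_ne volume ‖z‖)] with s hs hsz
  exact (radialChainMean_eq_smul_circleAverage he (le_of_lt hs) hsz).symm

theorem integrableOn_radialChainMean (he : Continuous e) (hc : HasCompactSupport e) (z : ℂ) :
    IntegrableOn (radialChainMean e z) (Ioi 0) :=
  ((integrableOn_smul_circleAverage (integrable_div_sub he hc z)).smul (-2 : ℝ)).congr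
    (ae_radialChainMean_eq he z)

theorem integral_radialChainMean (he : Continuous e) (hc : HasCompactSupport e) (z : ℂ) :
    ∫ s in Ioi 0, radialChainMean e z s = -(π : ℂ)⁻¹ * ∫ ζ, e ζ / (z - ζ) := by
  rw [← integral_congr_ae (ae_radialChainMean_eq he z), integral_smul,
    integral_eq_integral_circleAverage (integrable_div_sub he hc z)]
  simp only [Complex.real_smul]
  push_cast
  field_simp

theorem contDiffAt_div_sub_mul (he : ContDiff ℝ 1 e) (h : ζ ≠ z) :
    ContDiffAt ℝ 1 (fun ζ => ζ / (ζ - z) * e ζ) ζ := by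
  have hkernel : ContDiffAt ℂ 1 (fun ζ => ζ / (ζ - z)) ζ :=
    contDiffAt_id.div (contDiffAt_id.sub contDiffAt_const) (sub_ne_zero.2 h)
  exact (hkernel.restrict_scalars ℝ).mul he.contDiffAt

theorem dbar_div_sub_mul (he : ContDiff ℝ 1 e) (h : ζ ≠ z) :
    dbar (fun ζ => ζ / (ζ - z) * e ζ) ζ = ζ / (ζ - z) * dbar e ζ :=
  dbar_mul_of_differentiableAt (differentiableAt_id.div
    (differentiableAt_id.sub (differentiableAt_const _)) (sub_ne_zero.2 h))
    (he.differentiable (by simp) ζ)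

theorem radialChainMean_dbar (he : ContDiff ℝ 1 e) (hr : 0 < r) (hz : r ≠ ‖z‖) :
    radialChainMean (dbar e) z r = Real.circleAverage
      (fun ζ => 2 * r / ζ * dbar (fun ζ => ζ / (ζ - z) * e ζ) ζ) 0 r := by
  rw [radialChainMean_eq_circleAverage (continuous_dbar he) hr.le hz]
  refine Real.circleAverage_congr_sphere fun ζ hζ => ?_
  have hζr : ‖ζ‖ = r := by simpa [abs_of_pos hr] using hζ
  have hζ0 : ζ ≠ 0 := norm_pos_iff.1 (hζr ▸ hr)
  have hζz : ζ ≠ z := fun h => hz (h ▸ hζr.symm)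
  rw [dbar_div_sub_mul he hζz]
  field_simp

/-- Inside the circle of radius `ρ` this is Green's formula; outside, it is Green's formula on the
complement of the disc combined with the Cauchy–Pompeiu formula. -/
theorem chainMean_eq_add_integral (he : ContDiff ℝ 1 e) (hc : HasCompactSupport e) {ρ : ℝ}
    (hρ : 0 < ρ) (hρz : ρ ≠ ‖z‖) :
    chainMean e z ρ = e z + ∫ s in (0 : ℝ)..ρ, radialChainMean (dbar e) z s := by
  have hsmooth : ∀ s, 0 ≤ s → s ≠ ‖z‖ → ∀ θ,
      ContDiffAt ℝ 1 (fun ζ => ζ / (ζ - z) * e ζ) (circleMap 0 s θ) := fun s hs hsz θ =>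
    contDiffAt_div_sub_mul he (circleMap_ne_of_ne_norm hs hsz θ)
  rw [chainMean_eq_add_circleAverage he.continuous hρ.le hρz]
  simp only [← div_mul_eq_mul_div]
  rcases lt_or_gt_of_ne hρz with h | h
  · have hinterior : ∫ s in (0 : ℝ)..ρ, radialChainMean (dbar e) z s =
        Real.circleAverage (fun ζ => ζ / (ζ - z) * e ζ) 0 ρ := by
      have hgreen := circleAverage_sub_circleAverage fun s (hs : s ∈ uIcc 0 ρ) =>
        have hs' := uIcc_of_le hρ.le ▸ hs
        hsmooth s hs'.1 (hs'.2.trans_lt h).ne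
      rw [Real.circleAverage_zero, zero_div, zero_mul, sub_zero] at hgreen
      rw [hgreen, intervalIntegral.integral_of_le hρ.le, intervalIntegral.integral_of_le hρ.le]
      exact setIntegral_congr_fun measurableSet_Ioc fun s hs =>
        radialChainMean_dbar he hs.1 (hs.2.trans_lt h).ne
    rw [if_pos h.le, hinterior]
  · have hint := integrableOn_radialChainMean (continuous_dbar he) (hasCompactSupport_dbar hc) z
    have hexterior : ∫ s in Ioi ρ, radialChainMean (dbar e) z s =
        -Real.circleAverage (fun ζ => ζ / (ζ - z) * e ζ) 0 ρ := by
      rw [← integral_Ioi_circleAverage_dbar hρ.le (fun s hs =>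
        hsmooth s (hρ.le.trans hs) (h.trans_le hs).ne') hc.mul_left]
      exact setIntegral_congr_fun measurableSet_Ioi fun s hs =>
        radialChainMean_dbar he (hρ.trans hs) (h.trans hs).ne'
    have htotal : ∫ s in Ioi 0, radialChainMean (dbar e) z s = -e z := by
      rw [integral_radialChainMean (continuous_dbar he) (hasCompactSupport_dbar hc),
        cauchy_pompeiu he hc, neg_mul, inv_mul_cancel_left₀ (by simp [Real.pi_ne_zero])]
    rw [if_neg (not_le.2 h), ← intervalIntegral.integral_Ioi_sub_Ioi hint hρ.le, hexterior, htotal]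
    ring

end ChainMean

/-! ### Forms with product coefficients -/

section Primitives

variable {E : Type*} [NormedAddCommGroup E] [NormedSpace ℝ E] {a b : ℝ}

theorem absolutelyContinuousOnInterval_primitive {f : ℝ → E}
    (hf : IntervalIntegrable f volume a b) :
    AbsolutelyContinuousOnInterval (fun x => ∫ t in a..x, f t) a b := by
  have hint : ∀ x ∈ uIcc a b, IntervalIntegrable f volume a x := fun x hx =>
    hf.mono_set (uIcc_subset_uIcc_left hx)
  refine squeeze_zero' (.of_forall fun _ => Finset.sum_nonneg fun _ _ => dist_nonneg) ?_
    (hf.norm.absolutelyContinuousOnInterval_intervalIntegral (c := a) (by simp))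
  filter_upwards [Filter.mem_inf_of_right (Filter.mem_principal_self _)] with I hI
  refine Finset.sum_le_sum fun i hi => ?_
  obtain ⟨hx, hy⟩ := hI.1 i hi
  rw [dist_eq_norm, dist_eq_norm, intervalIntegral.integral_interval_sub_left (hint _ hx)
    (hint _ hy), intervalIntegral.integral_interval_sub_left (hint _ hx).norm (hint _ hy).norm]
  exact intervalIntegral.norm_integral_le_abs_integral_norm

theorem integral_eq_sub_of_absolutelyContinuousOnInterval [CompleteSpace E] {F f : ℝ → E}
    (hF : AbsolutelyContinuousOnInterval F a b)
    (hderiv : ∀ᵐ x, x ∈ uIcc a b → HasDerivAt F (f x) x) (hf : IntervalIntegrable f volume a b) :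
    ∫ x in a..b, f x = F b - F a := by
  have hconst : ∀ᵐ x, x ∈ uIcc a b → HasDerivAt (fun x => F x - ∫ t in a..x, f t) 0 x := by
    filter_upwards [hderiv, hf.ae_hasDerivAt_integral] with x hFx hfx hx
    simpa using (hFx hx).fun_sub (hfx hx a (by simp))
  obtain ⟨c, hc⟩ := AbsolutelyContinuousOnInterval.const_of_ae_hasDerivAt_zero
    (hF.fun_sub (absolutelyContinuousOnInterval_primitive hf)) hconst
  have hab := (hc a (by simp)).trans (hc b (by simp)).symm
  rw [intervalIntegral.integral_same, sub_zero] at hab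
  rw [hab, sub_sub_cancel]

theorem absolutelyContinuousOnInterval_prod {κ : Type*} {F : κ → ℝ → ℂ} (s : Finset κ)
    (hF : ∀ j ∈ s, AbsolutelyContinuousOnInterval (F j) a b) :
    AbsolutelyContinuousOnInterval (fun x => ∏ j ∈ s, F j x) a b := by
  induction s using Finset.cons_induction with
  | empty => exact (contDiff_const.contDiffOn).absolutelyContinuousOnInterval
  | cons j s hj ih =>
    simp only [Finset.prod_cons]
    exact (hF j (by simp)).smul (ih fun i hi => hF i (by simp [hi]))

variable {κ : Type*} [DecidableEq κ] {f : κ → ℝ → ℂ} {s : Finset κ}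

theorem intervalIntegrable_sum_prod_erase_mul (c : κ → ℂ)
    (hf : ∀ j ∈ s, IntervalIntegrable (f j) volume a b) :
    IntervalIntegrable (fun x => ∑ k ∈ s, (∏ j ∈ s.erase k, (c j + ∫ t in a..x, f j t)) * f k x)
      volume a b := by
  simp only [← Finset.sum_fn]
  refine IntervalIntegrable.sum _ fun k hk => (hf k hk).continuousOn_mul ?_
  exact continuousOn_finsetProd _ fun j hj => continuousOn_const.add
    (absolutelyContinuousOnInterval_primitive (hf j (Finset.mem_of_mem_erase hj))).continuousOn

theorem prod_add_integral_eq (c : κ → ℂ) (hf : ∀ j ∈ s, IntervalIntegrable (f j) volume a b) :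
    ∏ j ∈ s, (c j + ∫ t in a..b, f j t) = ∏ j ∈ s, c j +
      ∫ x in a..b, ∑ k ∈ s, (∏ j ∈ s.erase k, (c j + ∫ t in a..x, f j t)) * f k x := by
  have hderiv : ∀ᵐ x, x ∈ uIcc a b → HasDerivAt (fun x => ∏ j ∈ s, (c j + ∫ t in a..x, f j t))
      (∑ k ∈ s, (∏ j ∈ s.erase k, (c j + ∫ t in a..x, f j t)) * f k x) x := by
    filter_upwards [(Filter.eventually_all_finset s).2 fun j hj =>
      (hf j hj).ae_hasDerivAt_integral] with x hx hxab
    exact HasDerivAt.fun_finsetProd fun j hj => (hx j hj hxab a (by simp)).const_add (c j)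
  have hprim : ∀ j ∈ s, AbsolutelyContinuousOnInterval (fun x => c j + ∫ t in a..x, f j t) a b :=
    fun j hj => (contDiff_const.contDiffOn.absolutelyContinuousOnInterval).fun_add
      (absolutelyContinuousOnInterval_primitive (hf j hj))
  rw [integral_eq_sub_of_absolutelyContinuousOnInterval
    (absolutelyContinuousOnInterval_prod s hprim) hderiv
    (intervalIntegrable_sum_prod_erase_mul c hf)]
  simp

end Primitives

section Products

variable {ι : Type*} [Fintype ι] {e : ι → ℂ → ℂ}

theorem integrable_mul_prod_eval {Ω : Type*} [MeasurableSpace Ω] {μ : Measure Ω} {a : Ω → ℂ}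
    (ha : Integrable a μ) {pt : Ω → ι → ℂ} (hpt : Measurable pt) (he : ∀ j, Continuous (e j))
    (hc : ∀ j, HasCompactSupport (e j)) : Integrable (fun x => a x * ∏ j, e j (pt x j)) μ := by
  choose M hM using fun j => (he j).bounded_above_of_compact_support (hc j)
  have hmeas : Measurable fun x => ∏ j, e j (pt x j) := Finset.measurable_fun_prod _ fun j _ =>
    (he j).measurable.comp ((measurable_pi_apply j).comp hpt)
  refine ha.mul_bdd (c := ∏ j, M j) hmeas.aestronglyMeasurable (ae_of_all _ fun x => ?_)
  rw [norm_prod]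
  exact Finset.prod_le_prod (fun _ _ => norm_nonneg _) fun j _ => hM j _

theorem integral_cauchyKernel_mul_prod (z : ι → ℂ) (r : ℝ) (e : ι → ℂ → ℂ) :
    ∫ θ, cauchyKernel z (r, θ) * ∏ j, e j (chainPoint z (r, θ) j)
      ∂(Measure.pi fun _ : ι => angleMeasure) = ∏ j, chainMean (e j) (z j) r := by
  simp only [cauchyKernel, chainPoint, ← Finset.prod_mul_distrib]
  exact integral_fintype_prod_eq_prod fun j θ => cauchyWeight r (z j) θ *
    e j (chainCoord r (z j) θ)

theorem integrable_cauchyKernel_mul_radialFactor {z : ι → ℂ} (hz : ∀ j, ‖z j‖ ≤ 1) (k : ι) :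
    Integrable (fun p => cauchyKernel z p * radialFactor (p.2 k)) (chainMeasure ι) :=
  (integrable_cauchyKernel hz).mul_bdd (c := 2) (measurable_radialFactor.comp
    ((measurable_pi_apply k).comp measurable_snd)).aestronglyMeasurable
    (ae_of_all _ fun _ => norm_radialFactor_le _)

theorem integrableOn_prod_chainMean {z : ι → ℂ} (hz : ∀ j, ‖z j‖ ≤ 1)
    (he : ∀ j, Continuous (e j)) (hc : ∀ j, HasCompactSupport (e j)) :
    IntegrableOn (fun r => ∏ j, chainMean (e j) (z j) r) (Ioo 0 1) := by
  simp only [← integral_cauchyKernel_mul_prod]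
  exact (integrable_mul_prod_eval (integrable_cauchyKernel hz)
    (measurable_chainPoint measurable_const measurable_id) he hc).integral_prod_left

end Products

section ProductDerivatives

/-- The factors of `∂̄_k` of the product function `ζ ↦ ∏ j, e j (ζ j)`. -/
def dbarFactors {ι : Type*} [DecidableEq ι] (e : ι → ℂ → ℂ) (k : ι) : ι → ℂ → ℂ :=
  Function.update e k (dbar (e k))

/-- The `j`-th factor of the integral over all angles of the `k`-th component of the operator,
applied to a product function. -/
def chainFactor {ι : Type*} [DecidableEq ι] (k j : ι) (e : ℂ → ℂ) (z : ℂ) (r : ℝ) : ℂ :=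
  if j = k then radialChainMean e z r else chainMean e z r

variable {ι : Type*} [DecidableEq ι] {e : ι → ℂ → ℂ}

@[simp] theorem dbarFactors_same (e : ι → ℂ → ℂ) (k : ι) : dbarFactors e k k = dbar (e k) :=
  Function.update_self ..

theorem dbarFactors_of_ne {j k : ι} (h : j ≠ k) (e : ι → ℂ → ℂ) : dbarFactors e k j = e j :=
  Function.update_of_ne h ..

theorem continuous_dbarFactors (he : ∀ j, ContDiff ℝ 1 (e j)) (k j : ι) :
    Continuous (dbarFactors e k j) := by
  rcases eq_or_ne j k with rfl | h
  · simpa using continuous_dbar (he j)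
  · simpa [dbarFactors_of_ne h] using (he j).continuous

theorem hasCompactSupport_dbarFactors (hc : ∀ j, HasCompactSupport (e j)) (k j : ι) :
    HasCompactSupport (dbarFactors e k j) := by
  rcases eq_or_ne j k with rfl | h
  · simpa using hasCompactSupport_dbar (hc j)
  · simpa [dbarFactors_of_ne h] using hc j

theorem chainFactor_same (k : ι) (e : ℂ → ℂ) : chainFactor k k e = radialChainMean e := by
  ext z r
  exact if_pos rfl

theorem chainFactor_of_ne {j k : ι} (h : j ≠ k) (e : ℂ → ℂ) :
    chainFactor k j e = chainMean e := by
  ext z r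
  exact if_neg h

variable [Fintype ι]

theorem prod_chainMean_eq_add_integral (he : ∀ j, ContDiff ℝ 1 (e j))
    (hc : ∀ j, HasCompactSupport (e j)) (z : ι → ℂ) {ρ : ℝ} (hρ : 0 < ρ) (hρz : ∀ j, ρ ≠ ‖z j‖) :
    ∏ j, chainMean (e j) (z j) ρ = ∏ j, e j (z j) + ∫ r in (0 : ℝ)..ρ,
      ∑ k, ∏ j, chainFactor k j (dbarFactors e k j) (z j) r := by
  have hint : ∀ j, IntervalIntegrable (radialChainMean (dbar (e j)) (z j)) volume 0 ρ := fun j =>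
    (intervalIntegrable_iff_integrableOn_Ioc_of_le hρ.le).2 <| (integrableOn_radialChainMean
      (continuous_dbar (he j)) (hasCompactSupport_dbar (hc j)) (z j)).mono_set Ioc_subset_Ioi_self
  rw [Finset.prod_congr rfl fun j _ => chainMean_eq_add_integral (he j) (hc j) hρ (hρz j),
    prod_add_integral_eq (fun j => e j (z j)) fun j _ => hint j]
  congr 1
  refine intervalIntegral.integral_congr_ae ?_
  have hne : ∀ᵐ r : ℝ, ∀ j, r ≠ ‖z j‖ := ae_all_iff.2 fun j => Measure.ae_ne volume _
  filter_upwards [hne] with r hrz hr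
  rw [uIoc_of_le hρ.le] at hr
  refine Finset.sum_congr rfl fun k _ => ?_
  rw [← Finset.prod_erase_mul _ _ (Finset.mem_univ k), chainFactor_same, dbarFactors_same]
  congr 1
  refine Finset.prod_congr rfl fun j hj => ?_
  have hjk := Finset.ne_of_mem_erase hj
  rw [chainFactor_of_ne hjk, dbarFactors_of_ne hjk,
    chainMean_eq_add_integral (he j) (hc j) hr.1 (hrz j)]

theorem integral_cauchyKernel_mul_radialFactor_mul_prod (z : ι → ℂ) (r : ℝ) (k : ι)
    (e : ι → ℂ → ℂ) :
    ∫ θ, cauchyKernel z (r, θ) * radialFactor (θ k) * ∏ j, e j (chainPoint z (r, θ) j)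
      ∂(Measure.pi fun _ : ι => angleMeasure) = ∏ j, chainFactor k j (e j) (z j) r := by
  have hprod : ∀ θ : ι → ℝ, cauchyKernel z (r, θ) * radialFactor (θ k) *
      ∏ j, e j (chainPoint z (r, θ) j) = ∏ j, (cauchyWeight r (z j) (θ j) *
        ((if j = k then radialFactor (θ j) else 1) * e j (chainCoord r (z j) (θ j)))) := by
    intro θ
    rw [Finset.prod_mul_distrib, Finset.prod_mul_distrib, Finset.prod_ite_eq' Finset.univ k]
    simp [cauchyKernel, chainPoint, mul_assoc]
  simp only [hprod]
  rw [integral_fintype_prod_eq_prod fun j θ => cauchyWeight r (z j) θ *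
    ((if j = k then radialFactor θ else 1) * e j (chainCoord r (z j) θ))]
  refine Finset.prod_congr rfl fun j _ => ?_
  unfold chainFactor chainMean radialChainMean
  split_ifs <;> simp

theorem integrableOn_prod_chainFactor {z : ι → ℂ} (hz : ∀ j, ‖z j‖ ≤ 1) (k : ι)
    (he : ∀ j, Continuous (e j)) (hc : ∀ j, HasCompactSupport (e j)) :
    IntegrableOn (fun r => ∏ j, chainFactor k j (e j) (z j) r) (Ioo 0 1) := by
  simp only [← integral_cauchyKernel_mul_radialFactor_mul_prod]
  exact (integrable_mul_prod_eval (integrable_cauchyKernel_mul_radialFactor hz k)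
    (measurable_chainPoint measurable_const measurable_id) he hc).integral_prod_left

end ProductDerivatives

section Reassociation

variable {X Y Z : Type*} [MeasurableSpace X] [MeasurableSpace Y] [MeasurableSpace Z]
  {μ : Measure X} {ν : Measure Y} {ρ : Measure Z} [SFinite ν] [SFinite ρ]
  {F : X × Y × Z → ℂ}

theorem integrable_integral_prodAssoc (hF : Integrable F (μ.prod (ν.prod ρ))) :
    Integrable (fun x : X × Y => ∫ c, F (x.1, x.2, c) ∂ρ) (μ.prod ν) :=
  ((measurePreserving_prodAssoc μ ν ρ).integrable_comp_of_integrable hF).integral_prod_left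

theorem integral_prodAssoc [SFinite μ] (hF : Integrable F (μ.prod (ν.prod ρ))) :
    ∫ q, F q ∂(μ.prod (ν.prod ρ)) = ∫ x : X × Y, ∫ c, F (x.1, x.2, c) ∂ρ ∂(μ.prod ν) := by
  have h := measurePreserving_prodAssoc μ ν ρ
  rw [← h.integral_comp MeasurableEquiv.prodAssoc.measurableEmbedding]
  exact integral_prod _ (h.integrable_comp_of_integrable hF)

end Reassociation

section PairKernel

theorem insertNth_mem_polydisc {m : ℕ} (l : Fin (m + 1)) {a : ℂ} (ha : ‖a‖ < 1) {z : Fin m → ℂ}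
    (hz : z ∈ polydisc m) : l.insertNth (α := fun _ => ℂ) a z ∈ polydisc (m + 1) :=
  (Fin.forall_iff_succAbove l).2 ⟨by simpa using ha, fun j => by simpa using hz j⟩

theorem norm_insertNth_le_one {m : ℕ} (l : Fin (m + 1)) {a : ℂ} (ha : ‖a‖ ≤ 1) {z : Fin m → ℂ}
    (hz : ∀ j, ‖z j‖ ≤ 1) (j : Fin (m + 1)) : ‖l.insertNth (α := fun _ => ℂ) a z j‖ ≤ 1 := by
  revert j
  exact (Fin.forall_iff_succAbove l).2 ⟨by simpa using ha, fun j => by simpa using hz j⟩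

theorem measurable_insertNth {m : ℕ} (l : Fin (m + 1)) {X : Type*} [MeasurableSpace X]
    {a : X → ℂ} {z : X → Fin m → ℂ} (ha : Measurable a) (hz : Measurable z) :
    Measurable fun x => l.insertNth (α := fun _ => ℂ) (a x) (z x) := by
  refine measurable_pi_lambda _ ((Fin.forall_iff_succAbove l).2 ⟨by simpa using ha, fun j => ?_⟩)
  simpa only [Fin.insertNth_apply_succAbove] using hz.eval

/-- The product of Lebesgue measure on the unit disc, carrying one coordinate of the point `z`,
with the parameter measure of the chains in dimension `n`. -/
def discChainMeasure (n : ℕ) : Measure (ℂ × ℝ × (Fin n → ℝ)) :=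
  (volume.restrict (Metric.ball 0 1)).prod (chainMeasure (Fin n))

instance (n : ℕ) : SFinite (discChainMeasure n) := by
  unfold discChainMeasure
  infer_instance

/-- The kernel that pairs the `k`-th component of a form with `∂ψ/∂z̄` in the `l`-th variable, the
other variables `z` being frozen: `∫ H[g] ∂ψ/∂z̄_l` is minus the sum over `k` of the integrals of
`pairKernel ψ l z k` against `g k` at `pairPoint l z`. -/
def pairKernel {m : ℕ} (ψ : ℂ → ℂ) (l : Fin (m + 1)) (z : Fin m → ℂ) (k : Fin (m + 1))
    (q : ℂ × ℝ × (Fin (m + 1) → ℝ)) : ℂ :=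
  dbar ψ q.1 * (cauchyKernel (l.insertNth q.1 z) q.2 * radialFactor (q.2.2 k))

/-- The point of the chains over `z`, with `l`-th coordinate of `z` replaced by the disc variable,
that belongs to the parameter `q`. -/
def pairPoint {m : ℕ} (l : Fin (m + 1)) (z : Fin m → ℂ) (q : ℂ × ℝ × (Fin (m + 1) → ℝ)) :
    Fin (m + 1) → ℂ :=
  chainPoint (l.insertNth q.1 z) q.2

variable {m : ℕ} {ψ : ℂ → ℂ} {z : Fin m → ℂ} {e : Fin (m + 1) → ℂ → ℂ}

theorem measurable_pairPoint (l : Fin (m + 1)) (z : Fin m → ℂ) : Measurable (pairPoint l z) :=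
  measurable_chainPoint (measurable_insertNth l measurable_fst measurable_const) measurable_snd

theorem measurable_pairKernel (hψ : ContDiff ℝ 1 ψ) (l : Fin (m + 1)) (z : Fin m → ℂ)
    (k : Fin (m + 1)) : Measurable (pairKernel ψ l z k) :=
  ((continuous_dbar hψ).measurable.comp measurable_fst).mul <|
    (measurable_cauchyKernel (measurable_insertNth l measurable_fst measurable_const)
      measurable_snd).mul (measurable_radialFactor.comp (by fun_prop))

theorem exists_integral_norm_cauchyKernel_mul_radialFactor_le (ι : Type*) [Fintype ι] :
    ∃ C, ∀ z : ι → ℂ, (∀ j, ‖z j‖ ≤ 1) → ∀ k,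
      ∫ p, ‖cauchyKernel z p * radialFactor (p.2 k)‖ ∂(chainMeasure ι) ≤ C := by
  obtain ⟨C, -, hC⟩ := exists_integral_rpow_mul_norm_cauchyKernel_le ι (le_refl (0 : ℝ)) one_pos
  simp only [neg_zero, Real.rpow_zero, one_mul] at hC
  refine ⟨C * 2, fun z hz k => ?_⟩
  calc ∫ p, ‖cauchyKernel z p * radialFactor (p.2 k)‖ ∂(chainMeasure ι)
      ≤ ∫ p, ‖cauchyKernel z p‖ * 2 ∂(chainMeasure ι) := by
        refine integral_mono (integrable_cauchyKernel_mul_radialFactor hz k).norm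
          ((integrable_cauchyKernel hz).norm.mul_const 2) fun p => ?_
        simp only [norm_mul]
        gcongr
        exact norm_radialFactor_le _
    _ ≤ C * 2 := by
        rw [integral_mul_const]
        gcongr
        exact hC z 0 hz (by simp)

theorem integrable_pairKernel (hψ : ContDiff ℝ 1 ψ) (hc : HasCompactSupport ψ) (l : Fin (m + 1))
    (hz : ∀ j, ‖z j‖ ≤ 1) (k : Fin (m + 1)) :
    Integrable (pairKernel ψ l z k) (discChainMeasure (m + 1)) := by
  obtain ⟨C, hC⟩ := exists_integral_norm_cauchyKernel_mul_radialFactor_le (Fin (m + 1))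
  have hmeas := measurable_pairKernel hψ l z k
  have hz' : ∀ᵐ a ∂volume.restrict (Metric.ball (0 : ℂ) 1),
      ∀ j, ‖l.insertNth (α := fun _ => ℂ) a z j‖ ≤ 1 := by
    filter_upwards [ae_restrict_mem measurableSet_ball] with a ha
    exact norm_insertNth_le_one l (mem_ball_zero_iff.1 ha).le hz
  have hdbar := (integrable_dbar hψ hc).norm.restrict (s := Metric.ball (0 : ℂ) 1)
  refine (integrable_prod_iff hmeas.aestronglyMeasurable).2 ⟨?_, ?_⟩
  · filter_upwards [hz'] with a ha
    exact (integrable_cauchyKernel_mul_radialFactor ha k).const_mul (dbar ψ a)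
  · refine (hdbar.mul_const C).mono'
      hmeas.norm.stronglyMeasurable.integral_prod_right'.aestronglyMeasurable ?_
    filter_upwards [hz'] with a ha
    rw [Real.norm_of_nonneg (integral_nonneg fun _ => norm_nonneg _)]
    simp only [pairKernel, norm_mul (dbar ψ a), integral_const_mul]
    gcongr
    exact hC _ ha k

theorem integral_ball_dbar_mul (hs : tsupport ψ ⊆ Metric.ball 0 1) (F : ℂ → ℂ) :
    ∫ a in Metric.ball (0 : ℂ) 1, dbar ψ a * F a = ∫ a, F a * dbar ψ a := by
  rw [setIntegral_eq_integral_of_forall_compl_eq_zero]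
  · simp only [mul_comm]
  · intro a ha
    rw [dbar_eq_zero_of_notMem_tsupport fun h => ha (hs h), zero_mul]

theorem integral_angle_pairKernel_mul_prod (l : Fin (m + 1)) (k : Fin (m + 1)) (a : ℂ) (r : ℝ) :
    ∫ θ, pairKernel ψ l z k (a, r, θ) * ∏ j, e j (pairPoint l z (a, r, θ) j)
        ∂(Measure.pi fun _ : Fin (m + 1) => angleMeasure) =
      dbar ψ a * chainFactor k l (e l) a r *
        ∏ j, chainFactor k (l.succAbove j) (e (l.succAbove j)) (z j) r := by
  have h := integral_cauchyKernel_mul_radialFactor_mul_prod (l.insertNth a z) r k e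
  rw [Fin.prod_univ_succAbove _ l] at h
  simp only [Fin.insertNth_apply_same, Fin.insertNth_apply_succAbove] at h
  rw [mul_assoc, ← h, ← integral_const_mul]
  exact integral_congr_ae (ae_of_all _ fun θ => mul_assoc ..)

theorem integral_pairKernel_mul_prod (hψ : ContDiff ℝ 1 ψ) (hψc : HasCompactSupport ψ)
    (hs : tsupport ψ ⊆ Metric.ball 0 1) (l : Fin (m + 1)) (hz : ∀ j, ‖z j‖ ≤ 1)
    (k : Fin (m + 1)) (he : ∀ j, Continuous (e j)) (hc : ∀ j, HasCompactSupport (e j)) :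
    ∫ q, pairKernel ψ l z k q * ∏ j, e j (pairPoint l z q j) ∂(discChainMeasure (m + 1)) =
      ∫ r in Ioo (0 : ℝ) 1,
        (∏ j, chainFactor k (l.succAbove j) (e (l.succAbove j)) (z j) r) *
          ∫ a, chainFactor k l (e l) a r * dbar ψ a := by
  have hint : Integrable (fun q => pairKernel ψ l z k q * ∏ j, e j (pairPoint l z q j))
      (discChainMeasure (m + 1)) :=
    integrable_mul_prod_eval (integrable_pairKernel hψ hψc l hz k) (measurable_pairPoint l z) he hc
  have hint' := integrable_integral_prodAssoc hint
  refine (integral_prodAssoc hint).trans ?_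
  simp only [integral_angle_pairKernel_mul_prod] at hint' ⊢
  rw [integral_prod_symm _ hint']
  refine integral_congr_ae (ae_of_all _ fun r => ?_)
  simp only [integral_mul_const]
  rw [mul_comm, integral_ball_dbar_mul hs]

end PairKernel

section NormMoments

variable {f : ℂ → ℂ} {b : ℝ → ℂ}

theorem integrableOn_comp_norm_ball (hb : IntegrableOn b (Ioo 0 1)) :
    IntegrableOn (fun a : ℂ => b ‖a‖) (Metric.ball 0 1) := by
  rw [integrableOn_fun_norm_addHaar volume (f := b)]
  refine Integrable.bdd_smul (φ := fun y : ℝ => y ^ (Module.finrank ℝ ℂ - 1)) hb 1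
    (by fun_prop) ?_
  filter_upwards [ae_restrict_mem measurableSet_Ioo] with r hr
  rw [norm_pow, Real.norm_of_nonneg hr.1.le]
  exact pow_le_one₀ hr.1.le hr.2.le

theorem integrable_mul_comp_norm (hf : Continuous f) (hc : HasCompactSupport f)
    (hs : tsupport f ⊆ Metric.ball 0 1) (hb : IntegrableOn b (Ioo 0 1)) :
    Integrable fun a => f a * b ‖a‖ := by
  obtain ⟨A, hA⟩ := hf.bounded_above_of_compact_support hc
  refine (integrableOn_iff_integrable_of_support_subset fun a ha => ?_).1
    ((integrableOn_comp_norm_ball hb).bdd_mul hf.aestronglyMeasurable (ae_of_all _ hA))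
  exact hs (subset_tsupport _ fun h => ha (by simp [h]))

theorem integral_mul_comp_norm (hf : Continuous f) (hc : HasCompactSupport f)
    (hs : tsupport f ⊆ Metric.ball 0 1) (hb : IntegrableOn b (Ioo 0 1)) :
    ∫ a, f a * b ‖a‖ = ∫ r in Ioo (0 : ℝ) 1, b r * (2 * π * r * Real.circleAverage f 0 r) := by
  have havg : ∀ r ≥ (0 : ℝ), Real.circleAverage (fun a => f a * b ‖a‖) 0 r =
      b r * Real.circleAverage f 0 r := fun r hr => by
    rw [← smul_eq_mul, ← Real.circleAverage_fun_smul]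
    refine Real.circleAverage_congr_sphere fun a ha => ?_
    rw [mem_sphere_zero_iff_norm, abs_of_nonneg hr] at ha
    simp only [ha, smul_eq_mul, mul_comm]
  rw [integral_eq_integral_circleAverage (integrable_mul_comp_norm hf hc hs hb),
    ← integral_smul, setIntegral_eq_of_subset_of_forall_sdiff_eq_zero measurableSet_Ioi
      (Ioo_subset_Ioi_self : Ioo (0 : ℝ) 1 ⊆ Ioi 0)]
  · refine setIntegral_congr_fun measurableSet_Ioo fun r hr => ?_
    simp only [havg r hr.1.le, Complex.real_smul, Complex.ofReal_mul, Complex.ofReal_ofNat]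
    ring
  · intro r hr
    have hr0 : 0 < r := hr.1
    have hzero : Real.circleAverage f 0 r = 0 := by
      refine (Real.circleAverage_congr_sphere fun a ha => ?_).trans
        (Real.circleAverage_const (0 : ℂ) 0 r)
      rw [mem_sphere_zero_iff_norm, abs_of_pos hr0] at ha
      refine image_eq_zero_of_notMem_tsupport fun h => hr.2 ⟨hr0, ?_⟩
      exact ha ▸ mem_ball_zero_iff.1 (hs h)
    simp only [havg r hr0.le, hzero, mul_zero, smul_zero]

end NormMoments

section SliceKernel

/-- The kernel of the area integrals left over when `∂ψ/∂z̄` is integrated by parts against the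
chain means: the disc variable `q.1` is integrated over the region where the radius `q.2.1` of the
chain does not exceed its modulus. -/
def sliceKernel {m : ℕ} (ψ : ℂ → ℂ) (z : Fin m → ℂ) (k : Fin m) (q : ℂ × ℝ × (Fin m → ℝ)) : ℂ :=
  if q.2.1 ≤ ‖q.1‖ then ψ q.1 * (cauchyKernel z q.2 * radialFactor (q.2.2 k)) else 0

/-- The point with `l`-th coordinate the disc variable and remaining coordinates on the chains
over `z`. -/
def slicePoint {m : ℕ} (l : Fin (m + 1)) (z : Fin m → ℂ) (q : ℂ × ℝ × (Fin m → ℝ)) :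
    Fin (m + 1) → ℂ :=
  l.insertNth q.1 (chainPoint z q.2)

variable {m : ℕ} {ψ : ℂ → ℂ} {z : Fin m → ℂ} {e : Fin (m + 1) → ℂ → ℂ}

theorem measurable_slicePoint (l : Fin (m + 1)) (z : Fin m → ℂ) : Measurable (slicePoint l z) :=
  measurable_insertNth l measurable_fst (measurable_chainPoint measurable_const measurable_snd)

theorem integrable_sliceKernel (hψ : Integrable ψ) (hz : ∀ j, ‖z j‖ ≤ 1) (k : Fin m) :
    Integrable (sliceKernel ψ z k) ((volume : Measure ℂ).prod (chainMeasure (Fin m))) :=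
  (hψ.mul_prod (integrable_cauchyKernel_mul_radialFactor hz k)).indicator
    (s := {q : ℂ × ℝ × (Fin m → ℝ) | q.2.1 ≤ ‖q.1‖})
    (measurableSet_le (by fun_prop) (by fun_prop))

theorem integral_angle_sliceKernel_mul_prod (l : Fin (m + 1)) (k : Fin m) (a : ℂ) (r : ℝ) :
    ∫ θ, sliceKernel ψ z k (a, r, θ) * ∏ j, e j (slicePoint l z (a, r, θ) j)
        ∂(Measure.pi fun _ : Fin m => angleMeasure) =
      {a : ℂ | r ≤ ‖a‖}.indicator (fun a => e l a * ψ a) a *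
        ∏ j, chainFactor k j (e (l.succAbove j)) (z j) r := by
  rw [← integral_cauchyKernel_mul_radialFactor_mul_prod z r k fun j => e (l.succAbove j),
    ← integral_const_mul]
  refine integral_congr_ae (ae_of_all _ fun θ => ?_)
  by_cases h : r ≤ ‖a‖
  · simp only [Fin.prod_univ_succAbove _ l, sliceKernel, slicePoint, Fin.insertNth_apply_same,
      Fin.insertNth_apply_succAbove, h, if_true, indicator, mem_ofPred_eq]
    ring
  · simp [sliceKernel, indicator, h]

theorem integrable_sliceKernel_mul_prod (hψ : Integrable ψ) (l : Fin (m + 1))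
    (hz : ∀ j, ‖z j‖ ≤ 1) (k : Fin m) (he : ∀ j, Continuous (e j))
    (hc : ∀ j, HasCompactSupport (e j)) :
    Integrable (fun q => sliceKernel ψ z k q * ∏ j, e j (slicePoint l z q j))
      ((volume : Measure ℂ).prod (chainMeasure (Fin m))) :=
  integrable_mul_prod_eval (integrable_sliceKernel hψ hz k) (measurable_slicePoint l z) he hc

theorem integrable_indicator_mul_prod_chainFactor (hψ : Integrable ψ) (l : Fin (m + 1))
    (hz : ∀ j, ‖z j‖ ≤ 1) (k : Fin m) (he : ∀ j, Continuous (e j))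
    (hc : ∀ j, HasCompactSupport (e j)) :
    Integrable (fun x : ℂ × ℝ => {a : ℂ | x.2 ≤ ‖a‖}.indicator (fun a => e l a * ψ a) x.1 *
      ∏ j, chainFactor k j (e (l.succAbove j)) (z j) x.2)
      ((volume : Measure ℂ).prod (volume.restrict (Ioo 0 1))) := by
  have h := integrable_integral_prodAssoc (integrable_sliceKernel_mul_prod hψ l hz k he hc)
  simpa only [integral_angle_sliceKernel_mul_prod] using h

theorem integral_sliceKernel_mul_prod (hψ : Integrable ψ) (l : Fin (m + 1)) (hz : ∀ j, ‖z j‖ ≤ 1)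
    (k : Fin m) (he : ∀ j, Continuous (e j)) (hc : ∀ j, HasCompactSupport (e j)) :
    ∫ q, sliceKernel ψ z k q * ∏ j, e j (slicePoint l z q j)
        ∂((volume : Measure ℂ).prod (chainMeasure (Fin m))) =
      ∫ x : ℂ × ℝ, {a : ℂ | x.2 ≤ ‖a‖}.indicator (fun a => e l a * ψ a) x.1 *
        ∏ j, chainFactor k j (e (l.succAbove j)) (z j) x.2
        ∂((volume : Measure ℂ).prod (volume.restrict (Ioo 0 1))) := by
  refine (integral_prodAssoc (integrable_sliceKernel_mul_prod hψ l hz k he hc)).trans ?_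
  simp only [integral_angle_sliceKernel_mul_prod]

theorem integral_sliceKernel_mul_prod_radius_outer (hψ : Integrable ψ) (l : Fin (m + 1))
    (hz : ∀ j, ‖z j‖ ≤ 1) (k : Fin m) (he : ∀ j, Continuous (e j))
    (hc : ∀ j, HasCompactSupport (e j)) :
    ∫ q, sliceKernel ψ z k q * ∏ j, e j (slicePoint l z q j)
        ∂((volume : Measure ℂ).prod (chainMeasure (Fin m))) =
      ∫ r in Ioo (0 : ℝ) 1, (∏ j, chainFactor k j (e (l.succAbove j)) (z j) r) *
        ∫ a in {a : ℂ | r ≤ ‖a‖}, e l a * ψ a := by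
  rw [integral_sliceKernel_mul_prod hψ l hz k he hc,
    integral_prod_symm _ (integrable_indicator_mul_prod_chainFactor hψ l hz k he hc)]
  refine integral_congr_ae (ae_of_all _ fun r => ?_)
  simp only [integral_mul_const, integral_indicator (measurableSet_le_norm r), mul_comm]

theorem integral_Ioo_indicator_mul (hs : tsupport ψ ⊆ Metric.ball 0 1) (f : ℂ → ℂ) (b : ℝ → ℂ)
    (a : ℂ) :
    ∫ r in Ioo (0 : ℝ) 1, {a : ℂ | r ≤ ‖a‖}.indicator (fun a => f a * ψ a) a * b r =
      f a * ψ a * ∫ r in (0 : ℝ)..‖a‖, b r := by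
  by_cases hψa : ψ a = 0
  · simp [indicator, hψa]
  have ha : ‖a‖ < 1 := mem_ball_zero_iff.1 (hs (subset_tsupport _ hψa))
  have hset : Ioo (0 : ℝ) 1 ∩ Iic ‖a‖ = Ioc 0 ‖a‖ := by
    ext r
    exact ⟨fun h => ⟨h.1.1, h.2⟩, fun h => ⟨⟨h.1, h.2.trans_lt ha⟩, h.2⟩⟩
  have hind : ∀ r, {a : ℂ | r ≤ ‖a‖}.indicator (fun a => f a * ψ a) a * b r =
      (Iic ‖a‖).indicator (fun r => f a * ψ a * b r) r := fun r => by simp [indicator]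
  simp only [hind]
  rw [setIntegral_indicator measurableSet_Iic, hset, integral_const_mul,
    intervalIntegral.integral_of_le (norm_nonneg a)]

theorem integral_sliceKernel_mul_prod_radius_inner (hψ : Integrable ψ)
    (hs : tsupport ψ ⊆ Metric.ball 0 1) (l : Fin (m + 1)) (hz : ∀ j, ‖z j‖ ≤ 1) (k : Fin m)
    (he : ∀ j, Continuous (e j)) (hc : ∀ j, HasCompactSupport (e j)) :
    ∫ q, sliceKernel ψ z k q * ∏ j, e j (slicePoint l z q j)
        ∂((volume : Measure ℂ).prod (chainMeasure (Fin m))) =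
      ∫ a, e l a * ψ a *
        ∫ r in (0 : ℝ)..‖a‖, ∏ j, chainFactor k j (e (l.succAbove j)) (z j) r := by
  rw [integral_sliceKernel_mul_prod hψ l hz k he hc,
    integral_prod _ (integrable_indicator_mul_prod_chainFactor hψ l hz k he hc)]
  simp only [integral_Ioo_indicator_mul hs]

theorem integrable_mul_integral_prod_chainFactor (hψ : Integrable ψ)
    (hs : tsupport ψ ⊆ Metric.ball 0 1) (l : Fin (m + 1)) (hz : ∀ j, ‖z j‖ ≤ 1) (k : Fin m)
    (he : ∀ j, Continuous (e j)) (hc : ∀ j, HasCompactSupport (e j)) :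
    Integrable fun a => e l a * ψ a *
      ∫ r in (0 : ℝ)..‖a‖, ∏ j, chainFactor k j (e (l.succAbove j)) (z j) r := by
  have h := (integrable_indicator_mul_prod_chainFactor hψ l hz k he hc).integral_prod_left
  simpa only [integral_Ioo_indicator_mul hs] using h

end SliceKernel

section IntegrationByParts

variable {m : ℕ} {ψ : ℂ → ℂ} {z : Fin m → ℂ} {e : Fin (m + 1) → ℂ → ℂ}

theorem chainFactor_succAbove (l : Fin (m + 1)) (k j : Fin m) :
    chainFactor (l.succAbove k) (l.succAbove j) = chainFactor k j := by
  ext e z r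
  simp only [chainFactor, Fin.succAbove_right_inj]

theorem dbarFactors_succAbove (e : Fin (m + 1) → ℂ → ℂ) (l : Fin (m + 1)) (k j : Fin m) :
    dbarFactors e (l.succAbove k) (l.succAbove j) =
      dbarFactors (fun i => e (l.succAbove i)) k j := by
  rcases eq_or_ne j k with rfl | h
  · simp
  · rw [dbarFactors_of_ne h, dbarFactors_of_ne (Fin.succAbove_right_injective.ne h)]

theorem integral_pairKernel_succAbove_mul_prod (hψ : ContDiff ℝ 1 ψ) (hψc : HasCompactSupport ψ)
    (hs : tsupport ψ ⊆ Metric.ball 0 1) (l : Fin (m + 1)) (hz : ∀ j, ‖z j‖ ≤ 1) (k : Fin m)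
    (he : ∀ j, ContDiff ℝ 1 (e j)) (hc : ∀ j, HasCompactSupport (e j)) :
    ∫ q, pairKernel ψ l z (l.succAbove k) q * ∏ j, e j (pairPoint l z q j)
        ∂(discChainMeasure (m + 1)) =
      -∫ q, sliceKernel ψ z k q * ∏ j, dbarFactors e l j (slicePoint l z q j)
        ∂((volume : Measure ℂ).prod (chainMeasure (Fin m))) := by
  rw [integral_pairKernel_mul_prod hψ hψc hs l hz _ (fun j => (he j).continuous) hc,
    integral_sliceKernel_mul_prod_radius_outer (hψ.continuous.integrable_of_hasCompactSupport hψc)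
      l hz k (continuous_dbarFactors he l) (hasCompactSupport_dbarFactors hc l), ← integral_neg]
  refine setIntegral_congr_fun measurableSet_Ioo fun r hr => ?_
  simp only [chainFactor_succAbove, chainFactor_of_ne (Fin.succAbove_ne l k).symm,
    dbarFactors_of_ne (Fin.succAbove_ne l _), dbarFactors_same]
  rw [integral_chainMean_mul_dbar (he l) hr.1.le hψ hψc, mul_neg]

theorem tsupport_mul_subset_ball (hs : tsupport ψ ⊆ Metric.ball 0 1) (f : ℂ → ℂ) :
    tsupport (fun a => f a * ψ a) ⊆ Metric.ball 0 1 :=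
  (tsupport_mul_subset_right (f := f)).trans hs

theorem integral_pairKernel_same_mul_prod (hψ : ContDiff ℝ 1 ψ) (hψc : HasCompactSupport ψ)
    (hs : tsupport ψ ⊆ Metric.ball 0 1) (l : Fin (m + 1)) (hz : ∀ j, ‖z j‖ ≤ 1)
    (he : ∀ j, Continuous (e j)) (hc : ∀ j, HasCompactSupport (e j)) :
    ∫ q, pairKernel ψ l z l q * ∏ j, e j (pairPoint l z q j) ∂(discChainMeasure (m + 1)) =
      ∫ a, e l a * ψ a * ∏ j, chainMean (e (l.succAbove j)) (z j) ‖a‖ := by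
  rw [integral_pairKernel_mul_prod hψ hψc hs l hz l he hc,
    integral_mul_comp_norm (f := fun a => e l a * ψ a)
      (b := fun r => ∏ j, chainMean (e (l.succAbove j)) (z j) r)
      ((he l).mul hψ.continuous) hψc.mul_left (tsupport_mul_subset_ball hs (e l))
      (integrableOn_prod_chainMean hz (fun j => he _) fun j => hc _)]
  refine setIntegral_congr_fun measurableSet_Ioo fun r hr => ?_
  simp only [chainFactor_of_ne (Fin.succAbove_ne l _), chainFactor_same]
  rw [integral_radialChainMean_mul_dbar (he l) hr.1.le hψ hψc]

theorem mul_prod_chainMean_norm_eq (hs : tsupport ψ ⊆ Metric.ball 0 1) (l : Fin (m + 1))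
    (hz : ∀ j, ‖z j‖ ≤ 1) (he : ∀ j, ContDiff ℝ 1 (e j)) (hc : ∀ j, HasCompactSupport (e j))
    {a : ℂ} (ha : 0 < ‖a‖) (haz : ∀ j, ‖a‖ ≠ ‖z j‖) :
    e l a * ψ a * ∏ j, chainMean (e (l.succAbove j)) (z j) ‖a‖ =
      ψ a * ∏ j, e j (l.insertNth (α := fun _ => ℂ) a z j) +
        ∑ k, dbarFactors e (l.succAbove k) l a * ψ a * ∫ r in (0 : ℝ)..‖a‖, ∏ j,
          chainFactor k j (dbarFactors e (l.succAbove k) (l.succAbove j)) (z j) r := by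
  by_cases hψa : ψ a = 0
  · simp [hψa]
  have ha1 : ‖a‖ < 1 := mem_ball_zero_iff.1 (hs (subset_tsupport _ hψa))
  have hint : ∀ k, IntervalIntegrable (fun r => ∏ j, chainFactor k j
      (dbarFactors (fun i => e (l.succAbove i)) k j) (z j) r) volume 0 ‖a‖ := fun k =>
    (intervalIntegrable_iff_integrableOn_Ioo_of_le ha.le).2 <|
      (integrableOn_prod_chainFactor hz k (continuous_dbarFactors (fun j => he _) k)
        (hasCompactSupport_dbarFactors (fun j => hc _) k)).mono_set (Ioo_subset_Ioo_right ha1.le)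
  simp only [dbarFactors_of_ne (Fin.succAbove_ne l _).symm, dbarFactors_succAbove,
    ← Finset.mul_sum, Fin.prod_univ_succAbove _ l, Fin.insertNth_apply_same,
    Fin.insertNth_apply_succAbove]
  rw [prod_chainMean_eq_add_integral (fun j => he _) (fun j => hc _) z ha haz,
    intervalIntegral.integral_finsetSum fun k _ => hint k]
  ring

theorem integral_mul_prod_chainMean_norm (hψ : ContDiff ℝ 1 ψ) (hψc : HasCompactSupport ψ)
    (hs : tsupport ψ ⊆ Metric.ball 0 1) (l : Fin (m + 1)) (hz : ∀ j, ‖z j‖ ≤ 1)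
    (he : ∀ j, ContDiff ℝ 1 (e j)) (hc : ∀ j, HasCompactSupport (e j)) :
    ∫ a, e l a * ψ a * ∏ j, chainMean (e (l.succAbove j)) (z j) ‖a‖ =
      (∫ a, ψ a * ∏ j, e j (l.insertNth (α := fun _ => ℂ) a z j)) +
      ∑ k, ∫ q, sliceKernel ψ z k q * ∏ j, dbarFactors e (l.succAbove k) j (slicePoint l z q j)
        ∂((volume : Measure ℂ).prod (chainMeasure (Fin m))) := by
  have hψi : Integrable ψ := hψ.continuous.integrable_of_hasCompactSupport hψc
  have hne : ∀ᵐ a : ℂ, ∀ j, ‖a‖ ≠ ‖z j‖ := ae_all_iff.2 fun j => by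
    filter_upwards [ae_ne_norm_complex ‖z j‖] with a ha using ha.symm
  have hcont := fun k => continuous_dbarFactors he (l.succAbove k)
  have hsupp := fun k => hasCompactSupport_dbarFactors hc (l.succAbove k)
  have hslice := fun k =>
    integrable_mul_integral_prod_chainFactor hψi hs l hz k (hcont k) (hsupp k)
  have hprod : Integrable fun a => ψ a * ∏ j, e j (l.insertNth (α := fun _ => ℂ) a z j) :=
    integrable_mul_prod_eval hψi (measurable_insertNth l measurable_id measurable_const)
      (fun j => (he j).continuous) hc
  simp only [fun k =>
    integral_sliceKernel_mul_prod_radius_inner hψi hs l hz k (hcont k) (hsupp k)]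
  rw [← integral_finsetSum _ fun k _ => hslice k,
    ← integral_add hprod (integrable_finsetSum _ fun k _ => hslice k)]
  refine integral_congr_ae ?_
  filter_upwards [hne, ae_ne_norm_complex 0] with a ha ha0
  exact mul_prod_chainMean_norm_eq hs l hz he hc ((norm_nonneg a).lt_of_ne ha0) ha

theorem integral_pairKernel_same_mul_prod_eq_add (hψ : ContDiff ℝ 1 ψ) (hψc : HasCompactSupport ψ)
    (hs : tsupport ψ ⊆ Metric.ball 0 1) (l : Fin (m + 1)) (hz : ∀ j, ‖z j‖ ≤ 1)
    (he : ∀ j, ContDiff ℝ 1 (e j)) (hc : ∀ j, HasCompactSupport (e j)) :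
    ∫ q, pairKernel ψ l z l q * ∏ j, e j (pairPoint l z q j) ∂(discChainMeasure (m + 1)) =
      (∫ a, ψ a * ∏ j, e j (l.insertNth (α := fun _ => ℂ) a z j)) +
      ∑ k, ∫ q, sliceKernel ψ z k q * ∏ j, dbarFactors e (l.succAbove k) j (slicePoint l z q j)
        ∂((volume : Measure ℂ).prod (chainMeasure (Fin m))) := by
  rw [integral_pairKernel_same_mul_prod hψ hψc hs l hz (fun j => (he j).continuous) hc,
    integral_mul_prod_chainMean_norm hψ hψc hs l hz he hc]

end IntegrationByParts

/-! ### Mollification -/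

section Mollify

/-- The superposition, with density `c`, of the translates of the product function
`ζ ↦ ∏ j, e j (ζ j)`; when all `e j` are equal to an approximate unit this is a mollification
of `c`. -/
def mollify {n : ℕ} (e : Fin n → ℂ → ℂ) (c : (Fin n → ℂ) → ℂ) (ζ : Fin n → ℂ) : ℂ :=
  ∫ w, c w * ∏ j, e j (ζ j - w j)

variable {n : ℕ} {e : Fin n → ℂ → ℂ} {c : (Fin n → ℂ) → ℂ}

section Pairing

variable {Ω : Type*} [MeasurableSpace Ω] {μ : Measure Ω} {a : Ω → ℂ}
  {pt : Ω → Fin n → ℂ}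

theorem integrable_mul_mul_prod_sub (ha : Integrable a μ) (hpt : Measurable pt)
    (hci : Integrable c) (he : ∀ j, Continuous (e j)) (hc : ∀ j, HasCompactSupport (e j)) :
    Integrable (fun p : Ω × (Fin n → ℂ) => a p.1 * (c p.2 * ∏ j, e j (pt p.1 j - p.2 j)))
      (μ.prod volume) := by
  simp only [← mul_assoc]
  exact integrable_mul_prod_eval (ha.mul_prod hci)
    ((hpt.comp measurable_fst).sub measurable_snd) he hc

theorem integral_mul_mul_prod_sub (w : Fin n → ℂ) :
    ∫ x, a x * (c w * ∏ j, e j (pt x j - w j)) ∂μ =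
      c w * ∫ x, a x * ∏ j, e j (pt x j - w j) ∂μ := by
  simp only [mul_left_comm (a _), integral_const_mul]

theorem integrable_mul_integral_mul_prod_sub [SFinite μ] (ha : Integrable a μ) (hpt : Measurable pt)
    (hci : Integrable c) (he : ∀ j, Continuous (e j)) (hc : ∀ j, HasCompactSupport (e j)) :
    Integrable fun w => c w * ∫ x, a x * ∏ j, e j (pt x j - w j) ∂μ := by
  simpa only [integral_mul_mul_prod_sub] using
    (integrable_mul_mul_prod_sub ha hpt hci he hc).integral_prod_right

theorem integral_mul_mollify [SFinite μ] (ha : Integrable a μ) (hpt : Measurable pt)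
    (hci : Integrable c) (he : ∀ j, Continuous (e j)) (hc : ∀ j, HasCompactSupport (e j)) :
    ∫ x, a x * mollify e c (pt x) ∂μ = ∫ w, c w * ∫ x, a x * ∏ j, e j (pt x j - w j) ∂μ := by
  simpa only [mollify, integral_const_mul, integral_mul_mul_prod_sub] using
    integral_integral_swap (f := fun x w => a x * (c w * ∏ j, e j (pt x j - w j)))
      (integrable_mul_mul_prod_sub ha hpt hci he hc)

end Pairing

section Closedness

theorem zeroExt_of_notMem (f : polydisc n → ℂ) {z : Fin n → ℂ} (hz : z ∉ polydisc n) :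
    zeroExt f z = 0 :=
  dif_neg hz

theorem setIntegral_zeroExt_mul (f : polydisc n → ℂ) (F : (Fin n → ℂ) → ℂ) :
    ∫ z in (polydisc n : Set (Fin n → ℂ)), zeroExt f z * F z = ∫ z, zeroExt f z * F z :=
  setIntegral_eq_integral_of_forall_compl_eq_zero fun z hz => by
    rw [zeroExt_of_notMem f hz, zero_mul]

theorem wirtingerBar_eq_dbar {φ : (Fin n → ℂ) → ℂ} {w : Fin n → ℂ}
    (hφ : DifferentiableAt ℝ φ w) (l : Fin n) :
    wirtingerBar l φ w = dbar (fun a => φ (Function.update w l a)) (w l) := by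
  have hφ' : HasFDerivAt φ (fderiv ℝ φ w) (Function.update w l (w l)) := by
    rw [Function.update_eq_self]
    exact hφ.hasFDerivAt
  have hderiv : ∀ v : ℂ, fderiv ℝ (fun a => φ (Function.update w l a)) (w l) v =
      fderiv ℝ φ w (Pi.single l v) := fun v => by
    have h := (hφ'.comp (w l) (hasFDerivAt_update (𝕜 := ℝ) w (w l))).fderiv
    rw [Function.comp_def] at h
    rw [h, ContinuousLinearMap.comp_apply]
    congr 1
    ext j
    rcases eq_or_ne j l with rfl | hj
    · simp
    · simp [hj]
  simp only [wirtingerBar, dbar, hderiv]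

theorem dbar_const_sub {f : ℂ → ℂ} {ζ a : ℂ} (hf : DifferentiableAt ℝ f (ζ - a)) :
    dbar (fun b => f (ζ - b)) a = -dbar f (ζ - a) := by
  have hderiv : HasFDerivAt (fun b => f (ζ - b))
      ((fderiv ℝ f (ζ - a)).comp (-ContinuousLinearMap.id ℝ ℂ)) a :=
    hf.hasFDerivAt.comp a ((hasFDerivAt_id a).const_sub ζ)
  simp only [dbar, hderiv.fderiv, ContinuousLinearMap.comp_neg, ContinuousLinearMap.comp_id,
    neg_apply]
  ring

theorem wirtingerBar_prod_sub (he : ∀ j, Differentiable ℝ (e j)) (l : Fin n) (ζ w : Fin n → ℂ) :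
    wirtingerBar l (fun w => ∏ j, e j (ζ j - w j)) w = -∏ j, dbarFactors e l j (ζ j - w j) := by
  have hdiff : ∀ a, DifferentiableAt ℝ (fun b => e l (ζ l - b)) a := by fun_prop
  have hsplit : (fun a => ∏ j, e j (ζ j - Function.update w l a j)) =
      fun a => (∏ j ∈ Finset.univ.erase l, e j (ζ j - w j)) * e l (ζ l - a) := by
    ext a
    rw [← Finset.prod_erase_mul _ _ (Finset.mem_univ l), Function.update_self]
    congr 1
    refine Finset.prod_congr rfl fun j hj => ?_
    rw [Function.update_of_ne (Finset.ne_of_mem_erase hj)]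
  rw [wirtingerBar_eq_dbar (by fun_prop) l, hsplit,
    dbar_mul_of_differentiableAt (differentiableAt_const _) (hdiff _), dbar_const_sub ((he l) _),
    mul_neg, ← Finset.prod_erase_mul _ (fun j => dbarFactors e l j (ζ j - w j)) (Finset.mem_univ l),
    dbarFactors_same]
  congr 2
  refine Finset.prod_congr rfl fun j hj => ?_
  rw [dbarFactors_of_ne (Finset.ne_of_mem_erase hj)]

theorem tsupport_prod_sub_subset {ε : ℝ} (hs : ∀ j, tsupport (e j) ⊆ Metric.closedBall 0 ε)
    (ζ : Fin n → ℂ) : tsupport (fun w : Fin n → ℂ => ∏ j, e j (ζ j - w j)) ⊆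
      Set.pi univ fun j => Metric.closedBall (ζ j) ε := by
  refine closure_minimal (fun w hw j _ => ?_)
    (isClosed_set_pi fun j _ => Metric.isClosed_closedBall)
  have hj : e j (ζ j - w j) ≠ 0 := fun h => hw (Finset.prod_eq_zero (Finset.mem_univ j) h)
  have hmem := hs j (subset_tsupport _ hj)
  rwa [mem_closedBall_zero_iff, ← dist_eq_norm, dist_comm] at hmem

/-- The product of translates `w ↦ ∏ j, e j (ζ j - w j)` as a test function on the polydisc. -/
def prodSubTestFunction (he : ∀ j, ContDiff ℝ (⊤ : ℕ∞) (e j)) {ε : ℝ}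
    (hs : ∀ j, tsupport (e j) ⊆ Metric.closedBall 0 ε) {ζ : Fin n → ℂ}
    (hζ : ∀ j, ‖ζ j‖ + ε < 1) : 𝓓(polydisc n, ℂ) where
  toFun w := ∏ j, e j (ζ j - w j)
  contDiff' := contDiff_prod fun j _ => (he j).comp (by fun_prop)
  hasCompactSupport' := (isCompact_univ_pi fun j => isCompact_closedBall (ζ j) ε).of_isClosed_subset
    (isClosed_tsupport _) (tsupport_prod_sub_subset hs ζ)
  tsupport_subset' w hw j := by
    have hwj := tsupport_prod_sub_subset hs ζ hw j (mem_univ j)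
    rw [Metric.mem_closedBall, dist_eq_norm] at hwj
    linarith [norm_sub_norm_le (w j) (ζ j), hζ j]

theorem mollify_dbarFactors_comm {g : Fin n → polydisc n → ℂ} (hg : IsDbarClosed g)
    (he : ∀ j, ContDiff ℝ (⊤ : ℕ∞) (e j)) {ε : ℝ}
    (hs : ∀ j, tsupport (e j) ⊆ Metric.closedBall 0 ε) {ζ : Fin n → ℂ} (hζ : ∀ j, ‖ζ j‖ + ε < 1)
    (l k : Fin n) :
    mollify (dbarFactors e l) (zeroExt (g k)) ζ = mollify (dbarFactors e k) (zeroExt (g l)) ζ := by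
  have hpair : ∀ i j, ∫ w in (polydisc n : Set (Fin n → ℂ)),
      zeroExt (g i) w * wirtingerBar j (prodSubTestFunction he hs hζ) w =
        -mollify (dbarFactors e j) (zeroExt (g i)) ζ := fun i j => by
    have hΦ := wirtingerBar_prod_sub (fun i => (he i).differentiable (by simp)) j ζ
    rw [setIntegral_zeroExt_mul, mollify, ← integral_neg]
    refine integral_congr_ae (ae_of_all _ fun w => ?_)
    exact (congrArg _ (hΦ w)).trans (mul_neg ..)
  have key := hg l k (prodSubTestFunction he hs hζ)
  rwa [hpair, hpair, neg_inj] at key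

end Closedness

end Mollify

section HomotopyFormula

variable {m : ℕ} {ψ : ℂ → ℂ} {z : Fin m → ℂ} {e : Fin (m + 1) → ℂ → ℂ}
  {c : (Fin (m + 1) → ℂ) → ℂ}

theorem dbarFactors_comp_sub (e : Fin m → ℂ → ℂ) (w : Fin m → ℂ) (k j : Fin m) (ζ : ℂ) :
    dbarFactors (fun j ζ => e j (ζ - w j)) k j ζ = dbarFactors e k j (ζ - w j) := by
  rcases eq_or_ne j k with rfl | h
  · simp only [dbarFactors_same, sub_eq_add_neg]
    exact dbar_comp_add _ _ _
  · simp only [dbarFactors_of_ne h]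

theorem integral_pairKernel_succAbove_mul_mollify (hψ : ContDiff ℝ 1 ψ)
    (hψc : HasCompactSupport ψ) (hs : tsupport ψ ⊆ Metric.ball 0 1) (l : Fin (m + 1))
    (hz : ∀ j, ‖z j‖ ≤ 1) (k : Fin m) (hci : Integrable c) (he : ∀ j, ContDiff ℝ 1 (e j))
    (hc : ∀ j, HasCompactSupport (e j)) :
    ∫ q, pairKernel ψ l z (l.succAbove k) q * mollify e c (pairPoint l z q)
        ∂(discChainMeasure (m + 1)) =
      -∫ q, sliceKernel ψ z k q * mollify (dbarFactors e l) c (slicePoint l z q)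
        ∂((volume : Measure ℂ).prod (chainMeasure (Fin m))) := by
  rw [integral_mul_mollify (integrable_pairKernel hψ hψc l hz _) (measurable_pairPoint l z) hci
      (fun j => (he j).continuous) hc,
    integral_mul_mollify
      (integrable_sliceKernel (hψ.continuous.integrable_of_hasCompactSupport hψc) hz k)
      (measurable_slicePoint l z) hci (continuous_dbarFactors he l)
      (hasCompactSupport_dbarFactors hc l), ← integral_neg]
  refine integral_congr_ae (ae_of_all _ fun w => ?_)
  have h := integral_pairKernel_succAbove_mul_prod hψ hψc hs l hz k
    (e := fun j ζ => e j (ζ - w j)) (fun j => (he j).comp (by fun_prop))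
    (fun j => (hc j).comp_homeomorph (Homeomorph.subRight (w j)))
  simp only [dbarFactors_comp_sub] at h
  simp only [h, mul_neg]

theorem integral_pairKernel_same_mul_mollify (hψ : ContDiff ℝ 1 ψ)
    (hψc : HasCompactSupport ψ) (hs : tsupport ψ ⊆ Metric.ball 0 1) (l : Fin (m + 1))
    (hz : ∀ j, ‖z j‖ ≤ 1) (hci : Integrable c) (he : ∀ j, ContDiff ℝ 1 (e j))
    (hc : ∀ j, HasCompactSupport (e j)) :
    ∫ q, pairKernel ψ l z l q * mollify e c (pairPoint l z q) ∂(discChainMeasure (m + 1)) =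
      (∫ a, ψ a * mollify e c (l.insertNth (α := fun _ => ℂ) a z)) +
      ∑ k, ∫ q, sliceKernel ψ z k q * mollify (dbarFactors e (l.succAbove k)) c (slicePoint l z q)
        ∂((volume : Measure ℂ).prod (chainMeasure (Fin m))) := by
  have hψi := hψ.continuous.integrable_of_hasCompactSupport (μ := volume) hψc
  have hec := fun j => (he j).continuous
  have hpt : Measurable fun a => l.insertNth (α := fun _ => ℂ) a z :=
    measurable_insertNth l measurable_id measurable_const
  have hslice := fun k : Fin m => integrable_mul_integral_mul_prod_sub
    (integrable_sliceKernel hψi hz k) (measurable_slicePoint l z) hci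
    (continuous_dbarFactors he (l.succAbove k)) (hasCompactSupport_dbarFactors hc (l.succAbove k))
  rw [integral_mul_mollify (integrable_pairKernel hψ hψc l hz l) (measurable_pairPoint l z) hci
      hec hc, integral_mul_mollify hψi hpt hci hec hc,
    Finset.sum_congr rfl fun k _ => integral_mul_mollify (integrable_sliceKernel hψi hz k)
      (measurable_slicePoint l z) hci (continuous_dbarFactors he (l.succAbove k))
      (hasCompactSupport_dbarFactors hc (l.succAbove k)),
    ← integral_finsetSum _ fun k _ => hslice k,
    ← integral_add (integrable_mul_integral_mul_prod_sub hψi hpt hci hec hc)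
      (integrable_finsetSum _ fun k _ => hslice k)]
  refine integral_congr_ae (ae_of_all _ fun w => ?_)
  have h := integral_pairKernel_same_mul_prod_eq_add hψ hψc hs l hz
    (e := fun j ζ => e j (ζ - w j)) (fun j => (he j).comp (by fun_prop))
    (fun j => (hc j).comp_homeomorph (Homeomorph.subRight (w j)))
  simp only [dbarFactors_comp_sub] at h
  simp only [h, mul_add, Finset.mul_sum]

theorem norm_slicePoint_le {R : ℝ} (hs : tsupport ψ ⊆ Metric.closedBall 0 R)
    (l : Fin (m + 1)) (hz : ∀ j, ‖z j‖ ≤ R) {k : Fin m} {q : ℂ × ℝ × (Fin m → ℝ)}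
    (hq : 0 ≤ q.2.1) (h : sliceKernel ψ z k q ≠ 0) (j : Fin (m + 1)) :
    ‖slicePoint l z q j‖ ≤ R := by
  have hle : q.2.1 ≤ ‖q.1‖ := by
    by_contra hlt
    exact h (if_neg hlt)
  have hψ : ψ q.1 ≠ 0 := fun hψ => h (by simp [sliceKernel, hψ])
  have haR : ‖q.1‖ ≤ R := mem_closedBall_zero_iff.1 (hs (subset_tsupport _ hψ))
  revert j
  refine (Fin.forall_iff_succAbove l).2 ⟨?_, fun j => ?_⟩
  · rwa [slicePoint, Fin.insertNth_apply_same]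
  · rw [slicePoint, Fin.insertNth_apply_succAbove]
    exact (norm_chainCoord_le hq _ _).trans (max_le (hle.trans haR) (hz j))

theorem sum_integral_pairKernel_mul_mollify {g : Fin (m + 1) → polydisc (m + 1) → ℂ}
    (hg : IsDbarClosed g) (hgi : ∀ k, Integrable (zeroExt (g k))) (hψ : ContDiff ℝ 1 ψ)
    (hψc : HasCompactSupport ψ) {R ε : ℝ} (hs : tsupport ψ ⊆ Metric.closedBall 0 R)
    (hε : 0 ≤ ε) (hR : R + ε < 1) (l : Fin (m + 1)) (hz : ∀ j, ‖z j‖ ≤ R)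
    (he : ∀ j, ContDiff ℝ (⊤ : ℕ∞) (e j)) (hes : ∀ j, tsupport (e j) ⊆ Metric.closedBall 0 ε) :
    ∑ k, ∫ q, pairKernel ψ l z k q * mollify e (zeroExt (g k)) (pairPoint l z q)
        ∂(discChainMeasure (m + 1)) =
      ∫ a, ψ a * mollify e (zeroExt (g l)) (l.insertNth (α := fun _ => ℂ) a z) := by
  have hs' : tsupport ψ ⊆ Metric.ball 0 1 :=
    hs.trans (Metric.closedBall_subset_ball (by linarith))
  have hz' : ∀ j, ‖z j‖ ≤ 1 := fun j => by linarith [hz j]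
  have he' : ∀ j, ContDiff ℝ 1 (e j) := fun j => (he j).of_le (by simp)
  have hec : ∀ j, HasCompactSupport (e j) := fun j =>
    (isCompact_closedBall (0 : ℂ) ε).of_isClosed_subset (isClosed_tsupport _) (hes j)
  have hclosed : ∀ k, ∫ q, sliceKernel ψ z k q *
        mollify (dbarFactors e l) (zeroExt (g (l.succAbove k))) (slicePoint l z q)
          ∂((volume : Measure ℂ).prod (chainMeasure (Fin m))) =
      ∫ q, sliceKernel ψ z k q *
        mollify (dbarFactors e (l.succAbove k)) (zeroExt (g l)) (slicePoint l z q)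
          ∂((volume : Measure ℂ).prod (chainMeasure (Fin m))) := fun k => by
    refine integral_congr_ae ?_
    filter_upwards [Measure.quasiMeasurePreserving_snd.ae (ae_fst_mem_Ioo (ι := Fin m))] with q hq
    rcases eq_or_ne (sliceKernel ψ z k q) 0 with h | h
    · simp only [h, zero_mul]
    · rw [mollify_dbarFactors_comm hg he hes (fun j => ?_)]
      linarith [norm_slicePoint_le hs l hz hq.1.le h j]
  simp only [Fin.sum_univ_succAbove _ l, hclosed, Finset.sum_neg_distrib,
    integral_pairKernel_same_mul_mollify hψ hψc hs' l hz' (hgi l) he' hec,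
    integral_pairKernel_succAbove_mul_mollify hψ hψc hs' l hz' _ (hgi _) he' hec,
    add_neg_cancel_right]

end HomotopyFormula

section ProductBump

open Filter Topology
open scoped Convolution

variable {n : ℕ}

/-- The product of the normalised bump function `φ` in each of the `n` variables: a smooth
probability density whose support is the open polydisc of radius `φ.rOut`. -/
def bumpProd (φ : ContDiffBump (0 : ℂ)) (ζ : Fin n → ℂ) : ℝ :=
  ∏ j, φ.normed volume (ζ j)

theorem continuous_bumpProd (φ : ContDiffBump (0 : ℂ)) :
    Continuous (bumpProd φ : (Fin n → ℂ) → ℝ) :=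
  continuous_finsetProd _ fun j _ => φ.continuous_normed.comp (continuous_apply j)

theorem bumpProd_nonneg (φ : ContDiffBump (0 : ℂ)) (ζ : Fin n → ℂ) : 0 ≤ bumpProd φ ζ :=
  Finset.prod_nonneg fun _ _ => φ.nonneg_normed _

theorem integral_bumpProd (φ : ContDiffBump (0 : ℂ)) : ∫ ζ : Fin n → ℂ, bumpProd φ ζ = 1 := by
  simp only [bumpProd, integral_fintype_prod_volume_eq_prod fun (_ : Fin n) a => φ.normed volume a,
    φ.integral_normed, Finset.prod_const_one]

theorem support_bumpProd_subset (φ : ContDiffBump (0 : ℂ)) :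
    Function.support (bumpProd φ : (Fin n → ℂ) → ℝ) ⊆ Metric.ball 0 φ.rOut := fun ζ hζ => by
  rw [mem_ball_zero_iff, pi_norm_lt_iff φ.rOut_pos]
  intro j
  have hj : ζ j ∈ Function.support (φ.normed volume) := Finset.prod_ne_zero_iff.1 hζ j (by simp)
  rwa [φ.support_normed_eq, mem_ball_zero_iff] at hj

theorem hasCompactSupport_bumpProd (φ : ContDiffBump (0 : ℂ)) :
    HasCompactSupport (bumpProd φ : (Fin n → ℂ) → ℝ) :=
  .of_support_subset_isCompact (isCompact_closedBall 0 φ.rOut)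
    ((support_bumpProd_subset φ).trans Metric.ball_subset_closedBall)

theorem exists_contDiffBump_seq :
    ∃ φ : ℕ → ContDiffBump (0 : ℂ), Tendsto (fun N => (φ N).rOut) atTop (𝓝 0) := by
  obtain ⟨r, -, hr, hlim⟩ := exists_seq_strictAnti_tendsto (0 : ℝ)
  exact ⟨fun N => ⟨r N / 2, r N, half_pos (hr N), half_lt_self (hr N)⟩, hlim⟩

/-- The mollification of `c` by `bumpProd φ`. -/
def bumpMollify (φ : ContDiffBump (0 : ℂ)) (c : (Fin n → ℂ) → ℂ) : (Fin n → ℂ) → ℂ :=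
  mollify (fun _ a => (φ.normed volume a : ℂ)) c

variable {c : (Fin n → ℂ) → ℂ}

theorem bumpMollify_eq_convolution (φ : ContDiffBump (0 : ℂ)) (c : (Fin n → ℂ) → ℂ) :
    bumpMollify φ c = bumpProd φ ⋆[ContinuousLinearMap.lsmul ℝ ℝ, volume] c := by
  ext ζ
  rw [convolution_lsmul_swap]
  refine integral_congr_ae (ae_of_all _ fun w => ?_)
  simp only [bumpProd, Pi.sub_apply, Complex.real_smul, Complex.ofReal_prod, mul_comm (c w)]

theorem continuous_bumpMollify (φ : ContDiffBump (0 : ℂ)) (hc : Integrable c) :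
    Continuous (bumpMollify φ c) := by
  rw [bumpMollify_eq_convolution]
  exact (hasCompactSupport_bumpProd φ).continuous_convolution_left _ (continuous_bumpProd φ)
    hc.locallyIntegrable

theorem norm_bumpMollify_le (φ : ContDiffBump (0 : ℂ)) (hc : Integrable c) {M : ℝ}
    (hM : ∀ ζ, ‖c ζ‖ ≤ M) (ζ : Fin n → ℂ) : ‖bumpMollify φ c ζ‖ ≤ M := by
  rw [bumpMollify_eq_convolution, ← dist_zero_right]
  exact dist_convolution_le ((norm_nonneg _).trans (hM 0)) (support_bumpProd_subset φ)
    (bumpProd_nonneg φ) (integral_bumpProd φ) hc.aestronglyMeasurable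
    fun w _ => (dist_zero_right (c w)).trans_le (hM w)

variable {ι : Type*} {u : Filter ι} {φ : ι → ContDiffBump (0 : ℂ)}

theorem tendsto_bumpMollify (hφ : Tendsto (fun i => (φ i).rOut) u (𝓝 0)) (hc : Integrable c)
    {ζ : Fin n → ℂ} (hζ : ContinuousAt c ζ) :
    Tendsto (fun i => bumpMollify (φ i) c ζ) u (𝓝 (c ζ)) := by
  simp only [bumpMollify_eq_convolution]
  refine convolution_tendsto_right (.of_forall fun i => bumpProd_nonneg (φ i))
    (.of_forall fun i => integral_bumpProd (φ i)) ?_ (.of_forall fun _ => hc.aestronglyMeasurable)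
    (hζ.tendsto.comp tendsto_snd) tendsto_const_nhds
  refine tendsto_smallSets_iff.2 fun s hs => ?_
  obtain ⟨δ, hδ, hsub⟩ := Metric.mem_nhds_iff.1 hs
  filter_upwards [hφ.eventually (gt_mem_nhds hδ)] with i hi
  exact ((support_bumpProd_subset (φ i)).trans (Metric.ball_subset_ball hi.le)).trans hsub

theorem tendsto_integral_mul_bumpMollify [u.IsCountablyGenerated] {Ω : Type*} [MeasurableSpace Ω]
    {μ : Measure Ω} {a : Ω → ℂ} {pt : Ω → Fin n → ℂ}
    (hφ : Tendsto (fun i => (φ i).rOut) u (𝓝 0)) (ha : Integrable a μ) (hpt : Measurable pt)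
    (hc : Integrable c) {M : ℝ} (hM : ∀ ζ, ‖c ζ‖ ≤ M)
    (hcont : ∀ᵐ x ∂μ, a x ≠ 0 → ContinuousAt c (pt x)) :
    Tendsto (fun i => ∫ x, a x * bumpMollify (φ i) c (pt x) ∂μ) u (𝓝 (∫ x, a x * c (pt x) ∂μ)) := by
  refine tendsto_integral_filter_of_dominated_convergence (fun x => ‖a x‖ * M)
    (.of_forall fun i => ha.aestronglyMeasurable.mul
      ((continuous_bumpMollify (φ i) hc).measurable.comp hpt).aestronglyMeasurable)
    (.of_forall fun i => ae_of_all _ fun x => ?_) (ha.norm.mul_const M) ?_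
  · rw [norm_mul]
    gcongr
    exact norm_bumpMollify_le (φ i) hc hM _
  · filter_upwards [hcont] with x hx
    rcases eq_or_ne (a x) 0 with h | h
    · simpa only [h, zero_mul] using tendsto_const_nhds
    · exact (tendsto_bumpMollify hφ hc (hx h)).const_mul _

end ProductBump

section SliceEquation

open Filter Topology

theorem exists_lt_one_subset_closedBall {ι : Type*} [Finite ι] {K : Set ℂ} (hK : IsClosed K)
    (hs : K ⊆ Metric.ball 0 1) {z : ι → ℂ} (hz : ∀ j, ‖z j‖ < 1) :
    ∃ R < 1, K ⊆ Metric.closedBall 0 R ∧ ∀ j, ‖z j‖ ≤ R := by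
  have hz' : range z ⊆ Metric.ball 0 1 := range_subset_iff.2 fun j => mem_ball_zero_iff.2 (hz j)
  obtain ⟨R, hR, hsub⟩ := exists_lt_subset_ball (hK.union (finite_range z).isClosed)
    (union_subset hs hz')
  have hsub' := hsub.trans Metric.ball_subset_closedBall
  exact ⟨R, hR, subset_union_left.trans hsub', fun j =>
    mem_closedBall_zero_iff.1 (hsub' (Or.inr (mem_range_self j)))⟩

variable {n m : ℕ}

theorem integrable_zeroExt {f : polydisc n → ℂ} (hf : Continuous f) {M : ℝ}
    (hM : ∀ z, ‖zeroExt f z‖ ≤ M) : Integrable (zeroExt f) := by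
  have hfin : volume (polydisc n : Set (Fin n → ℂ)) < ⊤ := by
    refine ((Metric.isBounded_ball (x := (0 : Fin n → ℂ)) (r := 2)).subset
      fun z hz => ?_).measure_lt_top
    rw [mem_ball_zero_iff, pi_norm_lt_iff two_pos]
    exact fun j => (hz j).trans one_lt_two
  refine (integrableOn_iff_integrable_of_support_subset fun z hz => ?_).1
    (Measure.integrableOn_of_bounded hfin.ne (measurable_zeroExt hf).aestronglyMeasurable
      (ae_of_all _ hM))
  by_contra hn
  exact hz (zeroExt_of_notMem f hn)

theorem continuousAt_zeroExt {f : polydisc n → ℂ} (hf : Continuous f) {ζ : Fin n → ℂ}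
    (hζ : ζ ∈ polydisc n) : ContinuousAt (zeroExt f) ζ :=
  (continuousOn_zeroExt hf).continuousAt ((polydisc n).isOpen.mem_nhds hζ)

theorem ae_pairPoint_mem_polydisc (l : Fin (m + 1)) {z : Fin m → ℂ} (hz : z ∈ polydisc m) :
    ∀ᵐ q ∂(discChainMeasure (m + 1)), pairPoint l z q ∈ polydisc (m + 1) := by
  filter_upwards [Measure.quasiMeasurePreserving_fst.ae (ae_restrict_mem measurableSet_ball),
    Measure.quasiMeasurePreserving_snd.ae ae_fst_mem_Ioo] with q hq₁ hq₂
  exact chainPoint_mem_polydisc (insertNth_mem_polydisc l (mem_ball_zero_iff.1 hq₁) hz) hq₂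

variable {g : Fin (m + 1) → polydisc (m + 1) → ℂ} {M : Fin (m + 1) → ℝ} {ψ : ℂ → ℂ} {z : Fin m → ℂ}

theorem sum_integral_pairKernel_mul_zeroExt (hg : IsDbarClosed g) (hgc : ∀ k, Continuous (g k))
    (hM : ∀ k z, ‖zeroExt (g k) z‖ ≤ M k) (hψ : ContDiff ℝ 1 ψ) (hψc : HasCompactSupport ψ)
    (hs : tsupport ψ ⊆ Metric.ball 0 1) (l : Fin (m + 1)) (hz : z ∈ polydisc m) :
    ∑ k, ∫ q, pairKernel ψ l z k q * zeroExt (g k) (pairPoint l z q)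
        ∂(discChainMeasure (m + 1)) =
      ∫ a, ψ a * zeroExt (g l) (l.insertNth (α := fun _ => ℂ) a z) := by
  obtain ⟨R, hR, hsR, hzR⟩ := exists_lt_one_subset_closedBall (isClosed_tsupport ψ) hs hz
  obtain ⟨φ, hφ⟩ := exists_contDiffBump_seq
  have hgi := fun k => integrable_zeroExt (hgc k) (hM k)
  have hmollified : ∀ᶠ N in atTop,
      ∑ k, ∫ q, pairKernel ψ l z k q * bumpMollify (φ N) (zeroExt (g k)) (pairPoint l z q)
          ∂(discChainMeasure (m + 1)) =
        ∫ a, ψ a * bumpMollify (φ N) (zeroExt (g l)) (l.insertNth (α := fun _ => ℂ) a z) := by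
    filter_upwards [hφ.eventually (gt_mem_nhds (sub_pos.2 hR))] with N hN
    refine sum_integral_pairKernel_mul_mollify hg hgi hψ hψc hsR (φ N).rOut_pos.le
      (by linarith) l hzR (fun _ => Complex.ofRealCLM.contDiff.comp (φ N).contDiff_normed)
      fun _ => ?_
    exact (closure_mono (Function.support_comp_subset Complex.ofReal_zero _)).trans
      (φ N).tsupport_normed_eq.subset
  have hsum := tendsto_finsetSum Finset.univ fun k _ => tendsto_integral_mul_bumpMollify hφ
    (integrable_pairKernel hψ hψc l (norm_le_one_of_mem_polydisc hz) k) (measurable_pairPoint l z)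
    (hgi k) (hM k) <| (ae_pairPoint_mem_polydisc l hz).mono fun q hq _ =>
      continuousAt_zeroExt (hgc k) hq
  have hslice := tendsto_integral_mul_bumpMollify hφ
    (hψ.continuous.integrable_of_hasCompactSupport (μ := volume) hψc)
    (measurable_insertNth l measurable_id measurable_const) (hgi l) (hM l) <|
      ae_of_all _ fun a ha => continuousAt_zeroExt (hgc l) <|
        insertNth_mem_polydisc l (mem_ball_zero_iff.1 (hs (subset_tsupport _ ha))) hz
  exact tendsto_nhds_unique hsum (hslice.congr' (hmollified.mono fun N hN => hN.symm))

theorem integral_zeroExt_henkin_mul_dbar (hg : IsDbarClosed g) (hgc : ∀ k, Continuous (g k))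
    (hM : ∀ k z, ‖zeroExt (g k) z‖ ≤ M k) (hψ : ContDiff ℝ 1 ψ) (hψc : HasCompactSupport ψ)
    (hs : tsupport ψ ⊆ Metric.ball 0 1) (l : Fin (m + 1)) (hz : z ∈ polydisc m) :
    ∫ a, zeroExt (henkin g) (l.insertNth (α := fun _ => ℂ) a z) * dbar ψ a =
      -∫ a, zeroExt (g l) (l.insertNth (α := fun _ => ℂ) a z) * ψ a := by
  have hgm := fun k => measurable_zeroExt (hgc k)
  have hint : ∀ k, Integrable (fun q => pairKernel ψ l z k q * zeroExt (g k) (pairPoint l z q))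
      (discChainMeasure (m + 1)) := fun k =>
    (integrable_pairKernel hψ hψc l (norm_le_one_of_mem_polydisc hz) k).mul_bdd
      ((hgm k).comp (measurable_pairPoint l z)).aestronglyMeasurable (ae_of_all _ fun _ => hM k _)
  have hdensity : ∀ q, ∑ k, pairKernel ψ l z k q * zeroExt (g k) (pairPoint l z q) =
      dbar ψ q.1 * henkinDensity (fun k => zeroExt (g k)) (l.insertNth q.1 z) q.2 := fun q => by
    simp only [henkinDensity, pairKernel, pairPoint, Finset.mul_sum]
    exact Finset.sum_congr rfl fun k _ => by ring
  have hsum := sum_integral_pairKernel_mul_zeroExt hg hgc hM hψ hψc hs l hz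
  have hint' := integrable_finsetSum Finset.univ fun k _ => hint k
  rw [← integral_finsetSum _ fun k _ => hint k] at hsum
  simp only [hdensity] at hsum hint'
  rw [discChainMeasure, integral_prod _ hint'] at hsum
  simp only [mul_comm (zeroExt (g l) _)]
  rw [← integral_ball_dbar_mul hs fun a => zeroExt (henkin g) (l.insertNth a z), ← hsum,
    ← integral_neg]
  refine setIntegral_congr_fun measurableSet_ball fun a ha => ?_
  have hmem := insertNth_mem_polydisc l (mem_ball_zero_iff.1 ha) hz
  simp only [zeroExt_of_mem _ hmem, integral_const_mul, ← mul_neg]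
  rw [henkin_eq_neg_integral
    (integrable_henkinDensity hgm hM (norm_le_one_of_mem_polydisc hmem))]

end SliceEquation

/-! ### The equation and the bound for the operator -/

section SeveralVariables

variable {m n : ℕ}

theorem contDiff_insertNth (l : Fin (m + 1)) (z : Fin m → ℂ) {k : WithTop ℕ∞} :
    ContDiff ℝ k fun a => l.insertNth (α := fun _ => ℂ) a z :=
  contDiff_pi.2 <| (Fin.forall_iff_succAbove l).2
    ⟨by simpa using contDiff_fun_id, fun j => by simpa using contDiff_const⟩

theorem integral_eq_integral_insertNth (l : Fin (m + 1)) {F : (Fin (m + 1) → ℂ) → ℂ}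
    (hF : Integrable F) : ∫ w, F w = ∫ z, ∫ a, F (l.insertNth a z) := by
  have h := (volume_preserving_piFinSuccAbove (fun _ : Fin (m + 1) => ℂ) l).symm
  exact (h.integral_comp' F).symm.trans (integral_prod_symm _ (h.integrable_comp_of_integrable hF))

theorem wirtingerBar_insertNth {φ : (Fin (m + 1) → ℂ) → ℂ} (hφ : Differentiable ℝ φ)
    (l : Fin (m + 1)) (a : ℂ) (z : Fin m → ℂ) :
    wirtingerBar l φ (l.insertNth a z) = dbar (fun b => φ (l.insertNth b z)) a := by
  simp only [wirtingerBar_eq_dbar (hφ _) l, Fin.update_insertNth, Fin.insertNth_apply_same]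

theorem insertNth_mem_tsupport (φ : (Fin (m + 1) → ℂ) → ℂ) (l : Fin (m + 1)) (z : Fin m → ℂ)
    {a : ℂ} (ha : a ∈ tsupport fun b => φ (l.insertNth b z)) :
    l.insertNth (α := fun _ => ℂ) a z ∈ tsupport φ :=
  tsupport_comp_subset_preimage φ (contDiff_insertNth (k := 0) l z).continuous ha

theorem hasCompactSupport_comp_insertNth {φ : (Fin (m + 1) → ℂ) → ℂ} (hφ : HasCompactSupport φ)
    (l : Fin (m + 1)) (z : Fin m → ℂ) : HasCompactSupport fun a => φ (l.insertNth a z) :=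
  (hφ.image (continuous_apply l)).of_isClosed_subset (isClosed_tsupport _) fun a ha =>
    ⟨l.insertNth a z, insertNth_mem_tsupport φ l z ha, by simp⟩

theorem integrable_zeroExt_mul {f : polydisc n → ℂ} {F : (Fin n → ℂ) → ℂ}
    (h : IntegrableOn (fun z => zeroExt f z * F z) (polydisc n : Set (Fin n → ℂ))) :
    Integrable fun z => zeroExt f z * F z := by
  refine (integrableOn_iff_integrable_of_support_subset fun z hz => ?_).1 h
  by_contra hn
  exact hz (by simp only [zeroExt_of_notMem f hn, zero_mul])

theorem integral_slice_zeroExt_henkin_mul_wirtingerBar {g : Fin (m + 1) → polydisc (m + 1) → ℂ}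
    (hg : IsDbarClosed g) (hgc : ∀ k, Continuous (g k)) {M : Fin (m + 1) → ℝ}
    (hM : ∀ k z, ‖zeroExt (g k) z‖ ≤ M k) (l : Fin (m + 1)) (φ : 𝓓(polydisc (m + 1), ℂ))
    (z : Fin m → ℂ) :
    ∫ a, zeroExt (henkin g) (l.insertNth (α := fun _ => ℂ) a z) *
        wirtingerBar l φ (l.insertNth a z) =
      -∫ a, zeroExt (g l) (l.insertNth (α := fun _ => ℂ) a z) * φ (l.insertNth a z) := by
  by_cases hz : z ∈ polydisc m
  · simp only [wirtingerBar_insertNth (φ.contDiff.differentiable (by simp)) l _ z]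
    refine integral_zeroExt_henkin_mul_dbar hg hgc hM
      ((φ.contDiff.of_le (by simp)).comp (contDiff_insertNth l z))
      (hasCompactSupport_comp_insertNth φ.hasCompactSupport l z) (fun a ha => ?_) l hz
    have hmem := φ.tsupport_subset (insertNth_mem_tsupport φ l z ha) l
    rwa [Fin.insertNth_apply_same, ← mem_ball_zero_iff] at hmem
  · have hoff : ∀ a, l.insertNth (α := fun _ => ℂ) a z ∉ polydisc (m + 1) := fun a h =>
      hz fun j => by simpa using h (l.succAbove j)
    simp only [zeroExt_of_notMem _ (hoff _), zero_mul, integral_zero, neg_zero]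

theorem isDbarSolution_henkin {g : Fin n → polydisc n → ℂ} (hg : IsDbarClosed g)
    (hgc : ∀ k, Continuous (g k)) {M : Fin n → ℝ} (hM : ∀ k z, ‖zeroExt (g k) z‖ ≤ M k)
    (hu : Continuous (henkin g)) : IsDbarSolution (henkin g) g := by
  intro l φ
  cases n with
  | zero => exact l.elim0
  | succ m =>
    obtain ⟨A, hA⟩ := φ.continuous.bounded_above_of_compact_support φ.hasCompactSupport
    have hφ : Integrable fun w => zeroExt (g l) w * φ w :=
      (integrable_zeroExt (hgc l) (hM l)).mul_bdd φ.continuous.aestronglyMeasurable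
        (ae_of_all _ hA)
    rw [setIntegral_zeroExt_mul, setIntegral_zeroExt_mul, integral_eq_integral_insertNth l hφ,
      integral_eq_integral_insertNth l
        (integrable_zeroExt_mul (integrable_zeroExt_mul_wirtingerBar hu l φ)), ← integral_neg]
    simp only [integral_slice_zeroExt_henkin_mul_wirtingerBar hg hgc hM l φ]

end SeveralVariables

section Operator

variable {n : ℕ} {α : ℝ≥0} {g h : Fin n → polydisc n → ℂ}

theorem henkin_add (hα0 : 0 < α) (hg : ∀ k, MemHolder α (g k)) (hh : ∀ k, MemHolder α (h k)) :
    henkin (g + h) = henkin g + henkin h := by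
  funext z
  have hgi := integrable_henkinDensity_zeroExt hα0 hg z.2
  have hhi := integrable_henkinDensity_zeroExt hα0 hh z.2
  have hghi := integrable_henkinDensity_zeroExt hα0 (fun k => (hg k).add (hh k)) z.2
  rw [Pi.add_apply, henkin_eq_neg_integral (g := g + h) hghi, henkin_eq_neg_integral hgi,
    henkin_eq_neg_integral hhi, ← neg_add, ← integral_add hgi hhi]
  simp only [henkinDensity, Pi.add_apply, zeroExt_add, mul_add, Finset.sum_add_distrib]

theorem henkin_smul (hα0 : 0 < α) (c : ℂ) (hg : ∀ k, MemHolder α (g k)) :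
    henkin (c • g) = c • henkin g := by
  funext z
  have hgi := integrable_henkinDensity_zeroExt hα0 hg z.2
  have hcgi := integrable_henkinDensity_zeroExt hα0 (fun k => (hg k).smul (c := c)) z.2
  rw [Pi.smul_apply, henkin_eq_neg_integral (g := c • g) hcgi, henkin_eq_neg_integral hgi,
    smul_neg, ← integral_smul]
  simp only [henkinDensity, Pi.smul_apply, zeroExt_smul, smul_eq_mul, Finset.mul_sum,
    mul_left_comm c]

theorem memHolder_and_holderNorm_le {f : polydisc n → ℂ} {B : ℝ} (hB : ∀ z, ‖f z‖ ≤ B)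
    (hH : ∀ z w, ‖f z - f w‖ ≤ B * dist z w ^ (α : ℝ)) :
    MemHolder α f ∧ holderNorm α f ≤ 2 * B := by
  have hB0 : 0 ≤ B := (norm_nonneg _).trans (hB (Classical.arbitrary _))
  have hw : HolderWith B.toNNReal α f := fun z w => by
    rw [edist_nndist, edist_nndist, ← ENNReal.coe_rpow_of_nonneg _ α.coe_nonneg, ← ENNReal.coe_mul,
      ENNReal.coe_le_coe, ← NNReal.coe_le_coe]
    push_cast
    rw [dist_eq_norm, Real.coe_toNNReal _ hB0]
    exact hH z w
  have hsemi : (nnHolderNorm α f : ℝ) ≤ B := by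
    simpa only [Real.coe_toNNReal _ hB0] using NNReal.coe_le_coe.2 hw.nnholderNorm_le
  refine ⟨hw.memHolder, ?_⟩
  rw [holderNorm, two_mul]
  exact add_le_add (ciSup_le hB) hsemi

theorem exists_holderNorm_henkin_le (n : ℕ) (hα0 : 0 < α) (hα1 : α < 1) :
    ∃ C : ℝ, ∀ g : Fin n → polydisc n → ℂ, (∀ k, MemHolder α (g k)) →
      MemHolder α (henkin g) ∧ holderNorm α (henkin g) ≤ C * formHolderNorm α g := by
  obtain ⟨C₁, hC₁⟩ := exists_norm_henkin_le n
  obtain ⟨C₂, hC₂⟩ := exists_norm_henkin_sub_le n hα1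
  refine ⟨2 * max C₁ C₂, fun g hg => ?_⟩
  have hN := formHolderNorm_nonneg α g
  rw [mul_assoc]
  refine memHolder_and_holderNorm_le (fun z => (hC₁ hα0 g hg z).trans ?_)
    fun z w => (hC₂ g hα0 hg z w).trans ?_
  · gcongr
    exact le_max_left _ _
  · gcongr
    exact le_max_right _ _

end Operator

end Henkin

end

theorem theorem3 (n : ℕ) (α : ℝ≥0) (hα₀ : 0 < α) (hα₁ : α < 1) :
    (∀ g ∈ closedForms n α hα₀, ∀ (z : polydisc n) (J : Finset (Fin n)), J ≠ Finset.univ →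
      IntegrableOn (henkinIntegrand g J z) (henkinRegion J (z : Fin n → ℂ))) ∧
    ∃ H : closedForms n α hα₀ →ₗ[ℂ] holderSpace n α,
      (∀ (g : closedForms n α hα₀) (z : polydisc n), (H g).1 z = henkin g.1 z) ∧
      (∀ g : closedForms n α hα₀, IsDbarSolution (H g).1 g.1) ∧
      ∃ C : ℝ, ∀ g : closedForms n α hα₀,
        holderNorm α (H g).1 ≤ C * formHolderNorm α g.1 := by
  obtain ⟨C, hC⟩ := Henkin.exists_holderNorm_henkin_le n hα₀ hα₁
  refine ⟨fun g hg z J _ => Henkin.integrableOn_henkinIntegrand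
      (Henkin.integrable_henkinDensity_zeroExt hα₀ hg.1 z.2) J,
    { toFun := fun g => ⟨henkin g.1, (hC g.1 g.2.1).1⟩
      map_add' := fun g h => Subtype.ext (Henkin.henkin_add hα₀ g.2.1 h.2.1)
      map_smul' := fun c g => Subtype.ext (Henkin.henkin_smul hα₀ c g.2.1) },
    fun _ _ => rfl, fun g => ?_, C, fun g => (hC g.1 g.2.1).2⟩
  exact Henkin.isDbarSolution_henkin g.2.2 (fun k => (g.2.1 k).holderWith.continuous hα₀)
    (fun k => Henkin.norm_zeroExt_le (g.2.1 k)) ((hC g.1 g.2.1).1.holderWith.continuous hα₀)
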